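/- Let $K\ge 2$, $\gamma>0$, let $c_1<\dots<c_{K-1}$ be equally spaced nodes in $[0,1]$ (for instance $c_j=\frac{j-1}{K-2}$ if $K\ge 3$; for $K=2$ a single node), with Lagrange basis polynomials $\ell_j$, and let $L_1,\dots,L_{K-1}$ be real numbers. Let $D=\operatorname{diag}(0,\dots,0,\gamma)\otimes I_d$ and $Q=Q_0\otimes I_d$ with $Q_0\in\mathbb R^{K\times K}$ skew-symmetric and tridiagonal with superdiagonal $(-1,-\gamma,\dots,-\gamma)$ and subdiagonal $(1,\gamma,\dots,\gamma)$. Points of $\mathbb R^{Kd}$ are written $x=(x_1,\dots,x_K)$ with $x_k\in\mathbb R^d$. Let $U:\mathbb R^d\to\mathbb R$ be of class $C^K$ with $U(0)=0$, $\nabla U(0)=0$, with $$\tfrac m2\|x'-x\|^2\le U(x')-U(x)-\langle\nabla U(x),x'-x\rangle\le \tfrac L2\|x'-x\|^2\qquad(x,x'\in\mathbb R^d)$$ for some constants $0<m\le L$, and with $\|D^i\nabla U(x)\|_{\mathrm{tsr}}\le L_i$ for all $x$ and $1\le i\le K-1$, where $\|T\|_{\mathrm{tsr}}=\sup\|T[v_1,\dots,v_i]\|$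 over unit vectors $v_1,\dots,v_i$ for an $i$-linear map $T$ with values in $\mathbb R^d$. Let $B$ be a standard Brownian motion in $\mathbb R^{Kd}$ and $h>0$. For a path $X$ on $[0,h]$ put $P(s;X)=\sum_{j=1}^{K-1}\ell_j(s/h)\,\nabla U(X_1(c_jh))$. For $n\ge0$ and $y\in\mathbb R^{Kd}$ let $\widehat{\mathcal T}_y[X]=\tilde X$ be the continuous path on $[0,h]$ solving $$\tilde X(t)=y-\int_0^t (D+Q)\bigl(P(s;X),\tilde X_2(s),\dots,\tilde X_K(s)\bigr)\,ds+\sqrt{2D}\,\bigl(B_{nh+t}-B_{nh}\bigr),\qquad 0\le t\le h.$$ The algorithm with $\nu_*\ge0$ Picard iterations per step starts at $\widehat X(0)=0$ and sets $\widehat X((n+1)h)=\widehat X^{[\nu_*]}(h)$, where $\widehat X^{[0]}\equiv y:=\widehat X(nh)$ and $\widehat X^{[\nu+1]}=\widehat{\mathcal T}_y[\widehat X^{[\nu]}]$. Let $\widehat X^\ast$ be the fixed point of $\widehat{\mathcal T}_y$ for $y=\widehat X(nh)$, and $$I_U:=\sup_{s\in[0,h]}\bigl\|\nabla U(\widehat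 X^\ast_1(s))-P(s;\widehat X^\ast)\bigr\|^2 .$$ Then there is a constant $C_{\mathrm{IR}}>0$ depending only on $K$, $L_1,\dots,L_{K-1}$, $\{c_j\}$ and $\gamma$, and a threshold $h''>0$ depending only on these quantities and on $m,L$ (in particular not on $d$, $U$, $n$, $N$, $\nu_*$), such that for all $0<h\le h''$, all $N\ge1$, and uniformly for $n=0,1,\dots,N-1$, $$\mathbb E\,I_U\;\le\;C_{\mathrm{IR}}\,N\,h^{2K-2}\,d^{K-1}.$$ -/

import Mathlib

open MeasureTheory ProbabilityTheory Set
open scoped ENNReal NNReal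

noncomputable section

namespace HigherOrderLangevin

/-- A point of `ℝ^{Kd}`, written as `K` blocks in `ℝ^d`; block `0` is the variable of interest.
Only the vector space structure and the topology of this space are used below. -/
abbrev State (K d : ℕ) : Type := Fin K → EuclideanSpace ℝ (Fin d)

/-! ### Assumptions on the potential -/

/-- `m`-strong convexity and `L`-smoothness. -/
def StronglyConvexSmooth {d : ℕ} (U : EuclideanSpace ℝ (Fin d) → ℝ) (m L : ℝ) : Prop :=
  ∀ x x' : EuclideanSpace ℝ (Fin d),
    m / 2 * ‖x' - x‖ ^ 2 ≤ U x' - U x - inner ℝ (gradient U x) (x' - x) ∧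
    U x' - U x - inner ℝ (gradient U x) (x' - x) ≤ L / 2 * ‖x' - x‖ ^ 2

/-- `U` is of class `C^K` and, for `1 ≤ i ≤ K - 1`, the `i`-th derivative of `∇U` is bounded by
`L_i = Λ (i - 1)`. The norm is the operator norm of an `i`-linear map into `ℝ^d`, which is
the tensor spectral norm. -/
def HigherOrderSmooth {d : ℕ} (K : ℕ) (U : EuclideanSpace ℝ (Fin d) → ℝ)
    (Λ : Fin (K - 1) → ℝ) : Prop :=
  ContDiff ℝ K U ∧
  ∀ (i : Fin (K - 1)) (x : EuclideanSpace ℝ (Fin d)),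
    ‖iteratedFDeriv ℝ ((i : ℕ) + 1) (gradient U) x‖ ≤ Λ i

/-- `U` is centered. -/
def Centered {d : ℕ} (U : EuclideanSpace ℝ (Fin d) → ℝ) : Prop :=
  gradient U 0 = 0 ∧ U 0 = 0

/-! ### The matrices of the `K`-th order Langevin dynamics -/

/-- `D = diag(0, …, 0, γ)`, before tensoring with `I_d`. -/
def dampingMatrix (K : ℕ) (γ : ℝ) : Matrix (Fin K) (Fin K) ℝ :=
  Matrix.diagonal fun i => if (i : ℕ) + 1 = K then γ else 0

/-- The skew-symmetric tridiagonal `Q`, before tensoring with `I_d`: its superdiagonal is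
`-1, -γ, …, -γ` and its subdiagonal is `1, γ, …, γ`. -/
def skewMatrix (K : ℕ) (γ : ℝ) : Matrix (Fin K) (Fin K) ℝ :=
  Matrix.of fun i j =>
    if (i : ℕ) + 1 = j then (if (i : ℕ) = 0 then -1 else -γ)
    else if (j : ℕ) + 1 = i then (if (j : ℕ) = 0 then 1 else γ)
    else 0

/-- `√(2D)`, before tensoring with `I_d`; recall that `D` is diagonal. -/
def noiseMatrix (K : ℕ) (γ : ℝ) : Matrix (Fin K) (Fin K) ℝ :=
  Matrix.diagonal fun i => Real.sqrt (2 * dampingMatrix K γ i i)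

/-- The action of `M ⊗ I_d` on `ℝ^{Kd}`. -/
def blockMul {K d : ℕ} (M : Matrix (Fin K) (Fin K) ℝ) (x : State K d) : State K d :=
  fun i => ∑ j, M i j • x j

/-! ### The interpolant and the discretized operator -/

/-- The Lagrange interpolant `P(s; X) = ∑ⱼ ℓⱼ(s/h) ∇U(X₁(cⱼ h))` on a step of length `h`, where the
`ℓⱼ` are the Lagrange basis polynomials of the nodes `cⱼ`. -/
def interpolant {K d M : ℕ} [NeZero K] (U : EuclideanSpace ℝ (Fin d) → ℝ) (c : Fin M → ℝ) (h : ℝ)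
    (X : ℝ → State K d) (s : ℝ) : EuclideanSpace ℝ (Fin d) :=
  ∑ j, (Lagrange.basis Finset.univ c j).eval (s / h) • gradient U (X (c j * h) 0)

/-- `Y` is a continuous path on `[0,h]` that solves
`Y(t) = y - ∫₀ᵗ (D+Q) (P(s;X), Y₂(s), …, Y_K(s)) ds + √(2D) w(t)`,
where `w` is the driving path, started at `0`. -/
def SolvesStep {K d M : ℕ} [NeZero K] (γ : ℝ) (U : EuclideanSpace ℝ (Fin d) → ℝ) (c : Fin M → ℝ)
    (h : ℝ) (w : ℝ → State K d) (y : State K d) (X Y : ℝ → State K d) : Prop :=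
  ContinuousOn Y (Icc 0 h) ∧
  ∀ t ∈ Icc 0 h,
    Y t = y
      - (∫ s in (0 : ℝ)..t, blockMul (dampingMatrix K γ + skewMatrix K γ)
          (fun k => if k = 0 then interpolant U c h X s else Y s k))
      + blockMul (noiseMatrix K γ) (w t)

/-- The discretized operator `T̂_y`: it sends `X` to the solution `X̃` of the linear equation
`SolvesStep`. The solution is unique on `[0,h]`; values outside `[0,h]` play no role. -/
def discreteOp {K d M : ℕ} [NeZero K] (γ : ℝ) (U : EuclideanSpace ℝ (Fin d) → ℝ) (c : Fin M → ℝ)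
    (h : ℝ) (w : ℝ → State K d) (y : State K d) (X : ℝ → State K d) : ℝ → State K d :=
  Classical.epsilon fun Y => SolvesStep γ U c h w y X Y

/-- The fixed point `X̂*_y` of `T̂_y` on `[0,h]`. It exists and is unique on `[0,h]` when `h` is
small. -/
def fixedPath {K d M : ℕ} [NeZero K] (γ : ℝ) (U : EuclideanSpace ℝ (Fin d) → ℝ) (c : Fin M → ℝ)
    (h : ℝ) (w : ℝ → State K d) (y : State K d) : ℝ → State K d :=
  Classical.epsilon fun Y => SolvesStep γ U c h w y Y Y

/-- The Picard iterates: `X̂^[0] ≡ y` and `X̂^[ν+1] = T̂_y (X̂^[ν])`. -/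
def picard {K d M : ℕ} [NeZero K] (γ : ℝ) (U : EuclideanSpace ℝ (Fin d) → ℝ) (c : Fin M → ℝ)
    (h : ℝ) (w : ℝ → State K d) (y : State K d) : ℕ → ℝ → State K d
  | 0 => fun _ => y
  | ν + 1 => discreteOp γ U c h w y (picard γ U c h w y ν)

/-! ### The driving noise and the algorithm -/

/-- `B` is a standard Brownian motion in `ℝ^{Kd}`: its coordinates are independent real Brownian
motions started at `0` (with almost surely continuous paths). -/
def IsBrownianMotion {K d : ℕ} {Ω : Type*} [MeasurableSpace Ω] (B : ℝ≥0 → Ω → State K d)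
    (μ : Measure Ω) : Prop :=
  (∀ (k : Fin K) (i : Fin d), IsBrownianReal (fun t ω => B t ω k i) μ) ∧
  iIndepFun (fun (p : Fin K × Fin d) (ω : Ω) (t : ℝ≥0) => B t ω p.1 p.2) μ

/-- The Brownian increment `t ↦ B(nh + t) - B(nh)` that drives step `n`, along one sample path. -/
def stepNoise {K d : ℕ} (b : ℝ≥0 → State K d) (h : ℝ) (n : ℕ) (t : ℝ) : State K d :=
  b (Real.toNNReal (n * h + t)) - b (Real.toNNReal (n * h))

/-- The state `X̂(nh)` of the algorithm with `ν` Picard iterations per step, started at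
`X̂(0) = 0`, along the sample path `b` of the Brownian motion. -/
def iterate {K d M : ℕ} [NeZero K] (γ : ℝ) (U : EuclideanSpace ℝ (Fin d) → ℝ) (c : Fin M → ℝ)
    (h : ℝ) (ν : ℕ) (b : ℝ≥0 → State K d) : ℕ → State K d
  | 0 => 0
  | n + 1 => picard γ U c h (stepNoise b h n) (iterate γ U c h ν b n) ν h

/-- The fixed-point path `X̂*` of step `n`, that is, of `T̂_y` with `y = X̂(nh)`, driven by the
Brownian increments of `[nh, (n+1)h]`; the time `t ∈ [0,h]` is counted from `nh`. -/
def stepFixedPath {K d M : ℕ} [NeZero K] (γ : ℝ) (U : EuclideanSpace ℝ (Fin d) → ℝ)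
    (c : Fin M → ℝ) (h : ℝ) (ν : ℕ) (b : ℝ≥0 → State K d) (n : ℕ) : ℝ → State K d :=
  fixedPath γ U c h (stepNoise b h n) (iterate γ U c h ν b n)

/-- `I_U = sup_{s ∈ [0,h]} ‖∇U(X₁(s)) - P(s; X)‖²`, with values in `[0,∞]`. -/
def interpolationError {K d M : ℕ} [NeZero K] (U : EuclideanSpace ℝ (Fin d) → ℝ) (c : Fin M → ℝ)
    (h : ℝ) (X : ℝ → State K d) : ℝ≥0∞ :=
  ⨆ s ∈ Icc (0 : ℝ) h, ‖gradient U (X s 0) - interpolant U c h X s‖ₑ ^ 2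

end HigherOrderLangevin

end

/-!
The interpolation error of one step is local. Block `k` of the fixed-point path is obtained from
its neighbours by integration in time and only the last block carries noise, so block `0` has
`K - 1` derivatives in time, and interpolation at `K - 1` nodes has an error of order
`(h (1 + ‖y‖ + J)) ^ (K - 1)`, where `y` is the starting point of the step and `J` the time average
of the noise (`exists_local_error_bound`). Instead of differentiating the path, which solves an
equation with interpolated data, one carries polynomial approximations with controlled coefficients
through the equation; this is the calculus of `PolyApprox`.

It remains to bound the moments of order `2 (K - 1)` of the iterates by `N d ^ (K - 1)`, with a
constant that does not see the convexity parameters. An average of the Brownian path over the last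
unit of time is subtracted from the path; the remainder (`centeredNoise`) has bounded moments, and
after it is subtracted from the iterates, each step becomes an Euler step of the noiseless dynamics
with an error of order `h` (`StepAssumptions.shifted_step`). Growth can then be estimated path by
path, without conditioning on the past, in two ways. Over times `n h ≤ 1` a Gronwall argument gives
a constant that does not depend on `m` and `L` (`StepAssumptions.shifted_pow_le_of_short`). Over
longer times a Lyapunov function of hypocoercive type contracts (`exists_lyapunov_step`), which
gives a bound uniform in time, with a constant `G` that depends on `m` and `L`
(`StepAssumptions.shifted_pow_le_of_lyapunov`). When `N h > 1` and `h ≤ 1 / (G + 1)`, the number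
`N` is at least `G`, so that the factor `N` in the claim absorbs this constant. In both cases the
bound is a running average of powers of the forcing, whose expectations follow from Gaussian
moments (`IsBrownianMotion.exists_forcing_majorant`).

Measurability holds because the error is a Lipschitz functional of the Brownian path in the
supremum norm, and the path is a uniform limit of Bernstein polynomials in finitely many of its
values (`aemeasurable_of_stable`).
-/

noncomputable section

namespace HigherOrderLangevin

/-! ### The linear step equation -/

/-- The sum of the absolute values of the entries of a matrix; it bounds the operator norm of
`M ⊗ I_d` for the supremum norm over blocks. -/
def entrySum {K : ℕ} (M : Matrix (Fin K) (Fin K) ℝ) : ℝ := ∑ i, ∑ j, |M i j|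

lemma entrySum_nonneg {K : ℕ} (M : Matrix (Fin K) (Fin K) ℝ) : 0 ≤ entrySum M :=
  Finset.sum_nonneg fun _ _ => Finset.sum_nonneg fun _ _ => abs_nonneg _

lemma norm_blockMul_le {K d : ℕ} (M : Matrix (Fin K) (Fin K) ℝ) (x : State K d) :
    ‖blockMul M x‖ ≤ entrySum M * ‖x‖ := by
  refine (pi_norm_le_iff_of_nonneg (mul_nonneg (entrySum_nonneg M) (norm_nonneg _))).2 fun i => ?_
  calc ‖∑ j, M i j • x j‖ ≤ ∑ j, ‖M i j • x j‖ := norm_sum_le _ _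
    _ ≤ ∑ j, |M i j| * ‖x‖ := by
        refine Finset.sum_le_sum fun j _ => ?_
        rw [norm_smul, Real.norm_eq_abs]
        exact mul_le_mul_of_nonneg_left (norm_le_pi_norm x j) (abs_nonneg _)
    _ = (∑ j, |M i j|) * ‖x‖ := by rw [Finset.sum_mul]
    _ ≤ entrySum M * ‖x‖ := by
        refine mul_le_mul_of_nonneg_right ?_ (norm_nonneg _)
        exact Finset.single_le_sum (f := fun i => ∑ j, |M i j|)
          (fun i _ => Finset.sum_nonneg fun _ _ => abs_nonneg _) (Finset.mem_univ i)

lemma blockMul_sub {K d : ℕ} (M : Matrix (Fin K) (Fin K) ℝ) (x y : State K d) :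
    blockMul M (x - y) = blockMul M x - blockMul M y := by
  funext i
  simp [blockMul, smul_sub, Finset.sum_sub_distrib]

lemma blockMul_smul {K d : ℕ} (M : Matrix (Fin K) (Fin K) ℝ) (a : ℝ) (x : State K d) :
    blockMul M (a • x) = a • blockMul M x := by
  funext i
  simp [blockMul, Finset.smul_sum, smul_comm a]

lemma continuous_blockMul {K d : ℕ} (M : Matrix (Fin K) (Fin K) ℝ) :
    Continuous (blockMul M : State K d → State K d) := by
  unfold blockMul
  fun_prop

/-- Entry `(i, i)` of the noise matrix vanishes except for the last `i`. -/
lemma blockMul_noiseMatrix_apply {K d : ℕ} (γ : ℝ) (x : State K d) (i : Fin K) :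
    blockMul (noiseMatrix K γ) x i =
      if (i : ℕ) + 1 = K then Real.sqrt (2 * γ) • x i else 0 := by
  simp only [blockMul, noiseMatrix, dampingMatrix, Matrix.diagonal_apply]
  rw [Finset.sum_eq_single i]
  · by_cases h : (i : ℕ) + 1 = K <;> simp [h]
  · intro j _ hj
    simp [hj.symm]
  · simp

/-- The drift `(D + Q)(p, x₂, …, x_K)`, with `p` in the place of the gradient. -/
def drift {K d : ℕ} [NeZero K] (γ : ℝ) (p : EuclideanSpace ℝ (Fin d)) (x : State K d) :
    State K d :=
  blockMul (dampingMatrix K γ + skewMatrix K γ) (fun k => if k = 0 then p else x k)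

/-- A bound for the operator norm of `D + Q`, at least `1`. -/
def driftBound (K : ℕ) (γ : ℝ) : ℝ := 1 + entrySum (dampingMatrix K γ + skewMatrix K γ)

/-- A bound for the operator norm of `√(2D)`, at least `1`. -/
def noiseBound (K : ℕ) (γ : ℝ) : ℝ := 1 + entrySum (noiseMatrix K γ)

lemma one_le_driftBound (K : ℕ) (γ : ℝ) : 1 ≤ driftBound K γ := by
  have := entrySum_nonneg (dampingMatrix K γ + skewMatrix K γ)
  unfold driftBound; linarith

lemma one_le_noiseBound (K : ℕ) (γ : ℝ) : 1 ≤ noiseBound K γ := by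
  have := entrySum_nonneg (noiseMatrix K γ)
  unfold noiseBound; linarith

lemma norm_noise_le {K d : ℕ} (γ : ℝ) (x : State K d) :
    ‖blockMul (noiseMatrix K γ) x‖ ≤ noiseBound K γ * ‖x‖ := by
  refine (norm_blockMul_le _ _).trans (mul_le_mul_of_nonneg_right ?_ (norm_nonneg _))
  unfold noiseBound; linarith

section
variable {K d : ℕ} [NeZero K] {γ : ℝ}

lemma norm_drift_le_of_le {p : EuclideanSpace ℝ (Fin d)} {x : State K d} {r : ℝ}
    (hp : ‖p‖ ≤ r) (hx : ∀ k, k ≠ 0 → ‖x k‖ ≤ r) :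
    ‖drift γ p x‖ ≤ driftBound K γ * r := by
  have hr : 0 ≤ r := (norm_nonneg _).trans hp
  refine (norm_blockMul_le _ _).trans ?_
  have h1 : ‖(fun k => if k = 0 then p else x k : State K d)‖ ≤ r := by
    refine (pi_norm_le_iff_of_nonneg hr).2 fun i => ?_
    by_cases h : i = 0
    · simp [h, hp]
    · simp only [h, if_false]; exact hx i h
  have h2 : entrySum (dampingMatrix K γ + skewMatrix K γ) ≤ driftBound K γ := by
    unfold driftBound; linarith
  exact mul_le_mul h2 h1 (norm_nonneg _) ((entrySum_nonneg _).trans h2)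

lemma norm_drift_le (p : EuclideanSpace ℝ (Fin d)) (x : State K d) :
    ‖drift γ p x‖ ≤ driftBound K γ * (‖p‖ + ‖x‖) :=
  norm_drift_le_of_le (by have := norm_nonneg x; linarith)
    fun k _ => (norm_le_pi_norm x k).trans (by have := norm_nonneg p; linarith)

lemma drift_sub (p p' : EuclideanSpace ℝ (Fin d)) (x x' : State K d) :
    drift γ (p - p') (x - x') = drift γ p x - drift γ p' x' := by
  rw [drift, drift, drift, ← blockMul_sub]
  congr 1
  funext k
  by_cases h : k = 0 <;> simp [h]

lemma continuousOn_drift {P : ℝ → EuclideanSpace ℝ (Fin d)} {Y : ℝ → State K d} {s : Set ℝ}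
    (hP : ContinuousOn P s) (hY : ContinuousOn Y s) :
    ContinuousOn (fun t => drift γ (P t) (Y t)) s := by
  refine (continuous_blockMul _).comp_continuousOn ?_
  refine continuousOn_pi.2 fun k => ?_
  by_cases h : k = 0
  · simpa [h] using hP
  · simpa [h] using continuousOn_pi.1 hY k

end

/-- `Y` solves the step equation on `[0,h]` with the forcing `P` in the place of the
interpolated gradient. -/
structure IsLinearSolution {K d : ℕ} [NeZero K] (γ h : ℝ) (P : ℝ → EuclideanSpace ℝ (Fin d))
    (w : ℝ → State K d) (y : State K d) (Y : ℝ → State K d) : Prop where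
  forcing : ContinuousOn P (Icc 0 h)
  noise : ContinuousOn w (Icc 0 h)
  sol : ContinuousOn Y (Icc 0 h)
  eqn : ∀ t ∈ Icc 0 h, Y t = y - (∫ s in (0 : ℝ)..t, drift γ (P s) (Y s))
    + blockMul (noiseMatrix K γ) (w t)

/-- The mean of `‖w‖` over `[0,h]`. -/
def meanNorm {K d : ℕ} (h : ℝ) (w : ℝ → State K d) : ℝ := h⁻¹ * ∫ s in (0 : ℝ)..h, ‖w s‖

lemma meanNorm_nonneg {K d : ℕ} {h : ℝ} (hh : 0 < h) (w : ℝ → State K d) : 0 ≤ meanNorm h w :=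
  mul_nonneg (inv_nonneg.2 hh.le)
    (intervalIntegral.integral_nonneg hh.le fun _ _ => norm_nonneg _)

lemma meanNorm_le_of_le {K d : ℕ} {h η : ℝ} (hh : 0 < h) {w : ℝ → State K d}
    (hw : ContinuousOn w (Icc 0 h)) (hη : ∀ t ∈ Icc 0 h, ‖w t‖ ≤ η) : meanNorm h w ≤ η := by
  have h1 : ∫ s in (0 : ℝ)..h, ‖w s‖ ≤ ∫ _ in (0 : ℝ)..h, η := by
    refine intervalIntegral.integral_mono_on hh.le ?_ (by simp) hη
    exact (hw.norm.intervalIntegrable_of_Icc hh.le)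
  rw [intervalIntegral.integral_const, sub_zero, smul_eq_mul] at h1
  unfold meanNorm
  rw [inv_mul_le_iff₀ hh]
  exact h1

section
variable {K d : ℕ} [NeZero K] {γ h : ℝ} {P P' : ℝ → EuclideanSpace ℝ (Fin d)}
  {w w' : ℝ → State K d} {y y' : State K d} {Y Y' : ℝ → State K d}

lemma IsLinearSolution.sub (H : IsLinearSolution γ h P w y Y)
    (H' : IsLinearSolution γ h P' w' y' Y') :
    IsLinearSolution γ h (fun s => P s - P' s) (fun s => w s - w' s) (y - y')
      (fun s => Y s - Y' s) where
  forcing := H.forcing.sub H'.forcing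
  noise := H.noise.sub H'.noise
  sol := H.sol.sub H'.sol
  eqn t ht := by
    have hsub : Icc 0 t ⊆ Icc 0 h := Icc_subset_Icc_right ht.2
    have h1 := ((continuousOn_drift (γ := γ) H.forcing H.sol).mono
      hsub).intervalIntegrable_of_Icc (μ := volume) ht.1
    have h2 := ((continuousOn_drift (γ := γ) H'.forcing H'.sol).mono
      hsub).intervalIntegrable_of_Icc (μ := volume) ht.1
    simp only [drift_sub]
    rw [intervalIntegral.integral_sub h1 h2, H.eqn t ht, H'.eqn t ht, blockMul_sub]
    abel

/-- Away from its noise, a solution of the step equation moves by `O(h)`. Only the mean of the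
noise enters, since the noise acts on the other blocks through time integrals. -/
lemma IsLinearSolution.norm_sub_le (H : IsLinearSolution γ h P w y Y) (hh : 0 < h)
    (hsmall : driftBound K γ * h ≤ 1 / 2) {R : ℝ} (hP : ∀ s ∈ Icc 0 h, ‖P s‖ ≤ R)
    {t : ℝ} (ht : t ∈ Icc 0 h) :
    ‖Y t - y - blockMul (noiseMatrix K γ) (w t)‖ ≤
      2 * driftBound K γ * h * (R + ‖y‖ + noiseBound K γ * meanNorm h w) := by
  set a := driftBound K γ
  have ha1 : 1 ≤ a := one_le_driftBound K γ
  set f : ℝ → ℝ := fun t => ‖Y t - y - blockMul (noiseMatrix K γ) (w t)‖ with hf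
  have hfc : ContinuousOn f (Icc 0 h) :=
    ((H.sol.sub continuousOn_const).sub ((continuous_blockMul _).comp_continuousOn H.noise)).norm
  obtain ⟨t₀, ht₀, hmax⟩ := isCompact_Icc.exists_isMaxOn ⟨0, left_mem_Icc.2 hh.le⟩ hfc
  have hR : 0 ≤ R := (norm_nonneg _).trans (hP 0 (left_mem_Icc.2 hh.le))
  have hdr : ∀ s ∈ Icc 0 h, ‖drift γ (P s) (Y s)‖ ≤
      a * (R + ‖y‖ + f t₀ + noiseBound K γ * ‖w s‖) := by
    intro s hs
    have h3 : ‖Y s‖ ≤ ‖y‖ + f t₀ + noiseBound K γ * ‖w s‖ := by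
      have h1 : Y s = y + (Y s - y - blockMul (noiseMatrix K γ) (w s))
        + blockMul (noiseMatrix K γ) (w s) := by abel
      have h2 : f s ≤ f t₀ := hmax hs
      rw [h1]
      refine (norm_add₃_le).trans ?_
      have := norm_noise_le γ (w s)
      simp only [hf] at h2 ⊢
      linarith
    refine (norm_drift_le _ _).trans (mul_le_mul_of_nonneg_left ?_ (by linarith))
    have := hP s hs
    linarith
  have hint : IntervalIntegrable (fun s => ‖w s‖) volume 0 h :=
    H.noise.norm.intervalIntegrable_of_Icc hh.le
  have hnn : ∀ s, 0 ≤ a * (R + ‖y‖ + f t₀ + noiseBound K γ * ‖w s‖) := fun s => by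
    have := one_le_noiseBound K γ
    have : 0 ≤ f t₀ := norm_nonneg _
    positivity
  have hkey : ∀ t ∈ Icc 0 h, f t ≤
      a * h * (R + ‖y‖ + f t₀ + noiseBound K γ * meanNorm h w) := by
    intro t ht
    have h0 : f t = ‖∫ s in (0 : ℝ)..t, drift γ (P s) (Y s)‖ := by
      simp only [hf]
      rw [H.eqn t ht, ← norm_neg]
      congr 1
      abel
    have hi2 : IntervalIntegrable (fun s => a * (R + ‖y‖ + f t₀ + noiseBound K γ * ‖w s‖))
        volume 0 h := by
      refine IntervalIntegrable.const_mul ?_ _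
      exact (intervalIntegrable_const).add (hint.const_mul _)
    calc f t = ‖∫ s in (0 : ℝ)..t, drift γ (P s) (Y s)‖ := h0
      _ ≤ ∫ s in (0 : ℝ)..t, a * (R + ‖y‖ + f t₀ + noiseBound K γ * ‖w s‖) := by
          refine intervalIntegral.norm_integral_le_of_norm_le ht.1 (Filter.Eventually.of_forall
            fun s hs => hdr s ⟨hs.1.le, hs.2.trans ht.2⟩) ?_
          refine hi2.mono_set ?_
          rw [uIcc_of_le ht.1, uIcc_of_le hh.le]
          exact Icc_subset_Icc_right ht.2
      _ ≤ ∫ s in (0 : ℝ)..h, a * (R + ‖y‖ + f t₀ + noiseBound K γ * ‖w s‖) := by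
          refine intervalIntegral.integral_mono_interval le_rfl ht.1 ht.2
            (Filter.Eventually.of_forall hnn) hi2
      _ = a * h * (R + ‖y‖ + f t₀ + noiseBound K γ * meanNorm h w) := by
          rw [intervalIntegral.integral_const_mul, intervalIntegral.integral_add
            intervalIntegrable_const (hint.const_mul _), intervalIntegral.integral_const_mul,
            intervalIntegral.integral_const, meanNorm]
          simp only [sub_zero, smul_eq_mul]
          field_simp
  -- Evaluated where `f` is largest, the bound can be solved for the maximum, as `a h ≤ 1 / 2`.
  have h1 := hkey t₀ ht₀
  set b := R + ‖y‖ + noiseBound K γ * meanNorm h w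
  have hft : f t ≤ f t₀ := hmax ht
  have hf0 : 0 ≤ f t₀ := norm_nonneg _
  have h3 : a * h * (R + ‖y‖ + f t₀ + noiseBound K γ * meanNorm h w) =
    a * h * b + a * h * f t₀ := by simp only [b]; ring
  rw [h3] at h1
  have h4 : a * h * f t₀ ≤ 1 / 2 * f t₀ := mul_le_mul_of_nonneg_right hsmall hf0
  show f t ≤ _
  calc f t ≤ f t₀ := hft
    _ ≤ 2 * (a * h * b) := by linarith
    _ = _ := by ring

end

/-- A Volterra equation `Y = f - ∫ D(Y)` with a Lipschitz, possibly nonlocal, functional `D` has a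
solution on a short interval. -/
lemma exists_volterra_solution {E : Type*} [NormedAddCommGroup E] [NormedSpace ℝ E]
    [CompleteSpace E] {h M : ℝ} (hh : 0 < h) (hM : 0 ≤ M) (hsmall : M * h ≤ 1 / 2)
    (D : (ℝ → E) → ℝ → E) (f : ℝ → E) (hf : ContinuousOn f (Icc 0 h))
    (hD : ∀ X, ContinuousOn X (Icc 0 h) → ContinuousOn (D X) (Icc 0 h))
    (hLip : ∀ X X', ∀ ρ : ℝ, (∀ s ∈ Icc 0 h, ‖X s - X' s‖ ≤ ρ) →
      ∀ s ∈ Icc 0 h, ‖D X s - D X' s‖ ≤ M * ρ) :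
    ∃ Y : ℝ → E, ContinuousOn Y (Icc 0 h) ∧
      ∀ t ∈ Icc 0 h, Y t = f t - ∫ s in (0 : ℝ)..t, D Y s := by
  have hext : ∀ X : C(Icc (0 : ℝ) h, E), ContinuousOn (IccExtend hh.le X) (Icc 0 h) := fun X =>
    X.continuous.Icc_extend'.continuousOn
  have hcont : ∀ X : C(Icc (0 : ℝ) h, E), ContinuousOn
      (fun t => f t - ∫ s in (0 : ℝ)..t, D (IccExtend hh.le X) s) (Icc 0 h) := by
    intro X
    refine hf.sub ?_
    have := intervalIntegral.continuousOn_primitive_interval (μ := volume) (a := 0) (b := h)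
      (f := D (IccExtend hh.le X)) (by
        rw [uIcc_of_le hh.le]
        exact (hD _ (hext X)).integrableOn_Icc)
    rwa [uIcc_of_le hh.le] at this
  let T : C(Icc (0 : ℝ) h, E) → C(Icc (0 : ℝ) h, E) := fun X =>
    ⟨fun t => f t - ∫ s in (0 : ℝ)..t, D (IccExtend hh.le X) s,
      continuousOn_iff_continuous_domRestrict.1 (hcont X)⟩
  have hT : ContractingWith (1 / 2 : ℝ≥0) T := by
    refine ⟨by norm_num, LipschitzWith.of_dist_le_mul fun X X' => ?_⟩
    refine (ContinuousMap.dist_le (by positivity)).2 fun t => ?_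
    have ht := t.2
    have hsub : Icc (0 : ℝ) t ⊆ Icc 0 h := Icc_subset_Icc_right ht.2
    have i1 := ((hD _ (hext X)).mono hsub).intervalIntegrable_of_Icc (μ := volume) ht.1
    have i2 := ((hD _ (hext X')).mono hsub).intervalIntegrable_of_Icc (μ := volume) ht.1
    have hl := hLip (IccExtend hh.le X) (IccExtend hh.le X') (dist X X') (by
      intro s hs
      rw [IccExtend_of_mem _ _ hs, IccExtend_of_mem _ _ hs, ← dist_eq_norm]
      exact ContinuousMap.dist_apply_le_dist _)
    show dist (f t - ∫ s in (0 : ℝ)..t, D (IccExtend hh.le X) s)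
      (f t - ∫ s in (0 : ℝ)..t, D (IccExtend hh.le X') s) ≤ _
    rw [dist_sub_left, dist_eq_norm, ← intervalIntegral.integral_sub i1 i2]
    have h1 := intervalIntegral.norm_integral_le_of_norm_le_const (a := (0 : ℝ)) (b := t)
      (f := fun s => D (IccExtend hh.le X) s - D (IccExtend hh.le X') s)
      (C := M * dist X X') (fun s hs => by
        rw [uIoc_of_le ht.1] at hs
        exact hl s ⟨hs.1.le, hs.2.trans ht.2⟩)
    refine h1.trans ?_
    rw [sub_zero, abs_of_nonneg ht.1]
    have h2 : M * (t : ℝ) ≤ 1 / 2 := (mul_le_mul_of_nonneg_left ht.2 hM).trans hsmall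
    have h3 : (0 : ℝ) ≤ dist X X' := dist_nonneg
    push_cast
    nlinarith
  obtain ⟨Y, hY⟩ : ∃ Y, T Y = Y := ⟨_, hT.fixedPoint_isFixedPt⟩
  refine ⟨IccExtend hh.le Y, hext Y, fun t ht => ?_⟩
  rw [IccExtend_of_mem _ _ ht]
  conv_lhs => rw [← hY]
  rfl

/-! ### The gradient of the potential -/

/-- The inverse of the Riesz isometry `E → E*`, as a real linear isometry. -/
def rieszInv (d : ℕ) : StrongDual ℝ (EuclideanSpace ℝ (Fin d)) ≃ₗᵢ[ℝ] EuclideanSpace ℝ (Fin d) :=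
  (InnerProductSpace.toDual ℝ (EuclideanSpace ℝ (Fin d))).symm

lemma contDiff_gradient {d n : ℕ} {U : EuclideanSpace ℝ (Fin d) → ℝ}
    (hU : ContDiff ℝ (n + 1 : ℕ) U) : ContDiff ℝ n (gradient U) := by
  have h1 : ContDiff ℝ n (fderiv ℝ U) := hU.fderiv_right (by norm_cast)
  exact (rieszInv d).contDiff.comp h1

lemma HigherOrderSmooth.norm_gradient_sub_le {d K : ℕ} (hK : 2 ≤ K)
    {U : EuclideanSpace ℝ (Fin d) → ℝ} {Λ : Fin (K - 1) → ℝ} (hU : HigherOrderSmooth K U Λ)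
    (x x' : EuclideanSpace ℝ (Fin d)) :
    ‖gradient U x - gradient U x'‖ ≤ Λ ⟨0, by omega⟩ * ‖x - x'‖ := by
  have hc : ContDiff ℝ (K - 1 : ℕ) (gradient U) := by
    refine contDiff_gradient ?_
    rw [show K - 1 + 1 = K by omega]
    exact hU.1
  have hd : Differentiable ℝ (gradient U) := hc.differentiable (by
    have : K - 1 ≠ 0 := by omega
    exact_mod_cast this)
  refine convex_univ.norm_image_sub_le_of_norm_fderiv_le (𝕜 := ℝ) (fun z _ => hd z)
    (fun z _ => ?_) (mem_univ x') (mem_univ x)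
  have := hU.2 ⟨0, by omega⟩ z
  simpa [norm_iteratedFDeriv_one] using this

lemma StronglyConvexSmooth.inner_gradient_ge {d : ℕ} {U : EuclideanSpace ℝ (Fin d) → ℝ} {m L : ℝ}
    (hU : StronglyConvexSmooth U m L) (h0 : Centered U) (x : EuclideanSpace ℝ (Fin d)) :
    m * ‖x‖ ^ 2 ≤ inner ℝ (gradient U x) x := by
  have h1 := (hU x 0).1
  have h2 := (hU 0 x).1
  simp only [zero_sub, norm_neg, inner_neg_right, sub_zero, h0.1, h0.2, inner_zero_left] at h1 h2
  linarith

/-! ### The interpolant -/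

lemma exists_lebesgue_constant {M : ℕ} (c : Fin M → ℝ) :
    ∃ Lb : ℝ, 1 ≤ Lb ∧ ∀ τ ∈ Icc (0 : ℝ) 1,
      ∑ j, |(Lagrange.basis Finset.univ c j).eval τ| ≤ Lb := by
  have hc : ContinuousOn (fun τ : ℝ => ∑ j, |(Lagrange.basis Finset.univ c j).eval τ|)
      (Icc 0 1) := by
    refine Continuous.continuousOn ?_
    exact continuous_finsetSum _ fun j _ => (Polynomial.continuous _).abs
  obtain ⟨b, hb⟩ := (isCompact_Icc.image_of_continuousOn hc).bddAbove
  exact ⟨max 1 b, le_max_left _ _, fun τ hτ => (hb ⟨τ, hτ, rfl⟩).trans (le_max_right _ _)⟩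

lemma norm_sum_basis_smul_le {M : ℕ} {c : Fin M → ℝ} {E : Type*} [NormedAddCommGroup E]
    [NormedSpace ℝ E] {Lb τ B : ℝ} (hLb : ∑ j, |(Lagrange.basis Finset.univ c j).eval τ| ≤ Lb)
    (hB : 0 ≤ B) {v : Fin M → E} (hv : ∀ j, ‖v j‖ ≤ B) :
    ‖∑ j, (Lagrange.basis Finset.univ c j).eval τ • v j‖ ≤ Lb * B := by
  calc _ ≤ ∑ j, ‖(Lagrange.basis Finset.univ c j).eval τ • v j‖ := norm_sum_le _ _
    _ ≤ ∑ j, |(Lagrange.basis Finset.univ c j).eval τ| * B := by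
        refine Finset.sum_le_sum fun j _ => ?_
        rw [norm_smul, Real.norm_eq_abs]
        exact mul_le_mul_of_nonneg_left (hv j) (abs_nonneg _)
    _ ≤ Lb * B := by
        rw [← Finset.sum_mul]
        exact mul_le_mul_of_nonneg_right hLb hB

lemma sum_basis_eval_eq_one {M : ℕ} (hM : 0 < M) {c : Fin M → ℝ} (hc : Function.Injective c)
    (τ : ℝ) : ∑ j, (Lagrange.basis Finset.univ c j).eval τ = 1 := by
  have h1 := Lagrange.sum_basis (s := Finset.univ) (v := c) hc.injOn ⟨⟨0, hM⟩, Finset.mem_univ _⟩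
  have := congrArg (Polynomial.eval τ) h1
  simpa [Polynomial.eval_finsetSum] using this

lemma continuous_interpolant {K d M : ℕ} [NeZero K] (U : EuclideanSpace ℝ (Fin d) → ℝ)
    (c : Fin M → ℝ) (h : ℝ) (X : ℝ → State K d) : Continuous (interpolant U c h X) := by
  unfold interpolant
  refine continuous_finsetSum _ fun j _ => ?_
  exact ((Polynomial.continuous _).comp (continuous_id.div_const h)).smul continuous_const

/-- The standing assumptions for one step: `ℓ` is a Lipschitz constant of `∇U`, `Lb` a bound for
the Lebesgue function of the nodes on `[0,1]`, and the step length `h` is small. -/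
structure StepAssumptions (K : ℕ) {d M : ℕ} (γ : ℝ) (U : EuclideanSpace ℝ (Fin d) → ℝ)
    (c : Fin M → ℝ) (ℓ Lb h : ℝ) : Prop where
  two_le : 2 ≤ K
  nodes_pos : 0 < M
  nodes_mem : ∀ j, c j ∈ Icc (0 : ℝ) 1
  nodes_inj : Function.Injective c
  lebesgue : ∀ τ ∈ Icc (0 : ℝ) 1, ∑ j, |(Lagrange.basis Finset.univ c j).eval τ| ≤ Lb
  one_le_lebesgue : 1 ≤ Lb
  one_le_lip : 1 ≤ ℓ
  lip : ∀ x x', ‖gradient U x - gradient U x'‖ ≤ ℓ * ‖x - x'‖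
  grad_zero : gradient U 0 = 0
  pos : 0 < h
  le_one : h ≤ 1
  small : 8 * driftBound K γ * (Lb * ℓ) * h ≤ 1

section
variable {K d M : ℕ} {γ : ℝ} {U : EuclideanSpace ℝ (Fin d) → ℝ} {c : Fin M → ℝ}
  {ℓ Lb h : ℝ}

lemma StepAssumptions.one_le_mul (H : StepAssumptions K γ U c ℓ Lb h) : 1 ≤ Lb * ℓ :=
  one_le_mul_of_one_le_of_one_le H.one_le_lebesgue H.one_le_lip

lemma StepAssumptions.drift_small (H : StepAssumptions K γ U c ℓ Lb h) :
    driftBound K γ * h ≤ 1 / 8 := by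
  have h1 := H.small
  have h2 := H.one_le_mul
  have h3 : 0 ≤ driftBound K γ * h := mul_nonneg (by linarith [one_le_driftBound K γ]) H.pos.le
  nlinarith

lemma StepAssumptions.norm_gradient_le (H : StepAssumptions K γ U c ℓ Lb h)
    (x : EuclideanSpace ℝ (Fin d)) : ‖gradient U x‖ ≤ ℓ * ‖x‖ := by
  simpa [H.grad_zero] using H.lip x 0

lemma StepAssumptions.div_mem (H : StepAssumptions K γ U c ℓ Lb h) {s : ℝ} (hs : s ∈ Icc 0 h) :
    s / h ∈ Icc (0 : ℝ) 1 :=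
  ⟨div_nonneg hs.1 H.pos.le, (div_le_one H.pos).2 hs.2⟩

lemma StepAssumptions.node_mem (H : StepAssumptions K γ U c ℓ Lb h) (j : Fin M) :
    c j * h ∈ Icc 0 h :=
  ⟨mul_nonneg (H.nodes_mem j).1 H.pos.le, by nlinarith [(H.nodes_mem j).2, H.pos]⟩

/-- The bound for the displacement, up to the noise, of the Picard iterates and of the fixed point
within one step. -/
def stepBound (K : ℕ) (γ κ h : ℝ) {d : ℕ} (w : ℝ → State K d) (y : State K d) : ℝ :=
  4 * driftBound K γ * h * ((κ + 1) * ‖y‖ + noiseBound K γ * meanNorm h w)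

lemma StepAssumptions.stepBound_nonneg (H : StepAssumptions K γ U c ℓ Lb h)
    (w : ℝ → State K d) (y : State K d) : 0 ≤ stepBound K γ (Lb * ℓ) h w y := by
  have ha := one_le_driftBound K γ
  have hb := one_le_noiseBound K γ
  have hk := H.one_le_mul
  have := H.pos
  have := meanNorm_nonneg H.pos w
  unfold stepBound
  positivity

lemma noise_apply_of_lt (x : State K d) (i : Fin K) (hi : (i : ℕ) + 1 < K) :
    blockMul (noiseMatrix K γ) x i = 0 := by
  rw [blockMul_noiseMatrix_apply, if_neg hi.ne]

variable [NeZero K]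

lemma StepAssumptions.norm_interpolant_sub_le (H : StepAssumptions K γ U c ℓ Lb h)
    {X X' : ℝ → State K d} {ρ : ℝ} (hX : ∀ t ∈ Icc 0 h, ‖X t 0 - X' t 0‖ ≤ ρ) {s : ℝ}
    (hs : s ∈ Icc 0 h) :
    ‖interpolant U c h X s - interpolant U c h X' s‖ ≤ Lb * ℓ * ρ := by
  have hρ : 0 ≤ ρ := (norm_nonneg _).trans (hX s hs)
  rw [interpolant, interpolant, ← Finset.sum_sub_distrib, mul_assoc]
  simp only [← smul_sub]
  refine norm_sum_basis_smul_le (H.lebesgue _ (H.div_mem hs))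
    (mul_nonneg (by linarith [H.one_le_lip]) hρ) fun j => ?_
  exact (H.lip _ _).trans (mul_le_mul_of_nonneg_left (hX _ (H.node_mem j))
    (by linarith [H.one_le_lip]))

/-- The interpolant of the constant path at `y` is constant. -/
lemma StepAssumptions.interpolant_const (H : StepAssumptions K γ U c ℓ Lb h) (y : State K d)
    (s : ℝ) : interpolant U c h (fun _ => y) s = gradient U (y 0) := by
  rw [interpolant, ← Finset.sum_smul, sum_basis_eval_eq_one H.nodes_pos H.nodes_inj, one_smul]

lemma StepAssumptions.norm_interpolant_sub_gradient_le (H : StepAssumptions K γ U c ℓ Lb h)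
    {X : ℝ → State K d} {y : State K d} {ρ : ℝ} (hX : ∀ t ∈ Icc 0 h, ‖X t 0 - y 0‖ ≤ ρ) {s : ℝ}
    (hs : s ∈ Icc 0 h) :
    ‖interpolant U c h X s - gradient U (y 0)‖ ≤ Lb * ℓ * ρ := by
  rw [← H.interpolant_const y s]
  exact H.norm_interpolant_sub_le hX hs

lemma StepAssumptions.norm_interpolant_le (H : StepAssumptions K γ U c ℓ Lb h)
    {X : ℝ → State K d} {y : State K d} {ρ : ℝ} (hX : ∀ t ∈ Icc 0 h, ‖X t 0 - y 0‖ ≤ ρ) {s : ℝ}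
    (hs : s ∈ Icc 0 h) :
    ‖interpolant U c h X s‖ ≤ Lb * ℓ * (‖y‖ + ρ) := by
  have h1 := H.norm_interpolant_sub_le (X' := fun _ => (0 : State K d)) (ρ := ‖y‖ + ρ) (fun t ht =>
    by
      have h2 : X t 0 - (0 : State K d) 0 = y 0 + (X t 0 - y 0) := by simp
      rw [h2]
      exact (norm_add_le _ _).trans (add_le_add (norm_le_pi_norm y 0) (hX t ht))) hs
  rw [H.interpolant_const] at h1
  simpa [H.grad_zero] using h1

/-! ### Existence of the solutions -/

lemma SolvesStep.isLinearSolution {w : ℝ → State K d} {y : State K d} {X Y : ℝ → State K d}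
    (hw : ContinuousOn w (Icc 0 h)) (hS : SolvesStep γ U c h w y X Y) :
    IsLinearSolution γ h (interpolant U c h X) w y Y :=
  ⟨(continuous_interpolant U c h X).continuousOn, hw, hS.1, hS.2⟩

lemma StepAssumptions.exists_solution (H : StepAssumptions K γ U c ℓ Lb h) {w : ℝ → State K d}
    (hw : ContinuousOn w (Icc 0 h)) (y : State K d)
    (P : (ℝ → State K d) → ℝ → EuclideanSpace ℝ (Fin d)) (hP : ∀ X, Continuous (P X))
    (hPl : ∀ X X' : ℝ → State K d, ∀ ρ : ℝ, (∀ s ∈ Icc 0 h, ‖X s - X' s‖ ≤ ρ) →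
      ∀ s ∈ Icc 0 h, ‖P X s - P X' s‖ ≤ Lb * ℓ * ρ) :
    ∃ Y : ℝ → State K d, ContinuousOn Y (Icc 0 h) ∧ ∀ t ∈ Icc 0 h,
      Y t = y - (∫ s in (0 : ℝ)..t, drift γ (P Y s) (Y s)) + blockMul (noiseMatrix K γ) (w t) := by
  have ha := one_le_driftBound K γ
  have hk := H.one_le_mul
  obtain ⟨Y, hY, hYe⟩ := exists_volterra_solution (M := driftBound K γ * (Lb * ℓ)) H.pos
    (by positivity) (by have := H.small; linarith) (fun X s => drift γ (P X s) (X s))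
    (fun t => y + blockMul (noiseMatrix K γ) (w t))
    (continuousOn_const.add ((continuous_blockMul _).comp_continuousOn hw))
    (fun X hX => continuousOn_drift (hP X).continuousOn hX)
    (fun X X' ρ hρ s hs => by
      have h0 : 0 ≤ ρ := (norm_nonneg _).trans (hρ s hs)
      rw [← drift_sub, mul_assoc]
      refine norm_drift_le_of_le (hPl X X' ρ hρ s hs) fun k _ => ?_
      refine ((norm_le_pi_norm (X s - X' s) k).trans (hρ s hs)).trans ?_
      exact le_mul_of_one_le_left h0 hk)
  refine ⟨Y, hY, fun t ht => ?_⟩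
  rw [hYe t ht]
  abel

lemma StepAssumptions.discreteOp_spec (H : StepAssumptions K γ U c ℓ Lb h) {w : ℝ → State K d}
    (hw : ContinuousOn w (Icc 0 h)) (y : State K d) (X : ℝ → State K d) :
    SolvesStep γ U c h w y X (discreteOp γ U c h w y X) := by
  refine Classical.epsilon_spec (p := fun Y => SolvesStep γ U c h w y X Y) ?_
  refine H.exists_solution hw y (fun _ => interpolant U c h X)
    (fun _ => continuous_interpolant U c h X) fun X' X'' ρ hρ s hs => ?_
  have h0 : 0 ≤ ρ := (norm_nonneg _).trans (hρ s hs)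
  have := H.one_le_mul
  simp only [sub_self, norm_zero]
  positivity

lemma StepAssumptions.fixedPath_spec (H : StepAssumptions K γ U c ℓ Lb h) {w : ℝ → State K d}
    (hw : ContinuousOn w (Icc 0 h)) (y : State K d) :
    SolvesStep γ U c h w y (fixedPath γ U c h w y) (fixedPath γ U c h w y) := by
  refine Classical.epsilon_spec (p := fun Y => SolvesStep γ U c h w y Y Y) ?_
  refine H.exists_solution hw y (fun X => interpolant U c h X)
    (fun X => continuous_interpolant U c h X) fun X X' ρ hρ s hs => ?_
  exact H.norm_interpolant_sub_le (fun t ht => (norm_le_pi_norm (X t - X' t) 0).trans (hρ t ht)) hs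

/-! ### Bounds for one step -/

lemma StepAssumptions.norm_sub_le_aux (H : StepAssumptions K γ U c ℓ Lb h) {w : ℝ → State K d}
    (hw : ContinuousOn w (Icc 0 h)) {y : State K d} {X Y : ℝ → State K d}
    (hS : SolvesStep γ U c h w y X Y) {ρ : ℝ} (hX : ∀ t ∈ Icc 0 h, ‖X t 0 - y 0‖ ≤ ρ)
    {t : ℝ} (ht : t ∈ Icc 0 h) :
    ‖Y t - y - blockMul (noiseMatrix K γ) (w t)‖ ≤
      stepBound K γ (Lb * ℓ) h w y / 2 + ρ / 2 := by
  have hρ : 0 ≤ ρ := (norm_nonneg _).trans (hX t ht)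
  have h1 := (hS.isLinearSolution hw).norm_sub_le H.pos (by linarith [H.drift_small])
    (fun s hs => H.norm_interpolant_le hX hs) ht
  refine h1.trans ?_
  have h2 : 2 * driftBound K γ * h * (Lb * ℓ) * ρ ≤ ρ / 2 := by
    have := H.small
    nlinarith
  unfold stepBound
  linarith

lemma norm_apply_zero_sub_le (hK : 2 ≤ K) (x y : State K d) (v : State K d) :
    ‖x 0 - y 0‖ ≤ ‖x - y - blockMul (noiseMatrix K γ) v‖ := by
  have h1 := norm_le_pi_norm (x - y - blockMul (noiseMatrix K γ) v) 0
  have h2 : blockMul (noiseMatrix K γ) v 0 = 0 := noise_apply_of_lt v 0 (by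
    rw [Fin.val_zero]; omega)
  simpa [h2] using h1

lemma StepAssumptions.solution_norm_sub_le (H : StepAssumptions K γ U c ℓ Lb h)
    {w : ℝ → State K d}
    (hw : ContinuousOn w (Icc 0 h)) {y : State K d} {X Y : ℝ → State K d}
    (hS : SolvesStep γ U c h w y X Y)
    (hX : ∀ t ∈ Icc 0 h, ‖X t 0 - y 0‖ ≤ stepBound K γ (Lb * ℓ) h w y)
    {t : ℝ} (ht : t ∈ Icc 0 h) :
    ‖Y t - y - blockMul (noiseMatrix K γ) (w t)‖ ≤ stepBound K γ (Lb * ℓ) h w y := by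
  have := H.norm_sub_le_aux hw hS hX ht
  linarith

lemma StepAssumptions.picard_norm_sub_le (H : StepAssumptions K γ U c ℓ Lb h)
    {w : ℝ → State K d} (hw : ContinuousOn w (Icc 0 h)) (y : State K d) (ν : ℕ)
    {t : ℝ} (ht : t ∈ Icc 0 h) :
    ‖picard γ U c h w y ν t 0 - y 0‖ ≤ stepBound K γ (Lb * ℓ) h w y := by
  induction ν generalizing t with
  | zero => simpa [picard] using H.stepBound_nonneg w y
  | succ ν ih =>
    exact (norm_apply_zero_sub_le H.two_le _ _ _).trans
      (H.solution_norm_sub_le hw (H.discreteOp_spec hw y _) (fun t ht => ih ht) ht)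

lemma StepAssumptions.fixed_norm_sub_le (H : StepAssumptions K γ U c ℓ Lb h)
    {w : ℝ → State K d} (hw : ContinuousOn w (Icc 0 h)) {y : State K d} {Y : ℝ → State K d}
    (hS : SolvesStep γ U c h w y Y Y) {t : ℝ} (ht : t ∈ Icc 0 h) :
    ‖Y t - y - blockMul (noiseMatrix K γ) (w t)‖ ≤ stepBound K γ (Lb * ℓ) h w y := by
  have hfc : ContinuousOn (fun t => ‖Y t - y - blockMul (noiseMatrix K γ) (w t)‖) (Icc 0 h) :=
    ((hS.1.sub continuousOn_const).sub ((continuous_blockMul _).comp_continuousOn hw)).norm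
  obtain ⟨t₀, ht₀, hmax⟩ := isCompact_Icc.exists_isMaxOn ⟨0, left_mem_Icc.2 H.pos.le⟩ hfc
  have h1 := H.norm_sub_le_aux hw hS (fun t ht =>
    (norm_apply_zero_sub_le (γ := γ) H.two_le (Y t) y (w t)).trans (hmax ht)) ht₀
  exact (hmax ht).trans (by simp only at h1 ⊢; linarith)

/-- One step is an Euler step up to an error of order `h² ‖y‖ + h · noise`. -/
lemma StepAssumptions.euler_error_le (H : StepAssumptions K γ U c ℓ Lb h)
    {w : ℝ → State K d} (hw : ContinuousOn w (Icc 0 h)) {y : State K d} {X Y : ℝ → State K d}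
    (hS : SolvesStep γ U c h w y X Y)
    (hX : ∀ t ∈ Icc 0 h, ‖X t 0 - y 0‖ ≤ stepBound K γ (Lb * ℓ) h w y) :
    ‖Y h - (y - h • drift γ (gradient U (y 0)) y + blockMul (noiseMatrix K γ) (w h))‖ ≤
      8 * driftBound K γ ^ 2 * (Lb * ℓ) ^ 2 * noiseBound K γ * h * (h * ‖y‖ + meanNorm h w) := by
  set a := driftBound K γ
  set b := noiseBound K γ
  set κ := Lb * ℓ
  set e := stepBound K γ κ h w y with he
  have ha1 : 1 ≤ a := one_le_driftBound K γ
  have hb1 : 1 ≤ b := one_le_noiseBound K γ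
  have hk1 : 1 ≤ κ := H.one_le_mul
  have he0 : 0 ≤ e := H.stepBound_nonneg w y
  have hh := H.pos
  have hmem : h ∈ Icc 0 h := right_mem_Icc.2 hh.le
  have hi1 := (continuousOn_drift (γ := γ) (continuous_interpolant U c h X).continuousOn
    hS.1).intervalIntegrable_of_Icc (μ := volume) hh.le
  have hw' : IntervalIntegrable (fun s => ‖w s‖) volume 0 h :=
    hw.norm.intervalIntegrable_of_Icc hh.le
  have h0 : Y h - (y - h • drift γ (gradient U (y 0)) y + blockMul (noiseMatrix K γ) (w h)) =
      - ∫ s in (0 : ℝ)..h, drift γ (interpolant U c h X s - gradient U (y 0)) (Y s - y) := by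
    simp only [drift_sub]
    rw [intervalIntegral.integral_sub hi1 intervalIntegrable_const,
      intervalIntegral.integral_const, sub_zero, hS.2 h hmem]
    simp only [drift]
    abel
  rw [h0, norm_neg]
  have h1 : ‖∫ s in (0 : ℝ)..h, drift γ (interpolant U c h X s - gradient U (y 0)) (Y s - y)‖ ≤
      ∫ s in (0 : ℝ)..h, a * (κ * e + b * ‖w s‖) := by
    refine intervalIntegral.norm_integral_le_of_norm_le hh.le (Filter.Eventually.of_forall
      fun s hs => ?_) ((intervalIntegrable_const.add (hw'.const_mul _)).const_mul _)
    have hs' : s ∈ Icc 0 h := ⟨hs.1.le, hs.2⟩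
    have hbw : 0 ≤ b * ‖w s‖ := by positivity
    refine norm_drift_le_of_le ?_ fun k _ => ?_
    · exact (H.norm_interpolant_sub_gradient_le hX hs').trans (by linarith)
    · have h2 := H.solution_norm_sub_le hw hS hX hs'
      have h3 : Y s - y = (Y s - y - blockMul (noiseMatrix K γ) (w s)) +
        blockMul (noiseMatrix K γ) (w s) := by abel
      refine (norm_le_pi_norm (Y s - y) k).trans ?_
      rw [h3]
      have h4 : e ≤ κ * e := le_mul_of_one_le_left he0 hk1
      exact (norm_add_le _ _).trans (by linarith [norm_noise_le γ (w s)])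
  refine h1.trans ?_
  have hJ := meanNorm_nonneg hh w
  have h5 : ∫ s in (0 : ℝ)..h, ‖w s‖ = h * meanNorm h w := by
    unfold meanNorm; field_simp
  rw [intervalIntegral.integral_const_mul, intervalIntegral.integral_add
      intervalIntegrable_const (hw'.const_mul _), intervalIntegral.integral_const_mul,
      intervalIntegral.integral_const_mul, intervalIntegral.integral_const, h5, sub_zero,
      smul_eq_mul]
  set J := meanNorm h w
  have hsm : 8 * a * κ * h ≤ 1 := H.small
  have hke : κ * e ≤ b * J + 8 * a * κ ^ 2 * h * ‖y‖ := by
    have e1 : κ * e = 4 * a * κ * h * ((κ + 1) * ‖y‖) + 4 * a * κ * h * (b * J) := by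
      simp only [he, stepBound]; ring
    have e2 : 4 * a * κ * h * (b * J) ≤ b * J := by
      have : 0 ≤ b * J := by positivity
      nlinarith
    have e3 : 4 * a * κ * h * ((κ + 1) * ‖y‖) ≤ 8 * a * κ ^ 2 * h * ‖y‖ := by
      have : 0 ≤ 4 * a * κ * h * ‖y‖ := by positivity
      nlinarith
    linarith
  calc a * (κ * (h * e) + b * (h * J)) = a * h * (κ * e + b * J) := by ring
    _ ≤ a * h * (b * J + 8 * a * κ ^ 2 * h * ‖y‖ + b * J) := by
        gcongr
    _ = 8 * a ^ 2 * κ ^ 2 * h * (h * ‖y‖) + 2 * a * b * h * J := by ring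
    _ ≤ 8 * a ^ 2 * κ ^ 2 * b * h * (h * ‖y‖) + 8 * a ^ 2 * κ ^ 2 * b * h * J := by
        have e4 : a ≤ a ^ 2 * κ ^ 2 := by
          have : 1 ≤ a * κ ^ 2 := one_le_mul_of_one_le_of_one_le ha1 (one_le_pow₀ hk1)
          nlinarith
        have e5 : 0 ≤ 8 * a ^ 2 * κ ^ 2 * h * (h * ‖y‖) := by positivity
        have e6 : 0 ≤ b * h * J := by positivity
        nlinarith
    _ = _ := by ring

/-- Stability of the step equation with respect to all its data. -/
lemma StepAssumptions.stability (H : StepAssumptions K γ U c ℓ Lb h)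
    {w w' : ℝ → State K d} (hw : ContinuousOn w (Icc 0 h)) (hw' : ContinuousOn w' (Icc 0 h))
    {y y' : State K d} {X Y X' Y' : ℝ → State K d}
    (hS : SolvesStep γ U c h w y X Y) (hS' : SolvesStep γ U c h w' y' X' Y') {η ρ : ℝ}
    (hη : ∀ t ∈ Icc 0 h, ‖w t - w' t‖ ≤ η) (hy : ‖y - y'‖ ≤ η)
    (hρ : ∀ t ∈ Icc 0 h, ‖X t - X' t‖ ≤ ρ) {t : ℝ} (ht : t ∈ Icc 0 h) :
    ‖Y t - Y' t‖ ≤ 4 * noiseBound K γ * η + ρ / 2 := by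
  have hη0 : 0 ≤ η := (norm_nonneg _).trans hy
  have hρ0 : 0 ≤ ρ := (norm_nonneg _).trans (hρ t ht)
  have hL := (hS.isLinearSolution hw).sub (hS'.isLinearSolution hw')
  have h1 := hL.norm_sub_le H.pos (by linarith [H.drift_small]) (fun s hs =>
    H.norm_interpolant_sub_le (fun t ht => (norm_le_pi_norm (X t - X' t) 0).trans (hρ t ht)) hs) ht
  have hJ : meanNorm h (fun s => w s - w' s) ≤ η := meanNorm_le_of_le H.pos (hw.sub hw') hη
  set b := noiseBound K γ
  have hb1 : 1 ≤ b := one_le_noiseBound K γ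
  have h2 : ‖Y t - Y' t‖ ≤ ‖(Y t - Y' t) - (y - y') -
      blockMul (noiseMatrix K γ) (w t - w' t)‖ + η + b * η := by
    have e1 : Y t - Y' t = ((Y t - Y' t) - (y - y') - blockMul (noiseMatrix K γ) (w t - w' t))
      + (y - y') + blockMul (noiseMatrix K γ) (w t - w' t) := by abel
    conv_lhs => rw [e1]
    refine norm_add₃_le.trans ?_
    have := (norm_noise_le γ (w t - w' t)).trans
      (mul_le_mul_of_nonneg_left (hη t ht) (by linarith))
    linarith
  have ha := H.drift_small
  have hs := H.small
  have ha0 : 0 ≤ driftBound K γ * h := mul_nonneg (by linarith [one_le_driftBound K γ]) H.pos.le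
  have h3 : 2 * driftBound K γ * h * (Lb * ℓ * ρ + ‖y - y'‖ +
      b * meanNorm h (fun s => w s - w' s)) ≤ ρ / 2 + η + b * η := by
    have e1 : 2 * driftBound K γ * h * (Lb * ℓ * ρ) ≤ ρ / 2 := by nlinarith
    have e2 : 2 * driftBound K γ * h * ‖y - y'‖ ≤ η := by nlinarith [norm_nonneg (y - y')]
    have e3 : 2 * driftBound K γ * h * (b * meanNorm h (fun s => w s - w' s)) ≤ b * η := by
      have : b * meanNorm h (fun s => w s - w' s) ≤ b * η :=
        mul_le_mul_of_nonneg_left hJ (by linarith)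
      have h0 : 0 ≤ b * meanNorm h (fun s => w s - w' s) :=
        mul_nonneg (by linarith) (meanNorm_nonneg H.pos _)
      nlinarith
    linarith
  have h4 : η ≤ b * η := le_mul_of_one_le_left hη0 hb1
  linarith

/-- Stability of the fixed point with respect to the starting point and the noise. -/
lemma StepAssumptions.fixed_stability (H : StepAssumptions K γ U c ℓ Lb h)
    {w w' : ℝ → State K d} (hw : ContinuousOn w (Icc 0 h)) (hw' : ContinuousOn w' (Icc 0 h))
    {y y' : State K d} {Y Y' : ℝ → State K d}
    (hS : SolvesStep γ U c h w y Y Y) (hS' : SolvesStep γ U c h w' y' Y' Y') {η : ℝ}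
    (hη : ∀ t ∈ Icc 0 h, ‖w t - w' t‖ ≤ η) (hy : ‖y - y'‖ ≤ η) {t : ℝ} (ht : t ∈ Icc 0 h) :
    ‖Y t - Y' t‖ ≤ 8 * noiseBound K γ * η := by
  obtain ⟨t₀, ht₀, hmax⟩ := isCompact_Icc.exists_isMaxOn ⟨0, left_mem_Icc.2 H.pos.le⟩
    (hS.1.sub hS'.1).norm
  have h1 := H.stability hw hw' hS hS' hη hy (fun t ht => hmax ht) ht₀
  exact (hmax ht).trans (by simp only [Pi.sub_apply] at h1 ⊢; linarith)

end

/-! ### Polynomial approximation at scale `ρ` -/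

/-- On `[0,1]`, the function `f` is approximated up to `B ρ ^ n` by a polynomial of degree less than
`n` whose coefficient of `τ ^ i` is at most `B ρ ^ i`. For `ρ ≤ 1` this is what Taylor expansion
gives for a function whose `i`-th derivatives are of size `ρ ^ i`; it is stable under sums,
integration, composition with smooth maps, and Lagrange interpolation. -/
def PolyApprox {E : Type*} [NormedAddCommGroup E] [NormedSpace ℝ E] (n : ℕ) (B ρ : ℝ)
    (f : ℝ → E) : Prop :=
  ∃ a : ℕ → E, (∀ i < n, ‖a i‖ ≤ B * ρ ^ i) ∧
    ∀ τ ∈ Icc (0 : ℝ) 1, ‖f τ - ∑ i ∈ Finset.range n, τ ^ i • a i‖ ≤ B * ρ ^ n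

section
variable {E : Type*} [NormedAddCommGroup E] [NormedSpace ℝ E] {n : ℕ} {B B' ρ : ℝ} {f f' : ℝ → E}

lemma PolyApprox.mono (hρ : 0 ≤ ρ) (hB : B ≤ B') (hf : PolyApprox n B ρ f) :
    PolyApprox n B' ρ f := by
  obtain ⟨a, h1, h2⟩ := hf
  exact ⟨a, fun i hi => (h1 i hi).trans (mul_le_mul_of_nonneg_right hB (by positivity)),
    fun τ hτ => (h2 τ hτ).trans (mul_le_mul_of_nonneg_right hB (by positivity))⟩

lemma PolyApprox.congr (hf : PolyApprox n B ρ f) (h : ∀ τ ∈ Icc (0 : ℝ) 1, f' τ = f τ) :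
    PolyApprox n B ρ f' := by
  obtain ⟨a, h1, h2⟩ := hf
  exact ⟨a, h1, fun τ hτ => by rw [h τ hτ]; exact h2 τ hτ⟩

lemma polyApprox_zero : PolyApprox n 0 ρ (fun _ => (0 : E)) :=
  ⟨fun _ => 0, fun i _ => by simp, fun τ _ => by simp⟩

/-- A function close to its constant term. -/
lemma polyApprox_one {v : E} (hv : ‖v‖ ≤ B) (hf : ∀ τ ∈ Icc (0 : ℝ) 1, ‖f τ - v‖ ≤ B * ρ) :
    PolyApprox 1 B ρ f :=
  ⟨fun _ => v, fun i hi => by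
    obtain rfl : i = 0 := by omega
    simpa using hv, fun τ hτ => by simpa using hf τ hτ⟩

lemma polyApprox_const (hn : 1 ≤ n) (hρ : 0 ≤ ρ) {v : E} (hv : ‖v‖ ≤ B) :
    PolyApprox n B ρ (fun _ => v) := by
  have hB : 0 ≤ B := (norm_nonneg _).trans hv
  refine ⟨fun i => if i = 0 then v else 0, fun i _ => ?_, fun τ _ => ?_⟩
  · by_cases h : i = 0
    · simpa [h] using hv
    · simp only [h, if_false, norm_zero]; positivity
  · rw [Finset.sum_eq_single 0]
    · simp only [pow_zero, if_true, one_smul, sub_self, norm_zero]; positivity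
    · intro b _ hb; simp [hb]
    · intro h; exact absurd (Finset.mem_range.2 (by omega)) h

lemma PolyApprox.add (hf : PolyApprox n B ρ f) (hf' : PolyApprox n B' ρ f') :
    PolyApprox n (B + B') ρ (fun τ => f τ + f' τ) := by
  obtain ⟨a, h1, h2⟩ := hf
  obtain ⟨a', h1', h2'⟩ := hf'
  refine ⟨fun i => a i + a' i, fun i hi => ?_, fun τ hτ => ?_⟩
  · rw [add_mul]
    exact (norm_add_le _ _).trans (add_le_add (h1 i hi) (h1' i hi))
  · simp only [smul_add, Finset.sum_add_distrib]
    rw [add_sub_add_comm, add_mul]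
    exact (norm_add_le _ _).trans (add_le_add (h2 τ hτ) (h2' τ hτ))

lemma PolyApprox.smul (b : ℝ) (hf : PolyApprox n B ρ f) :
    PolyApprox n (|b| * B) ρ (fun τ => b • f τ) := by
  obtain ⟨a, h1, h2⟩ := hf
  refine ⟨fun i => b • a i, fun i hi => ?_, fun τ hτ => ?_⟩
  · rw [norm_smul, Real.norm_eq_abs, mul_assoc]
    exact mul_le_mul_of_nonneg_left (h1 i hi) (abs_nonneg _)
  · simp only [smul_comm _ b]
    rw [← Finset.smul_sum, ← smul_sub, norm_smul, Real.norm_eq_abs, mul_assoc]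
    exact mul_le_mul_of_nonneg_left (h2 τ hτ) (abs_nonneg _)

lemma PolyApprox.sum {ι : Type*} (s : Finset ι) {F : ι → ℝ → E} {b : ι → ℝ}
    (hF : ∀ j ∈ s, PolyApprox n (b j) ρ (F j)) :
    PolyApprox n (∑ j ∈ s, b j) ρ (fun τ => ∑ j ∈ s, F j τ) := by
  classical
  induction s using Finset.induction_on with
  | empty => simpa using polyApprox_zero
  | insert j s hj ih =>
    simp only [Finset.sum_insert hj]
    exact (hF j (Finset.mem_insert_self _ _)).add
      (ih fun i hi => hF i (Finset.mem_insert_of_mem hi))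

/-- Integration over a time of length `h` gains one order, and the factor `h / ρ`. -/
lemma PolyApprox.integral [CompleteSpace E] (hf : PolyApprox n B ρ f)
    (hc : ContinuousOn f (Icc 0 1)) {h : ℝ} (hh : 0 ≤ h) (hρ : 0 ≤ ρ) (hB' : 0 ≤ B')
    (hB : h * B ≤ B' * ρ) :
    PolyApprox (n + 1) B' ρ (fun τ => h • ∫ s in (0 : ℝ)..τ, f s) := by
  obtain ⟨a, h1, h2⟩ := hf
  have hpow : ∀ i, h * (B * ρ ^ i) ≤ B' * ρ ^ (i + 1) := fun i => by
    have := mul_le_mul_of_nonneg_right hB (pow_nonneg hρ i)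
    rw [pow_succ]; linarith
  refine ⟨fun i => if i = 0 then 0 else (h * (i : ℝ)⁻¹) • a (i - 1), fun i hi => ?_,
    fun τ hτ => ?_⟩
  · rcases i with _ | i
    · simpa using hB'
    · simp only [Nat.add_eq_zero_iff, one_ne_zero, and_false, if_false, Nat.add_sub_cancel]
      rw [norm_smul, norm_mul, Real.norm_of_nonneg hh, norm_inv, Real.norm_natCast]
      have h3 := h1 i (by omega)
      have h4 : ((i + 1 : ℕ) : ℝ)⁻¹ ≤ 1 := inv_le_one_of_one_le₀ (by simp)
      calc h * ((i + 1 : ℕ) : ℝ)⁻¹ * ‖a i‖ ≤ h * 1 * (B * ρ ^ i) := by gcongr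
        _ ≤ _ := by rw [mul_one]; exact hpow i
  · rw [Finset.sum_range_succ']
    simp only [Nat.add_eq_zero_iff, one_ne_zero, and_false, if_false, Nat.add_sub_cancel,
      if_true, smul_zero, add_zero]
    have hsub : Icc (0 : ℝ) τ ⊆ Icc 0 1 := Icc_subset_Icc_right hτ.2
    have i1 : IntervalIntegrable f volume 0 τ := (hc.mono hsub).intervalIntegrable_of_Icc hτ.1
    have i2 : ∀ i ∈ Finset.range n,
        IntervalIntegrable (fun s : ℝ => s ^ i • a i) volume 0 τ := fun i _ =>
      ((continuous_pow i).smul continuous_const).intervalIntegrable _ _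
    have e1 : ∑ i ∈ Finset.range n, τ ^ (i + 1) • (h * ((i + 1 : ℕ) : ℝ)⁻¹) • a i =
        h • ∫ s in (0 : ℝ)..τ, ∑ i ∈ Finset.range n, s ^ i • a i := by
      rw [intervalIntegral.integral_finsetSum i2, Finset.smul_sum]
      refine Finset.sum_congr rfl fun i _ => ?_
      rw [intervalIntegral.integral_smul_const, integral_pow, smul_smul, smul_smul]
      congr 1
      push_cast
      simp only [ne_eq, Nat.add_eq_zero_iff, one_ne_zero, and_false, not_false_eq_true, zero_pow,
        sub_zero]
      field_simp
    rw [e1, ← smul_sub, ← intervalIntegral.integral_sub i1 (by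
      exact (continuous_finsetSum _ fun i _ =>
        (continuous_pow i).smul continuous_const).intervalIntegrable _ _),
      norm_smul, Real.norm_of_nonneg hh]
    have h3 := intervalIntegral.norm_integral_le_of_norm_le_const (a := (0 : ℝ)) (b := τ)
      (f := fun s => f s - ∑ i ∈ Finset.range n, s ^ i • a i) (C := B * ρ ^ n) (fun s hs => by
        rw [uIoc_of_le hτ.1] at hs
        exact h2 s ⟨hs.1.le, hs.2.trans hτ.2⟩)
    have hBn : 0 ≤ B * ρ ^ n := (norm_nonneg _).trans (h2 0 ⟨le_rfl, zero_le_one⟩)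
    calc _ ≤ h * (B * ρ ^ n * |τ - 0|) := mul_le_mul_of_nonneg_left h3 hh
      _ ≤ h * (B * ρ ^ n * 1) := by
          gcongr
          rw [sub_zero, abs_of_nonneg hτ.1]; exact hτ.2
      _ ≤ _ := by rw [mul_one]; exact hpow n

lemma sum_basis_eval_smul_poly {M : ℕ} {c : Fin M → ℝ} (hc : Function.Injective c) (hn : n ≤ M)
    (a : ℕ → E) (τ : ℝ) :
    ∑ j, (Lagrange.basis Finset.univ c j).eval τ • ∑ i ∈ Finset.range n, c j ^ i • a i =
      ∑ i ∈ Finset.range n, τ ^ i • a i := by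
  simp only [Finset.smul_sum]
  rw [Finset.sum_comm]
  refine Finset.sum_congr rfl fun i hi => ?_
  simp only [smul_smul]
  rw [← Finset.sum_smul]
  congr 1
  have hdeg : (Polynomial.X ^ i : Polynomial ℝ).degree < (Finset.univ : Finset (Fin M)).card := by
    rw [Polynomial.degree_X_pow, Finset.card_univ, Fintype.card_fin]
    exact_mod_cast (Finset.mem_range.1 hi).trans_le hn
  have h1 := Lagrange.eq_interpolate (s := Finset.univ) (v := c) hc.injOn hdeg
  have h2 := congrArg (Polynomial.eval τ) h1
  rw [Lagrange.interpolate_apply] at h2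
  simp only [Polynomial.eval_finsetSum, Polynomial.eval_mul, Polynomial.eval_C,
    Polynomial.eval_pow, Polynomial.eval_X] at h2
  rw [h2]
  exact Finset.sum_congr rfl fun j _ => mul_comm _ _

/-- Interpolation at `M` nodes preserves approximation to any order `n ≤ M`, because it reproduces
polynomials of degree less than `M`. -/
lemma PolyApprox.interpolate {M : ℕ} {c : Fin M → ℝ} (hc : Function.Injective c) (hn : n ≤ M)
    (hmem : ∀ j, c j ∈ Icc (0 : ℝ) 1) {Lb : ℝ} (hLb1 : 1 ≤ Lb)
    (hLb : ∀ τ ∈ Icc (0 : ℝ) 1, ∑ j, |(Lagrange.basis Finset.univ c j).eval τ| ≤ Lb)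
    (hB : 0 ≤ B) (hρ : 0 ≤ ρ) (hf : PolyApprox n B ρ f) :
    PolyApprox n (Lb * B) ρ
      (fun τ => ∑ j, (Lagrange.basis Finset.univ c j).eval τ • f (c j)) := by
  obtain ⟨a, h1, h2⟩ := hf
  refine ⟨a, fun i hi => (h1 i hi).trans (by
    rw [mul_assoc]; exact le_mul_of_one_le_left (by positivity) hLb1), fun τ hτ => ?_⟩
  rw [← sum_basis_eval_smul_poly hc hn a τ, ← Finset.sum_sub_distrib]
  simp only [← smul_sub]
  rw [mul_assoc]
  exact norm_sum_basis_smul_le (hLb τ hτ) (by positivity) fun j => h2 _ (hmem j)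

/-- The interpolation error of a function that is approximated to order `n`. -/
lemma PolyApprox.norm_sub_interpolate_le {M : ℕ} {c : Fin M → ℝ} (hc : Function.Injective c)
    (hn : n ≤ M) (hmem : ∀ j, c j ∈ Icc (0 : ℝ) 1) {Lb : ℝ}
    (hLb : ∀ τ ∈ Icc (0 : ℝ) 1, ∑ j, |(Lagrange.basis Finset.univ c j).eval τ| ≤ Lb)
    (hB : 0 ≤ B) (hρ : 0 ≤ ρ) (hf : PolyApprox n B ρ f) {τ : ℝ} (hτ : τ ∈ Icc (0 : ℝ) 1) :
    ‖f τ - ∑ j, (Lagrange.basis Finset.univ c j).eval τ • f (c j)‖ ≤ (1 + Lb) * (B * ρ ^ n) := by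
  obtain ⟨a, h1, h2⟩ := hf
  have h3 : ‖∑ j, (Lagrange.basis Finset.univ c j).eval τ •
      (f (c j) - ∑ i ∈ Finset.range n, c j ^ i • a i)‖ ≤ Lb * (B * ρ ^ n) :=
    norm_sum_basis_smul_le (hLb τ hτ) (by positivity) fun j => h2 _ (hmem j)
  simp only [smul_sub, Finset.sum_sub_distrib] at h3
  rw [sum_basis_eval_smul_poly hc hn a τ] at h3
  have h4 := norm_sub_le (f τ - ∑ i ∈ Finset.range n, τ ^ i • a i)
    (∑ j, (Lagrange.basis Finset.univ c j).eval τ • f (c j) - ∑ i ∈ Finset.range n, τ ^ i • a i)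
  rw [sub_sub_sub_cancel_right] at h4
  linarith [h2 τ hτ]

lemma contDiff_poly (n : ℕ) (a : ℕ → E) {N : WithTop ℕ∞} :
    ContDiff ℝ N (fun τ : ℝ => ∑ i ∈ Finset.range n, τ ^ i • a i) :=
  ContDiff.sum fun i _ => (contDiff_id.pow i).smul contDiff_const

lemma norm_iteratedDeriv_poly_le (hB : 0 ≤ B) (hρ : 0 ≤ ρ) (hρ1 : ρ ≤ 1) {a : ℕ → E}
    (ha : ∀ i < n, ‖a i‖ ≤ B * ρ ^ i) {i : ℕ} (hi : i ≤ n) {τ : ℝ} (hτ : τ ∈ Icc (0 : ℝ) 1) :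
    ‖iteratedDeriv i (fun τ : ℝ => ∑ j ∈ Finset.range n, τ ^ j • a j) τ‖ ≤
      n * (n ^ n * B * ρ ^ i) := by
  rw [iteratedDeriv_fun_sum fun j _ =>
    ((contDiff_id.pow j).smul contDiff_const).contDiffAt]
  refine (norm_sum_le _ _).trans ?_
  have : ∀ j ∈ Finset.range n,
      ‖iteratedDeriv i (fun τ : ℝ => τ ^ j • a j) τ‖ ≤ n ^ n * B * ρ ^ i := by
    intro j hj
    have hj' := Finset.mem_range.1 hj
    rw [iteratedDeriv_smul_const (contDiff_id.pow j).contDiffAt, iteratedDeriv_pow, norm_smul,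
      norm_mul, Real.norm_natCast, norm_pow, Real.norm_of_nonneg hτ.1]
    rcases lt_or_ge j i with h | h
    · rw [Nat.descFactorial_eq_zero_iff_lt.2 h]
      simp only [Nat.cast_zero, zero_mul]
      positivity
    · have h1 : ((j.descFactorial i : ℕ) : ℝ) ≤ (n : ℝ) ^ n := by
        have h2 : j.descFactorial i ≤ n ^ n :=
          (Nat.descFactorial_le_pow j i).trans ((Nat.pow_le_pow_left hj'.le i).trans
            (Nat.pow_le_pow_right (by omega) hi))
        exact_mod_cast h2
      have h2 : τ ^ (j - i) ≤ 1 := pow_le_one₀ hτ.1 hτ.2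
      have h3 : ‖a j‖ ≤ B * ρ ^ i := (ha j hj').trans
        (mul_le_mul_of_nonneg_left (pow_le_pow_of_le_one hρ hρ1 h) hB)
      have h4 : (0 : ℝ) ≤ τ ^ (j - i) := pow_nonneg hτ.1 _
      calc _ ≤ (n : ℝ) ^ n * 1 * (B * ρ ^ i) := by gcongr
        _ = _ := by ring
  refine (Finset.sum_le_sum this).trans ?_
  rw [Finset.sum_const, Finset.card_range, nsmul_eq_mul]

/-- The bound produced by `PolyApprox.comp`. -/
def compBound (n : ℕ) (Γ B : ℝ) : ℝ :=
  Γ * B + n.factorial * Γ * max 1 (n * (n ^ n * B)) ^ n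

/-- Composition with a smooth map preserves polynomial approximation: replace the function by its
polynomial, and expand the smooth function of time so obtained by Taylor's formula, its derivatives
being controlled by the Faà di Bruno formula. -/
lemma PolyApprox.comp {F : Type*} [NormedAddCommGroup F] [NormedSpace ℝ F] (hn : 1 ≤ n)
    {Γ : ℝ} (hB : 0 ≤ B) (hρ : 0 ≤ ρ) (hρ1 : ρ ≤ 1) {G : E → F} (hG : ContDiff ℝ n G)
    (hΓ : ∀ i, 1 ≤ i → i ≤ n → ∀ x, ‖iteratedFDeriv ℝ i G x‖ ≤ Γ) (hf : PolyApprox n B ρ f) :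
    PolyApprox n (compBound n Γ B) ρ (fun τ => G (f τ) - G 0) := by
  obtain ⟨a, h1, h2⟩ := hf
  have hΓ0 : 0 ≤ Γ := (norm_nonneg _).trans (hΓ 1 le_rfl hn 0)
  have hLip : ∀ x y, ‖G x - G y‖ ≤ Γ * ‖x - y‖ := fun x y => by
    refine convex_univ.norm_image_sub_le_of_norm_fderiv_le (𝕜 := ℝ)
      (fun z _ => hG.differentiable (by exact_mod_cast (by omega : n ≠ 0)) z)
      (fun z _ => ?_) (mem_univ y) (mem_univ x)
    simpa [norm_iteratedFDeriv_one] using hΓ 1 le_rfl hn z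
  set q : ℝ → E := fun τ => ∑ i ∈ Finset.range n, τ ^ i • a i with hq
  set D := max 1 (n * (n ^ n * B)) with hD
  have hD1 : 1 ≤ D := le_max_left _ _
  have hqc : ContDiff ℝ n q := contDiff_poly n a
  have hφc : ContDiff ℝ n (G ∘ q) := hG.comp hqc
  have hder : ∀ i, 1 ≤ i → i ≤ n → ∀ τ ∈ Icc (0 : ℝ) 1,
      ‖iteratedDeriv i (G ∘ q) τ‖ ≤ i.factorial * Γ * (D * ρ) ^ i := by
    intro i hi hin τ hτ
    have hc1 : ContDiff ℝ i G := hG.of_le (by exact_mod_cast hin)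
    have hc2 : ContDiff ℝ i q := hqc.of_le (by exact_mod_cast hin)
    have hc3 : ContDiff ℝ i (G ∘ q) := hc1.comp hc2
    -- The derivatives of positive order do not see the constant that is subtracted here, and the
    -- derivative of order zero is bounded once it is.
    have key := norm_iteratedFDeriv_comp_le (𝕜 := ℝ) (g := fun z => G z - G (q τ)) (f := q)
      (n := i) (N := i) (hc1.sub contDiff_const) hc2 le_rfl τ (C := Γ) (D := D * ρ)
      (fun k hk => by
        rcases Nat.eq_zero_or_pos k with rfl | hk0
        · simpa using hΓ0
        · change ‖iteratedFDeriv ℝ k (G - fun _ => G (q τ)) (q τ)‖ ≤ Γ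
          rw [iteratedFDeriv_sub_apply (hc1.of_le (by exact_mod_cast hk)).contDiffAt
            contDiff_const.contDiffAt, iteratedFDeriv_const_of_ne hk0.ne']
          simpa using hΓ k hk0 (hk.trans hin) _)
      (fun k hk1 hk => by
        rw [norm_iteratedFDeriv_eq_norm_iteratedDeriv]
        refine (norm_iteratedDeriv_poly_le hB hρ hρ1 h1 (hk.trans hin) hτ).trans ?_
        rw [mul_pow, ← mul_assoc]
        refine mul_le_mul_of_nonneg_right ?_ (by positivity)
        exact (le_max_right _ _).trans (le_self_pow₀ hD1 (by omega)))
    have e1 : ((fun z => G z - G (q τ)) ∘ q) = (G ∘ q) - fun _ => G (q τ) := rfl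
    rw [e1, iteratedFDeriv_sub_apply hc3.contDiffAt contDiff_const.contDiffAt,
      iteratedFDeriv_const_of_ne (by omega), Pi.zero_apply, sub_zero,
      norm_iteratedFDeriv_eq_norm_iteratedDeriv] at key
    exact key
  obtain ⟨k, rfl⟩ : ∃ k, n = k + 1 := ⟨n - 1, by omega⟩
  have hud : UniqueDiffOn ℝ (Icc (0 : ℝ) 1) := uniqueDiffOn_Icc zero_lt_one
  have hin : ∀ i ≤ k + 1, ∀ τ ∈ Icc (0 : ℝ) 1,
      iteratedDerivWithin i (G ∘ q) (Icc 0 1) τ = iteratedDeriv i (G ∘ q) τ := fun i hi τ hτ =>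
    iteratedDerivWithin_eq_iteratedDeriv hud
      (hφc.of_le (by exact_mod_cast hi)).contDiffAt hτ
  have hmono : ∀ i ≤ k + 1, D ^ i ≤ D ^ (k + 1) := fun i hi => pow_le_pow_right₀ hD1 hi
  have hB0 : Γ * B ≤ compBound (k + 1) Γ B := by
    unfold compBound
    have : 0 ≤ ((k + 1).factorial : ℝ) * Γ * D ^ (k + 1) := by positivity
    linarith
  have h00 : (0 : ℝ) ∈ Icc (0 : ℝ) 1 := ⟨le_rfl, zero_le_one⟩
  -- The approximating polynomial is the Taylor polynomial of `G ∘ q - G 0` at `0`.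
  refine ⟨fun i => if i = 0 then G (q 0) - G 0 else
    ((i.factorial : ℝ)⁻¹) • iteratedDeriv i (G ∘ q) 0, fun i hi => ?_, fun τ hτ => ?_⟩
  · by_cases h0 : i = 0
    · subst h0
      simp only [if_true, pow_zero, mul_one]
      refine (hLip _ _).trans (le_trans ?_ hB0)
      have e2 : q 0 = a 0 := by
        simp only [hq]
        rw [Finset.sum_range_succ']
        simp
      rw [e2, sub_zero]
      exact mul_le_mul_of_nonneg_left (by simpa using h1 0 (by omega)) hΓ0
    · simp only [h0, if_false]
      rw [norm_smul, norm_inv, Real.norm_natCast]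
      have h3 := hder i (by omega) hi.le 0 h00
      have h5 : Γ * D ^ i ≤ compBound (k + 1) Γ B := by
        have e3 : Γ * D ^ i ≤ Γ * D ^ (k + 1) := mul_le_mul_of_nonneg_left (hmono i hi.le) hΓ0
        have e4 : Γ * D ^ (k + 1) ≤ (k + 1).factorial * (Γ * D ^ (k + 1)) :=
          le_mul_of_one_le_left (by positivity) (by exact_mod_cast Nat.factorial_pos _)
        have e5 : 0 ≤ Γ * B := by positivity
        unfold compBound
        linarith
      calc _ ≤ (i.factorial : ℝ)⁻¹ * (i.factorial * Γ * (D * ρ) ^ i) := by gcongr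
        _ = Γ * D ^ i * ρ ^ i := by rw [mul_pow]; field_simp
        _ ≤ _ := mul_le_mul_of_nonneg_right h5 (by positivity)
  · have htay := taylor_mean_remainder_bound (f := G ∘ q) (a := 0) (b := 1) (n := k)
      (C := (k + 1).factorial * Γ * (D * ρ) ^ (k + 1)) zero_le_one
      (by exact_mod_cast hφc.contDiffOn) hτ (fun s hs => by
        rw [hin (k + 1) le_rfl s hs]
        exact hder (k + 1) (by omega) le_rfl s hs)
    have e6 : taylorWithinEval (G ∘ q) k (Icc 0 1) 0 τ = G 0 + ∑ i ∈ Finset.range (k + 1),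
        τ ^ i • (if i = 0 then G (q 0) - G 0 else
          ((i.factorial : ℝ)⁻¹) • iteratedDeriv i (G ∘ q) 0) := by
      rw [taylor_within_apply, Finset.sum_range_succ', Finset.sum_range_succ' (n := k)]
      have : ∀ i ∈ Finset.range k, (((i + 1).factorial : ℝ)⁻¹ * (τ - 0) ^ (i + 1)) •
          iteratedDerivWithin (i + 1) (G ∘ q) (Icc 0 1) 0 = τ ^ (i + 1) •
          (if i + 1 = 0 then G (q 0) - G 0 else
          (((i + 1).factorial : ℝ)⁻¹) • iteratedDeriv (i + 1) (G ∘ q) 0) := by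
        intro i hi
        rw [hin (i + 1) (by have := Finset.mem_range.1 hi; omega) 0 h00, if_neg (by omega),
          smul_smul, sub_zero, mul_comm]
      rw [Finset.sum_congr rfl this]
      simp only [Nat.add_eq_zero_iff, one_ne_zero, and_false, if_false, iteratedDerivWithin_zero,
        Nat.factorial_zero, Nat.cast_one, inv_one, pow_zero, mul_one, one_smul, if_true,
        Function.comp]
      abel
    rw [e6] at htay
    set S := ∑ i ∈ Finset.range (k + 1),
        τ ^ i • (if i = 0 then G (q 0) - G 0 else
          ((i.factorial : ℝ)⁻¹) • iteratedDeriv i (G ∘ q) 0)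
    have h6 : ‖G (f τ) - G (q τ)‖ ≤ Γ * (B * ρ ^ (k + 1)) :=
      (hLip _ _).trans (mul_le_mul_of_nonneg_left (h2 τ hτ) hΓ0)
    have h7 : G (f τ) - G 0 - S = (G (f τ) - G (q τ)) + ((G ∘ q) τ - (G 0 + S)) := by
      simp only [Function.comp]; abel
    rw [h7]
    refine (norm_add_le _ _).trans ?_
    have h8 : ((k + 1).factorial : ℝ) * Γ * (D * ρ) ^ (k + 1) * (τ - 0) ^ (k + 1) / k.factorial ≤
        (k + 1).factorial * Γ * D ^ (k + 1) * ρ ^ (k + 1) := by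
      rw [sub_zero, mul_pow]
      have hp : (1 : ℝ) ≤ k.factorial := by exact_mod_cast k.factorial_pos
      refine (div_le_self (by have := hτ.1; positivity) hp).trans ?_
      rw [← mul_assoc]
      exact mul_le_of_le_one_right (by positivity) (pow_le_one₀ hτ.1 hτ.2)
    have h9 : compBound (k + 1) Γ B * ρ ^ (k + 1) = Γ * (B * ρ ^ (k + 1)) +
        (k + 1).factorial * Γ * D ^ (k + 1) * ρ ^ (k + 1) := by
      unfold compBound; ring
    rw [h9]
    exact add_le_add h6 (htay.trans h8)

end

/-! ### The local interpolation error -/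

/-- The fixed-point path of one step after rescaling time to `[0,1]`: `x τ` is the path at time
`h τ`, `A` bounds its size, and `ρ = h A ≤ 1` is the scale of its displacement. -/
structure ScaledStep {K d M : ℕ} [NeZero K] (γ : ℝ) (c : Fin M → ℝ) (ℓ Lb Γ C₀ h A : ℝ)
    (g : EuclideanSpace ℝ (Fin d) → EuclideanSpace ℝ (Fin d)) (y : State K d)
    (x : ℝ → State K d) : Prop where
  two_le : 2 ≤ K
  nodes_mem : ∀ j, c j ∈ Icc (0 : ℝ) 1
  nodes_pos : 0 < M
  nodes_inj : Function.Injective c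
  lebesgue : ∀ τ ∈ Icc (0 : ℝ) 1, ∑ j, |(Lagrange.basis Finset.univ c j).eval τ| ≤ Lb
  one_le_lebesgue : 1 ≤ Lb
  lip_nonneg : 0 ≤ ℓ
  smooth : ContDiff ℝ M g
  deriv_le : ∀ i, 1 ≤ i → i ≤ M → ∀ z, ‖iteratedFDeriv ℝ i g z‖ ≤ Γ
  pos : 0 < h
  one_le : 1 ≤ A
  scale_le : h * A ≤ 1
  start_le : ‖y‖ ≤ A
  grad_le : ‖g (y 0)‖ ≤ ℓ * A
  cont : ContinuousOn x (Icc 0 1)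
  close : ∀ τ ∈ Icc (0 : ℝ) 1, ∀ k : Fin K, (k : ℕ) + 1 < K → ‖x τ k - y k‖ ≤ C₀ * (h * A)
  eqn : ∀ τ ∈ Icc (0 : ℝ) 1, ∀ k : Fin K, (k : ℕ) + 1 < K → x τ k = y k -
    h • ∫ s in (0 : ℝ)..τ,
      drift γ (∑ j, (Lagrange.basis Finset.univ c j).eval s • g (x (c j) 0)) (x s) k

lemma driftMatrix_eq_zero {K : ℕ} {γ : ℝ} {k j : Fin K} (hj : (k : ℕ) + 1 < j) :
    (dampingMatrix K γ + skewMatrix K γ) k j = 0 := by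
  have h1 : k ≠ j := fun h => by subst h; omega
  simp only [Matrix.add_apply, dampingMatrix, skewMatrix, Matrix.diagonal_apply_ne _ h1,
    Matrix.of_apply]
  rw [if_neg (by omega), if_neg (by omega), add_zero]

section
variable {K M : ℕ} [NeZero K] {γ : ℝ} {c : Fin M → ℝ} {ℓ Lb Γ C₀ : ℝ}

/-- Block `k` of the path has `K - 1 - k` orders of smoothness: each integration of the chain of
equations gains one order over the neighbouring blocks, and the interpolated gradient inherits the
order of block `0`. The displacement of block `0` is bounded without the factor `A`, since it is
already of the size `h A` of the scale; this is what the composition with the gradient needs. -/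
lemma exists_polyApprox_scaledStep (hMK : M < K) (hΓ : 0 ≤ Γ) (hC₀ : 0 ≤ C₀)
    (n : ℕ) :
    n + 1 ≤ M → ∃ C : ℝ, 0 ≤ C ∧ ∀ (d : ℕ) (h A : ℝ)
      (g : EuclideanSpace ℝ (Fin d) → EuclideanSpace ℝ (Fin d)) (y : State K d)
      (x : ℝ → State K d), ScaledStep γ c ℓ Lb Γ C₀ h A g y x →
      (∀ k : Fin K, (k : ℕ) + (n + 1) < K → PolyApprox (n + 1) (C * A) (h * A) (fun τ => x τ k)) ∧
      PolyApprox (n + 1) C (h * A) (fun τ => x τ 0 - y 0) := by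
  induction n with
  | zero =>
    intro _
    refine ⟨1 + C₀, by positivity, fun d h A g y x H => ⟨fun k hk => ?_, ?_⟩⟩
    · have hA := H.one_le
      have hhA : 0 ≤ h * A := mul_nonneg H.pos.le (by linarith)
      refine polyApprox_one (v := y k) ?_ fun τ hτ => (H.close τ hτ k hk).trans ?_
      · refine (norm_le_pi_norm y k).trans (H.start_le.trans ?_)
        nlinarith
      · refine mul_le_mul_of_nonneg_right ?_ hhA
        nlinarith
    · have hhA : 0 ≤ h * A := mul_nonneg H.pos.le (by linarith [H.one_le])
      refine polyApprox_one (v := 0) (by simp; positivity) fun τ hτ => ?_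
      rw [sub_zero]
      refine (H.close τ hτ 0 ?_).trans (mul_le_mul_of_nonneg_right (by linarith) hhA)
      rw [Fin.val_zero]; have := H.two_le; omega
  | succ n ih =>
    intro hn
    obtain ⟨C, hC, ih⟩ := ih (by omega)
    set C1 := compBound (n + 1) Γ C with hC1
    set a := driftBound K γ with ha
    set C2 := C + (|ℓ| + |Lb| * C1) with hC2
    have ha1 : 1 ≤ a := one_le_driftBound K γ
    have hC1n : 0 ≤ C1 := by
      rw [hC1, compBound]
      positivity
    refine ⟨1 + a * C2, by positivity, fun d h A g y x H => ?_⟩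
    obtain ⟨ih1, ih2⟩ := ih d h A g y x H
    have hA := H.one_le
    have hA0 : 0 ≤ A := by linarith
    have hh := H.pos
    have hρ : 0 ≤ h * A := mul_nonneg hh.le hA0
    have hLb1 := H.one_le_lebesgue
    have hcomp : PolyApprox (n + 1) C1 (h * A) (fun τ => g (x τ 0) - g (y 0)) := by
      have hG : ContDiff ℝ (n + 1 : ℕ) (fun z => g (y 0 + z)) :=
        (H.smooth.of_le (by exact_mod_cast (by omega : n + 1 ≤ M))).comp
          (contDiff_const.add contDiff_id)
      refine (PolyApprox.comp (G := fun z => g (y 0 + z)) (Γ := Γ) (by omega) hC hρ H.scale_le hG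
        (fun i hi hin z => ?_) ih2).congr fun τ _ => by simp
      rw [iteratedFDeriv_comp_add_left]
      exact H.deriv_le i hi (by omega) _
    have hP : PolyApprox (n + 1) (C2 * A) (h * A)
        (fun τ => ∑ j, (Lagrange.basis Finset.univ c j).eval τ • g (x (c j) 0)) := by
      have h1 := (polyApprox_const (n := n + 1) (by omega) hρ H.grad_le).add
        (hcomp.interpolate H.nodes_inj (by omega) H.nodes_mem hLb1 H.lebesgue hC1n hρ)
      refine (h1.mono hρ ?_).congr fun τ _ => ?_
      · rw [hC2, abs_of_nonneg H.lip_nonneg, abs_of_nonneg (by linarith : 0 ≤ Lb)]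
        have : 0 ≤ Lb * C1 := by positivity
        nlinarith
      · simp only [smul_sub, Finset.sum_sub_distrib]
        rw [← Finset.sum_smul, sum_basis_eval_eq_one H.nodes_pos H.nodes_inj, one_smul]
        abel
    have hPc : Continuous (fun τ : ℝ =>
        ∑ j, (Lagrange.basis Finset.univ c j).eval τ • g (x (c j) 0)) :=
      continuous_finsetSum _ fun j _ => (Polynomial.continuous _).smul continuous_const
    -- Block `k` is driven by the blocks up to `k + 1` only, which are known to the previous order.
    have hint : ∀ k : Fin K, (k : ℕ) + (n + 1 + 1) < K → PolyApprox (n + 1 + 1) (a * C2) (h * A)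
        (fun τ => h • ∫ s in (0 : ℝ)..τ,
          drift γ (∑ j, (Lagrange.basis Finset.univ c j).eval s • g (x (c j) 0)) (x s) k) := by
      intro k hk
      have h1 : PolyApprox (n + 1) (∑ j, |(dampingMatrix K γ + skewMatrix K γ) k j| * (C2 * A))
          (h * A) (fun s => drift γ
            (∑ j, (Lagrange.basis Finset.univ c j).eval s • g (x (c j) 0)) (x s) k) := by
        unfold drift blockMul
        refine PolyApprox.sum _ fun j _ => ?_
        rcases lt_or_ge ((k : ℕ) + 1) j with hj | hj
        · rw [driftMatrix_eq_zero hj]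
          simpa using polyApprox_zero
        · refine PolyApprox.smul _ ?_
          by_cases hj0 : j = 0
          · simp only [hj0, if_true]
            exact hP
          · simp only [hj0, if_false]
            refine (ih1 j (by omega)).mono hρ (mul_le_mul_of_nonneg_right ?_ hA0)
            rw [hC2]
            have : 0 ≤ |ℓ| + |Lb| * C1 := by positivity
            linarith
      have h2 : ∑ j, |(dampingMatrix K γ + skewMatrix K γ) k j| * (C2 * A) ≤ a * (C2 * A) := by
        rw [← Finset.sum_mul]
        refine mul_le_mul_of_nonneg_right ?_ (by positivity)
        have h3 := Finset.single_le_sum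
          (f := fun i => ∑ j, |(dampingMatrix K γ + skewMatrix K γ) i j|)
          (fun i _ => Finset.sum_nonneg fun _ _ => abs_nonneg _) (Finset.mem_univ k)
        simp only [ha, driftBound, entrySum]
        linarith
      refine (h1.mono hρ h2).integral ?_ hh.le hρ (by positivity) (by nlinarith)
      exact continuousOn_pi.1 (continuousOn_drift hPc.continuousOn H.cont) k
    constructor
    · intro k hk
      have h1 := (polyApprox_const (n := n + 1 + 1) (by omega) hρ
        ((norm_le_pi_norm y k).trans H.start_le)).add ((hint k hk).smul (-1))
      refine (h1.mono hρ ?_).congr fun τ hτ => ?_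
      · rw [abs_neg, abs_one, one_mul, add_mul, one_mul]
        have : 0 ≤ a * C2 := by positivity
        nlinarith
      · rw [H.eqn τ hτ k (by omega)]
        module
    · have hK0 : ((0 : Fin K) : ℕ) + (n + 1 + 1) < K := by
        rw [Fin.val_zero]; omega
      refine (((hint 0 hK0).smul (-1)).mono hρ ?_).congr fun τ hτ => ?_
      · rw [abs_neg, abs_one, one_mul]; linarith
      · rw [H.eqn τ hτ 0 (by omega)]
        module

/-- A solution of the fixed-point equation, rescaled in time, is a `ScaledStep`. -/
lemma SolvesStep.scaledStep {d : ℕ} {U : EuclideanSpace ℝ (Fin d) → ℝ} {h : ℝ}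
    (H : StepAssumptions K γ U c ℓ Lb h) (hU : ContDiff ℝ M (gradient U))
    (hΓ : ∀ i, 1 ≤ i → i ≤ M → ∀ z, ‖iteratedFDeriv ℝ i (gradient U) z‖ ≤ Γ)
    {w : ℝ → State K d} (hw : ContinuousOn w (Icc 0 h)) {y : State K d} {Y : ℝ → State K d}
    (hS : SolvesStep γ U c h w y Y Y) (hA : h * (1 + ‖y‖ + meanNorm h w) ≤ 1) :
    ScaledStep γ c ℓ Lb Γ (4 * driftBound K γ * (Lb * ℓ + 1 + noiseBound K γ)) h
      (1 + ‖y‖ + meanNorm h w) (gradient U) y (fun τ => Y (h * τ)) := by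
  have hJ := meanNorm_nonneg H.pos w
  have hy := norm_nonneg y
  have hh := H.pos
  have ha := one_le_driftBound K γ
  have hb := one_le_noiseBound K γ
  have hκ := H.one_le_mul
  have hmem : ∀ τ ∈ Icc (0 : ℝ) 1, h * τ ∈ Icc 0 h := fun τ hτ =>
    ⟨mul_nonneg hh.le hτ.1, mul_le_of_le_one_right hh.le hτ.2⟩
  have hnoise : ∀ (t : ℝ) (k : Fin K), (k : ℕ) + 1 < K →
      blockMul (noiseMatrix K γ) (w t) k = 0 := fun t k hk => noise_apply_of_lt _ k hk
  refine ⟨H.two_le, H.nodes_mem, H.nodes_pos, H.nodes_inj, H.lebesgue, H.one_le_lebesgue,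
    by linarith [H.one_le_lip], hU, hΓ, H.pos, by linarith, hA, by linarith, ?_, ?_, ?_, ?_⟩
  · refine (H.norm_gradient_le _).trans (mul_le_mul_of_nonneg_left ?_ (by linarith [H.one_le_lip]))
    linarith [norm_le_pi_norm y 0]
  · exact hS.1.comp (continuous_const.mul continuous_id).continuousOn fun τ hτ => hmem τ hτ
  · intro τ hτ k hk
    have h1 := H.fixed_norm_sub_le hw hS (hmem τ hτ)
    have h2 := (norm_le_pi_norm _ k).trans h1
    simp only [Pi.sub_apply, hnoise _ k hk, sub_zero] at h2
    refine h2.trans ?_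
    unfold stepBound
    have h3 : (Lb * ℓ + 1) * ‖y‖ + noiseBound K γ * meanNorm h w ≤
        (Lb * ℓ + 1 + noiseBound K γ) * (1 + ‖y‖ + meanNorm h w) := by
      have e1 : 0 ≤ noiseBound K γ * (1 + ‖y‖) := by positivity
      have e2 : 0 ≤ (Lb * ℓ + 1) * (1 + meanNorm h w) := by positivity
      nlinarith
    calc _ ≤ 4 * driftBound K γ * h *
        ((Lb * ℓ + 1 + noiseBound K γ) * (1 + ‖y‖ + meanNorm h w)) := by gcongr
      _ = _ := by ring
  · intro τ hτ k hk
    have hsub : Icc 0 (h * τ) ⊆ Icc 0 h := Icc_subset_Icc_right (hmem τ hτ).2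
    have hi := ((continuousOn_drift (γ := γ) (continuous_interpolant U c h Y).continuousOn
      hS.1).mono hsub).intervalIntegrable_of_Icc (μ := volume) (hmem τ hτ).1
    have e1 : (∫ s in (0 : ℝ)..(h * τ), drift γ (interpolant U c h Y s) (Y s)) k =
        ∫ s in (0 : ℝ)..(h * τ), drift γ (interpolant U c h Y s) (Y s) k :=
      ((ContinuousLinearMap.proj (R := ℝ) (φ := fun _ : Fin K => EuclideanSpace ℝ (Fin d))
        k).intervalIntegral_comp_comm hi).symm
    have e2 := congrFun (hS.2 _ (hmem τ hτ)) k
    change Y (h * τ) k = y k - (∫ s in (0 : ℝ)..(h * τ),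
      drift γ (interpolant U c h Y s) (Y s)) k + blockMul (noiseMatrix K γ) (w (h * τ)) k at e2
    rw [hnoise _ k hk, add_zero, e1] at e2
    rw [e2]
    congr 1
    have e3 := intervalIntegral.smul_integral_comp_mul_left (a := (0 : ℝ)) (b := τ)
      (fun s => drift γ (interpolant U c h Y s) (Y s) k) h
    rw [mul_zero] at e3
    rw [← e3]
    congr 2
    funext s
    simp only [interpolant, mul_comm h, mul_div_cancel_right₀ s hh.ne']

/-- The interpolation error along the fixed-point path of one step has the order of the number of
nodes. -/
lemma exists_local_error_bound (hM : 0 < M) (hMK : M < K) (hΓ : 0 ≤ Γ) (hℓ : 1 ≤ ℓ)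
    (hLb : 1 ≤ Lb) :
    ∃ C : ℝ, 0 ≤ C ∧ ∀ (d : ℕ) (U : EuclideanSpace ℝ (Fin d) → ℝ) (h : ℝ),
      StepAssumptions K γ U c ℓ Lb h → ContDiff ℝ M (gradient U) →
      (∀ i, 1 ≤ i → i ≤ M → ∀ z, ‖iteratedFDeriv ℝ i (gradient U) z‖ ≤ Γ) →
      ∀ (w : ℝ → State K d), ContinuousOn w (Icc 0 h) → ∀ (y : State K d) (Y : ℝ → State K d),
      SolvesStep γ U c h w y Y Y → ∀ s ∈ Icc 0 h,
      ‖gradient U (Y s 0) - interpolant U c h Y s‖ ≤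
        C * (h * (1 + ‖y‖ + meanNorm h w)) ^ M := by
  have ha := one_le_driftBound K γ
  have hb := one_le_noiseBound K γ
  set C₀ := 4 * driftBound K γ * (Lb * ℓ + 1 + noiseBound K γ) with hC₀
  have hC₀n : 0 ≤ C₀ := by positivity
  obtain ⟨k, rfl⟩ : ∃ k, M = k + 1 := ⟨M - 1, by omega⟩
  obtain ⟨C, hC, hmain⟩ := exists_polyApprox_scaledStep (K := K) (γ := γ) (c := c) (ℓ := ℓ)
    (Lb := Lb) hMK hΓ hC₀n k le_rfl
  have hcb : 0 ≤ compBound (k + 1) Γ C := by rw [compBound]; positivity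
  refine ⟨(1 + Lb) * compBound (k + 1) Γ C + 2 * (Lb * ℓ) * C₀, by positivity,
    fun d U h H hU hder w hw y Y hS s hs => ?_⟩
  have hJ := meanNorm_nonneg H.pos w
  have hh := H.pos
  set A := 1 + ‖y‖ + meanNorm h w with hA
  have hρ : 0 ≤ h * A := by positivity
  rcases le_or_gt (h * A) 1 with h1 | h1
  · have hsc := hS.scaledStep H hU hder hw h1
    have h2 := (hmain d h A _ y _ hsc).2
    have hG : ContDiff ℝ (k + 1 : ℕ) (fun z => gradient U (y 0 + z)) :=
      hU.comp (contDiff_const.add contDiff_id)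
    have h3 : PolyApprox (k + 1) (compBound (k + 1) Γ C) (h * A)
        (fun τ => gradient U (Y (h * τ) 0) - gradient U (y 0)) := by
      refine (PolyApprox.comp (G := fun z => gradient U (y 0 + z)) (Γ := Γ) (by omega) hC hρ h1 hG
        (fun i hi hin z => ?_) h2).congr fun τ _ => by simp
      rw [iteratedFDeriv_comp_add_left]
      exact hder i hi hin _
    have h4 := h3.norm_sub_interpolate_le H.nodes_inj le_rfl H.nodes_mem H.lebesgue hcb hρ
      (H.div_mem hs)
    simp only [smul_sub, Finset.sum_sub_distrib] at h4
    rw [← Finset.sum_smul, sum_basis_eval_eq_one H.nodes_pos H.nodes_inj, one_smul,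
      sub_sub_sub_cancel_right, mul_div_cancel₀ s hh.ne'] at h4
    have h5 : interpolant U c h Y s = ∑ j, (Lagrange.basis Finset.univ c j).eval (s / h) •
        gradient U (Y (h * c j) 0) := by
      simp only [interpolant, mul_comm]
    rw [h5]
    refine h4.trans ?_
    rw [← mul_assoc]
    refine mul_le_mul_of_nonneg_right ?_ (by positivity)
    have : 0 ≤ 2 * (Lb * ℓ) * C₀ := by positivity
    linarith
  · -- At scales above `1` the zeroth order bound is enough.
    have hclose : ∀ t ∈ Icc 0 h, ‖Y t 0 - y 0‖ ≤ C₀ * (h * A) := fun t ht => by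
      refine (norm_apply_zero_sub_le (γ := γ) H.two_le _ _ (w t)).trans
        ((H.fixed_norm_sub_le hw hS ht).trans ?_)
      unfold stepBound
      have h3 : (Lb * ℓ + 1) * ‖y‖ + noiseBound K γ * meanNorm h w ≤
          (Lb * ℓ + 1 + noiseBound K γ) * A := by
        have e1 : 0 ≤ noiseBound K γ * (1 + ‖y‖) := by positivity
        have e2 : 0 ≤ (Lb * ℓ + 1) * (1 + meanNorm h w) := by positivity
        rw [hA]
        nlinarith
      calc _ ≤ 4 * driftBound K γ * h * ((Lb * ℓ + 1 + noiseBound K γ) * A) := by gcongr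
        _ = _ := by rw [hC₀]; ring
    have h2 := H.norm_interpolant_sub_gradient_le hclose hs
    have h3 := (H.lip (Y s 0) (y 0)).trans
      (mul_le_mul_of_nonneg_left (hclose s hs) (by linarith))
    have h4 := norm_sub_le (gradient U (Y s 0) - gradient U (y 0))
      (interpolant U c h Y s - gradient U (y 0))
    rw [sub_sub_sub_cancel_right] at h4
    have h5 : ℓ ≤ Lb * ℓ := le_mul_of_one_le_left (by linarith) hLb
    have h6 : 0 ≤ C₀ * (h * A) := by positivity
    have h7 : h * A ≤ (h * A) ^ (k + 1) := le_self_pow₀ h1.le (by omega)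
    calc _ ≤ 2 * (Lb * ℓ) * C₀ * (h * A) := by nlinarith
      _ ≤ 2 * (Lb * ℓ) * C₀ * (h * A) ^ (k + 1) := by gcongr
      _ ≤ _ := by
        refine mul_le_mul_of_nonneg_right ?_ (by positivity)
        have : 0 ≤ (1 + Lb) * compBound (k + 1) Γ C := by positivity
        linarith

end

/-! ### A Lyapunov function for the dynamics -/

/-- The blocks of a state as a sequence, extended by zero. -/
def blockSeq {K d : ℕ} (x : State K d) (k : ℕ) : EuclideanSpace ℝ (Fin d) :=
  if h : k < K then x ⟨k, h⟩ else 0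

section
variable {K d : ℕ}

lemma blockSeq_of_le (x : State K d) {k : ℕ} (h : K ≤ k) : blockSeq x k = 0 := by
  simp [blockSeq, h]

lemma blockSeq_val (x : State K d) (k : Fin K) : blockSeq x k = x k := by
  simp [blockSeq]

lemma blockSeq_zero_index [NeZero K] (x : State K d) : blockSeq x 0 = x 0 := by
  have := blockSeq_val x 0
  rwa [Fin.val_zero] at this

lemma blockSeq_add (x y : State K d) (k : ℕ) :
    blockSeq (x + y) k = blockSeq x k + blockSeq y k := by
  unfold blockSeq; split_ifs <;> simp

lemma blockSeq_smul (a : ℝ) (x : State K d) (k : ℕ) :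
    blockSeq (a • x) k = a • blockSeq x k := by
  unfold blockSeq; split_ifs <;> simp

lemma norm_blockSeq_le (x : State K d) (k : ℕ) : ‖blockSeq x k‖ ≤ ‖x‖ := by
  unfold blockSeq
  split_ifs with h
  · exact norm_le_pi_norm x _
  · simp

/-- The couplings between neighbouring blocks: `1` between the first two, `γ` afterwards. -/
def coupling (γ : ℝ) (k : ℕ) : ℝ := if k = 0 then 1 else γ

/-- The chain structure of the drift: each block is driven by its two neighbours, and only the last
one is damped. -/
lemma blockSeq_neg_drift [NeZero K] (γ : ℝ) (p : EuclideanSpace ℝ (Fin d)) (x : State K d) {k : ℕ}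
    (hk : k < K) (q : ℕ → EuclideanSpace ℝ (Fin d)) (hq0 : q 0 = p)
    (hq : ∀ k, k ≠ 0 → q k = blockSeq x k) :
    blockSeq (-drift γ p x) k = coupling γ k • q (k + 1)
      - (if k = 0 then 0 else coupling γ (k - 1) • q (k - 1))
      - (if k + 1 = K then γ • q k else 0) := by
  have h0 : blockSeq (-drift γ p x) k = -drift γ p x ⟨k, hk⟩ := by simp [blockSeq, hk]
  have hqv : ∀ j : Fin K, (if j = 0 then p else x j) = q j := fun j => by
    by_cases hj : j = 0
    · subst hj; simp [hq0]
    · rw [if_neg hj, hq _ (fun h => hj (Fin.ext (by simpa using h))), blockSeq_val]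
  have h1 : drift γ p x ⟨k, hk⟩ = ∑ j ∈ Finset.range K,
      ((if k = j then (if k + 1 = K then γ else 0) else 0) +
        (if k + 1 = j then -coupling γ k else if j + 1 = k then coupling γ j else 0)) • q j := by
    rw [← Fin.sum_univ_eq_sum_range (fun j => ((if k = j then (if k + 1 = K then γ else 0) else 0) +
        (if k + 1 = j then -coupling γ k else if j + 1 = k then coupling γ j else 0)) • q j) K]
    unfold drift blockMul
    refine Finset.sum_congr rfl fun j _ => ?_
    change (dampingMatrix K γ + skewMatrix K γ) ⟨k, hk⟩ j • (if j = 0 then p else x j) = _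
    rw [hqv]
    congr 1
    simp only [dampingMatrix, skewMatrix, Matrix.add_apply, Matrix.diagonal_apply, Matrix.of_apply,
      coupling, Fin.ext_iff]
    congr 1
    split_ifs <;> rfl
  rw [h0, h1]
  simp only [add_smul, Finset.sum_add_distrib]
  have e1 : ∑ j ∈ Finset.range K, (if k = j then (if k + 1 = K then γ else 0) else 0) • q j =
      if k + 1 = K then γ • q k else 0 := by
    rw [Finset.sum_eq_single k]
    · by_cases h : k + 1 = K <;> simp [h]
    · intro j _ hj; simp [hj.symm]
    · intro h; exact absurd (Finset.mem_range.2 hk) h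
  have e2 : ∑ j ∈ Finset.range K, (if k + 1 = j then -coupling γ k else
      if j + 1 = k then coupling γ j else 0) • q j =
      -(coupling γ k • q (k + 1)) + if k = 0 then 0 else coupling γ (k - 1) • q (k - 1) := by
    have hs : ∀ j, (if k + 1 = j then -coupling γ k else
      if j + 1 = k then coupling γ j else 0) • q j =
        (if k + 1 = j then -(coupling γ k • q j) else 0)
        + (if j + 1 = k then coupling γ j • q j else 0) := fun j => by
      by_cases h1 : k + 1 = j
      · have : ¬ j + 1 = k := by omega
        simp [h1, this]
      · simp [h1]
    simp only [hs, Finset.sum_add_distrib]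
    congr 1
    · rw [Finset.sum_ite_eq]
      by_cases h : k + 1 < K
      · simp [h]
      · have h2 : q (k + 1) = 0 := by rw [hq _ (by omega), blockSeq_of_le x (by omega)]
        simp [h, h2]
    · rcases k with _ | k
      · simp
      · simp only [Nat.add_right_cancel_iff, Nat.add_eq_zero_iff, one_ne_zero, and_false, if_false,
          Nat.add_sub_cancel]
        rw [Finset.sum_ite_eq' (Finset.range K) k]
        simp [show k < K by omega]
  rw [e1, e2]
  abel

end

/-- The weights of the cross terms in the Lyapunov function. For `δ < 1` their logarithms are
strictly convex in the index, and the weights increase with the index; this makes every off-diagonal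
term small compared with the diagonal ones. -/
def crossWeight (K : ℕ) (δ : ℝ) (k : ℕ) : ℝ := δ ^ (K ^ 2 - (k + 1) ^ 2)

section
variable {K : ℕ} {δ : ℝ}

lemma crossWeight_pos (hδ : 0 < δ) (k : ℕ) : 0 < crossWeight K δ k := pow_pos hδ _

lemma crossWeight_last (hK : 1 ≤ K) : crossWeight K δ (K - 1) = 1 := by
  rw [crossWeight, Nat.sub_add_cancel hK, Nat.sub_self, pow_zero]

lemma le_crossWeight (hδ : 0 ≤ δ) (hδ1 : δ ≤ 1) (k : ℕ) : δ ^ (K ^ 2) ≤ crossWeight K δ k :=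
  pow_le_pow_of_le_one hδ hδ1 (Nat.sub_le _ _)

lemma crossWeight_le_one (hδ : 0 ≤ δ) (hδ1 : δ ≤ 1) (k : ℕ) : crossWeight K δ k ≤ 1 :=
  pow_le_one₀ hδ hδ1

lemma crossWeight_le_of_lt (hδ : 0 ≤ δ) (hδ1 : δ ≤ 1) {k j : ℕ} (hkj : k < j) (hj : j < K) :
    crossWeight K δ k ≤ δ ^ 2 * crossWeight K δ j := by
  rw [crossWeight, crossWeight, ← pow_add]
  refine pow_le_pow_of_le_one hδ hδ1 ?_
  have h1 : (j + 1) ^ 2 ≤ K ^ 2 := Nat.pow_le_pow_left hj 2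
  have h2 : (k + 1) ^ 2 + 2 ≤ (j + 1) ^ 2 := by nlinarith
  omega

lemma crossWeight_le (hδ : 0 ≤ δ) (hδ1 : δ ≤ 1) {k : ℕ} (hk : k + 1 < K) :
    crossWeight K δ k ≤ δ := by
  refine (crossWeight_le_of_lt hδ hδ1 (Nat.lt_succ_self k) hk).trans ?_
  have h1 := crossWeight_le_one (K := K) hδ hδ1 (k + 1)
  nlinarith [sq_nonneg δ, mul_le_of_le_one_right (sq_nonneg δ) h1]

lemma crossWeight_sq (k : ℕ) (hk : k + 2 < K) :
    crossWeight K δ (k + 1) ^ 2 = δ ^ 2 * (crossWeight K δ k * crossWeight K δ (k + 2)) := by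
  simp only [crossWeight, ← pow_mul, ← pow_add]
  congr 1
  have h1 : (k + 2 + 1) ^ 2 ≤ K ^ 2 := Nat.pow_le_pow_left hk 2
  have h2 : (k + 2 + 1) ^ 2 = k ^ 2 + 6 * k + 9 := by ring
  have h3 : (k + 1 + 1) ^ 2 = k ^ 2 + 4 * k + 4 := by ring
  have h4 : (k + 1) ^ 2 = k ^ 2 + 2 * k + 1 := by ring
  omega

/-- The weighted inequality `e s t ≤ δ (a s² + b t²) / 2` for `e² ≤ δ² a b`. -/
lemma mul_mul_le_of_sq_le {e a b s t : ℝ} (hδ : 0 ≤ δ) (ha : 0 ≤ a)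
    (hb : 0 ≤ b) (h : e ^ 2 ≤ δ ^ 2 * (a * b)) :
    e * s * t ≤ δ * (a * s ^ 2 + b * t ^ 2) / 2 := by
  have h1 : (e * s * t) ^ 2 ≤ (δ * (a * s ^ 2 + b * t ^ 2) / 2) ^ 2 := by
    have e1 : (e * s * t) ^ 2 ≤ δ ^ 2 * (a * b) * (s ^ 2 * t ^ 2) := by
      have := mul_le_mul_of_nonneg_right h (by positivity : 0 ≤ s ^ 2 * t ^ 2)
      linarith [this, (by ring : (e * s * t) ^ 2 = e ^ 2 * (s ^ 2 * t ^ 2))]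
    nlinarith [mul_nonneg (sq_nonneg δ) (sq_nonneg (a * s ^ 2 - b * t ^ 2))]
  exact abs_le_of_sq_le_sq' h1 (by positivity) |>.2

/-- The dissipation inequality behind the Lyapunov function, as an inequality for the norms of the
blocks. -/
lemma sum_crossWeight_le (hK : 2 ≤ K) (hδ : 0 < δ) (hδ1 : δ ≤ 1) {c₀ γ B : ℝ} (hB : 0 ≤ B)
    (hcγ : c₀ ≤ γ) (hsmall : 4 * K * B * δ ≤ c₀ / 2) {ξ : ℕ → ℝ} (hξ : ∀ k, K ≤ k → ξ k = 0) :
    -γ * ξ (K - 1) ^ 2 + ∑ k ∈ Finset.range (K - 1), crossWeight K δ k * (-c₀ * ξ k ^ 2 +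
      B * (ξ (k + 1) ^ 2 + (if k = 0 then 0 else ξ (k - 1) * ξ (k + 1)) + ξ k * ξ (k + 2) +
        ξ k * ξ (k + 1))) ≤
      -(c₀ / 2) * ∑ k ∈ Finset.range K, crossWeight K δ k * ξ k ^ 2 := by
  set S := ∑ k ∈ Finset.range K, crossWeight K δ k * ξ k ^ 2 with hS
  have hw : ∀ k, 0 < crossWeight K δ k := crossWeight_pos hδ
  have hterm : ∀ k, crossWeight K δ k * ξ k ^ 2 ≤ S := fun k => by
    have hS0 : 0 ≤ S := Finset.sum_nonneg fun k _ => mul_nonneg (hw k).le (sq_nonneg _)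
    by_cases hk : k < K
    · exact Finset.single_le_sum (f := fun k => crossWeight K δ k * ξ k ^ 2)
        (fun k _ => mul_nonneg (hw k).le (sq_nonneg _)) (Finset.mem_range.2 hk)
    · rw [hξ k (by omega)]; simpa using hS0
  have hS0 : 0 ≤ S := Finset.sum_nonneg fun k _ => mul_nonneg (hw k).le (sq_nonneg _)
  have hpair : ∀ i k j : ℕ, crossWeight K δ i ^ 2 ≤
      δ ^ 2 * (crossWeight K δ k * crossWeight K δ j) →
      crossWeight K δ i * ξ k * ξ j ≤ δ * S := fun i k j h => by
    refine (mul_mul_le_of_sq_le hδ.le (hw k).le (hw j).le h).trans ?_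
    nlinarith [hterm k, hterm j]
  have hstep : ∀ k j, k < j → j < K → crossWeight K δ k ^ 2 ≤
      δ ^ 2 * (crossWeight K δ k * crossWeight K δ j) := fun k j hkj hj => by
    have := crossWeight_le_of_lt hδ.le hδ1 hkj hj
    nlinarith [hw k]
  have hbad : ∀ k ∈ Finset.range (K - 1), crossWeight K δ k * (-c₀ * ξ k ^ 2 +
      B * (ξ (k + 1) ^ 2 + (if k = 0 then 0 else ξ (k - 1) * ξ (k + 1)) + ξ k * ξ (k + 2) +
        ξ k * ξ (k + 1))) ≤ -c₀ * (crossWeight K δ k * ξ k ^ 2) + B * (4 * (δ * S)) := by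
    intro k hk
    have hk' : k + 1 < K := by have := Finset.mem_range.1 hk; omega
    have hδS : 0 ≤ δ * S := mul_nonneg hδ.le hS0
    have e1 : crossWeight K δ k * ξ (k + 1) ^ 2 ≤ δ * S := by
      have h1 : crossWeight K δ k ≤ δ ^ 2 * crossWeight K δ (k + 1) :=
        crossWeight_le_of_lt hδ.le hδ1 (Nat.lt_succ_self k) hk'
      have h2 := hterm (k + 1)
      have h3 : crossWeight K δ k ≤ δ * crossWeight K δ (k + 1) :=
        h1.trans (mul_le_mul_of_nonneg_right (by nlinarith) (hw (k + 1)).le)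
      calc _ ≤ δ * crossWeight K δ (k + 1) * ξ (k + 1) ^ 2 := by gcongr
        _ = δ * (crossWeight K δ (k + 1) * ξ (k + 1) ^ 2) := by ring
        _ ≤ _ := by gcongr
    have e2 : crossWeight K δ k * (if k = 0 then 0 else ξ (k - 1) * ξ (k + 1)) ≤ δ * S := by
      rcases k with _ | k
      · simpa using hδS
      · rw [if_neg (by omega), ← mul_assoc]
        exact hpair (k + 1) k (k + 2) (crossWeight_sq k hk').le
    have e3 : crossWeight K δ k * ξ k * ξ (k + 2) ≤ δ * S := by
      by_cases h : k + 2 < K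
      · exact hpair k k (k + 2) (hstep k (k + 2) (by omega) h)
      · rw [hξ (k + 2) (by omega), mul_zero]; exact hδS
    have e4 := hpair k k (k + 1) (hstep k (k + 1) (by omega) hk')
    have e5 : crossWeight K δ k * (ξ (k + 1) ^ 2 +
        (if k = 0 then 0 else ξ (k - 1) * ξ (k + 1)) + ξ k * ξ (k + 2) + ξ k * ξ (k + 1)) ≤
        4 * (δ * S) := by
      rw [mul_add, mul_add, mul_add, ← mul_assoc, ← mul_assoc]
      linarith
    have e6 := mul_le_mul_of_nonneg_left e5 hB
    calc _ = -c₀ * (crossWeight K δ k * ξ k ^ 2) + B * (crossWeight K δ k * (ξ (k + 1) ^ 2 +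
        (if k = 0 then 0 else ξ (k - 1) * ξ (k + 1)) + ξ k * ξ (k + 2) + ξ k * ξ (k + 1))) := by
          ring
      _ ≤ _ := by linarith
  have hsum := Finset.sum_le_sum hbad
  rw [Finset.sum_add_distrib, ← Finset.mul_sum, Finset.sum_const, Finset.card_range,
    nsmul_eq_mul] at hsum
  have hsplit : S = ∑ k ∈ Finset.range (K - 1), crossWeight K δ k * ξ k ^ 2 + ξ (K - 1) ^ 2 := by
    have : K = (K - 1) + 1 := by omega
    rw [hS]
    conv_lhs => rw [this, Finset.sum_range_succ]
    rw [← this, crossWeight_last (by omega), one_mul]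
  have hcount : ((K - 1 : ℕ) : ℝ) * (B * (4 * (δ * S))) ≤ c₀ / 2 * S := by
    have h1 : ((K - 1 : ℕ) : ℝ) ≤ K := by exact_mod_cast Nat.sub_le _ _
    calc _ ≤ (K : ℝ) * (B * (4 * (δ * S))) := by gcongr
      _ = 4 * K * B * δ * S := by ring
      _ ≤ _ := by gcongr
  have h5 : -γ * ξ (K - 1) ^ 2 ≤ -c₀ * ξ (K - 1) ^ 2 := by nlinarith [sq_nonneg (ξ (K - 1))]
  have h6 := congrArg (fun z => -c₀ * z) hsplit
  simp only [mul_add] at h6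
  linarith

end

/-- The Lyapunov function: the energy `U(x₁) + ½ ∑ₖ ‖xₖ‖²` of the dynamics plus small multiples of
the inner products of neighbouring blocks, which make the energy dissipate in every block. -/
def lyapunov {K d : ℕ} (U : EuclideanSpace ℝ (Fin d) → ℝ) (δ : ℝ) (x : State K d) : ℝ :=
  U (blockSeq x 0) + ∑ k ∈ Finset.range K, 1 / 2 * ‖blockSeq x (k + 1)‖ ^ 2 +
    ∑ k ∈ Finset.range K, crossWeight K δ k * inner ℝ (blockSeq x k) (blockSeq x (k + 1))

/-- The derivative of `lyapunov` at `x` in the direction `v`. -/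
def lyapunovDeriv {K d : ℕ} (U : EuclideanSpace ℝ (Fin d) → ℝ) (δ : ℝ) (x v : State K d) : ℝ :=
  inner ℝ (gradient U (blockSeq x 0)) (blockSeq v 0) +
    ∑ k ∈ Finset.range K, inner ℝ (blockSeq x (k + 1)) (blockSeq v (k + 1)) +
    ∑ k ∈ Finset.range K, crossWeight K δ k *
      (inner ℝ (blockSeq v k) (blockSeq x (k + 1)) + inner ℝ (blockSeq x k) (blockSeq v (k + 1)))

section
variable {K d : ℕ} {U : EuclideanSpace ℝ (Fin d) → ℝ} {δ m L ℓ γ : ℝ}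

lemma exists_norm_eq_norm_apply [NeZero K] (x : State K d) : ∃ i : Fin K, ‖x‖ = ‖x i‖ := by
  obtain ⟨i, -, hi⟩ := Finset.exists_max_image Finset.univ (fun i => ‖x i‖)
    ⟨(0 : Fin K), Finset.mem_univ _⟩
  exact ⟨i, le_antisymm ((pi_norm_le_iff_of_nonneg (norm_nonneg _)).2 fun j =>
    hi j (Finset.mem_univ _)) (norm_le_pi_norm x i)⟩

lemma inner_blockSeq_le (x y : State K d) (i j : ℕ) :
    |inner ℝ (blockSeq x i) (blockSeq y j)| ≤ ‖x‖ * ‖y‖ :=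
  (abs_real_inner_le_norm _ _).trans
    (mul_le_mul (norm_blockSeq_le _ _) (norm_blockSeq_le _ _) (norm_nonneg _) (norm_nonneg _))

lemma sum_range_le_mul {f : ℕ → ℝ} {b : ℝ} (hf : ∀ k < K, f k ≤ b) :
    ∑ k ∈ Finset.range K, f k ≤ K * b := by
  refine (Finset.sum_le_sum fun k hk => hf k (Finset.mem_range.1 hk)).trans ?_
  rw [Finset.sum_const, Finset.card_range, nsmul_eq_mul]

lemma lyapunov_add_le (hL : 0 ≤ L) (hU : StronglyConvexSmooth U m L) (hδ : 0 < δ) (hδ1 : δ ≤ 1)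
    (x v : State K d) :
    lyapunov U δ (x + v) ≤ lyapunov U δ x + lyapunovDeriv U δ x v + (L + 2 * K) * ‖v‖ ^ 2 := by
  have h1 := (hU (blockSeq x 0) (blockSeq x 0 + blockSeq v 0)).2
  rw [add_sub_cancel_left] at h1
  have h2 : L / 2 * ‖blockSeq v 0‖ ^ 2 ≤ L * ‖v‖ ^ 2 := by
    have := pow_le_pow_left₀ (norm_nonneg _) (norm_blockSeq_le v 0) 2
    nlinarith [sq_nonneg ‖v‖]
  have h3 : ∑ k ∈ Finset.range K, 1 / 2 * ‖blockSeq (x + v) (k + 1)‖ ^ 2 ≤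
      ∑ k ∈ Finset.range K, 1 / 2 * ‖blockSeq x (k + 1)‖ ^ 2 +
      ∑ k ∈ Finset.range K, inner ℝ (blockSeq x (k + 1)) (blockSeq v (k + 1)) + K * ‖v‖ ^ 2 := by
    have : ∑ k ∈ Finset.range K, 1 / 2 * ‖blockSeq (x + v) (k + 1)‖ ^ 2 =
        ∑ k ∈ Finset.range K, 1 / 2 * ‖blockSeq x (k + 1)‖ ^ 2 +
        ∑ k ∈ Finset.range K, inner ℝ (blockSeq x (k + 1)) (blockSeq v (k + 1)) +
        ∑ k ∈ Finset.range K, 1 / 2 * ‖blockSeq v (k + 1)‖ ^ 2 := by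
      rw [← Finset.sum_add_distrib, ← Finset.sum_add_distrib]
      refine Finset.sum_congr rfl fun k _ => ?_
      rw [blockSeq_add, norm_add_sq_real]
      ring
    rw [this]
    refine add_le_add_right (sum_range_le_mul fun k _ => ?_) _
    have := pow_le_pow_left₀ (norm_nonneg _) (norm_blockSeq_le v (k + 1)) 2
    nlinarith [sq_nonneg ‖v‖]
  have h4 : ∑ k ∈ Finset.range K,
      crossWeight K δ k * inner ℝ (blockSeq (x + v) k) (blockSeq (x + v) (k + 1)) ≤
      ∑ k ∈ Finset.range K, crossWeight K δ k * inner ℝ (blockSeq x k) (blockSeq x (k + 1)) +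
      ∑ k ∈ Finset.range K, crossWeight K δ k * (inner ℝ (blockSeq v k) (blockSeq x (k + 1)) +
        inner ℝ (blockSeq x k) (blockSeq v (k + 1))) + K * ‖v‖ ^ 2 := by
    have : ∑ k ∈ Finset.range K,
        crossWeight K δ k * inner ℝ (blockSeq (x + v) k) (blockSeq (x + v) (k + 1)) =
        ∑ k ∈ Finset.range K, crossWeight K δ k * inner ℝ (blockSeq x k) (blockSeq x (k + 1)) +
        ∑ k ∈ Finset.range K, crossWeight K δ k * (inner ℝ (blockSeq v k) (blockSeq x (k + 1)) +
          inner ℝ (blockSeq x k) (blockSeq v (k + 1))) +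
        ∑ k ∈ Finset.range K, crossWeight K δ k * inner ℝ (blockSeq v k) (blockSeq v (k + 1)) := by
      rw [← Finset.sum_add_distrib, ← Finset.sum_add_distrib]
      refine Finset.sum_congr rfl fun k _ => ?_
      rw [blockSeq_add, blockSeq_add, inner_add_left, inner_add_right, inner_add_right]
      ring
    rw [this]
    refine add_le_add_right (sum_range_le_mul fun k _ => ?_) _
    have h5 := (le_abs_self _).trans (inner_blockSeq_le v v k (k + 1))
    have h6 := crossWeight_le_one (K := K) hδ.le hδ1 k
    have h7 := crossWeight_pos (K := K) hδ k
    nlinarith [sq_nonneg ‖v‖]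
  have h8 : blockSeq (x + v) 0 = blockSeq x 0 + blockSeq v 0 := blockSeq_add x v 0
  unfold lyapunov lyapunovDeriv
  rw [h8]
  linarith

lemma lyapunovDeriv_smul_add (x v e : State K d) (h : ℝ) :
    lyapunovDeriv U δ x (h • v + e) = h * lyapunovDeriv U δ x v + lyapunovDeriv U δ x e := by
  unfold lyapunovDeriv
  simp only [blockSeq_add, blockSeq_smul, inner_add_left, inner_add_right, inner_smul_left,
    inner_smul_right, RCLike.conj_to_real]
  rw [mul_add, mul_add, Finset.mul_sum, Finset.mul_sum, Finset.sum_add_distrib]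
  have : ∑ k ∈ Finset.range K, crossWeight K δ k *
      (h * inner ℝ (blockSeq v k) (blockSeq x (k + 1)) +
        inner ℝ (blockSeq e k) (blockSeq x (k + 1)) +
      (h * inner ℝ (blockSeq x k) (blockSeq v (k + 1)) +
        inner ℝ (blockSeq x k) (blockSeq e (k + 1)))) =
      ∑ k ∈ Finset.range K, h * (crossWeight K δ k * (inner ℝ (blockSeq v k) (blockSeq x (k + 1)) +
        inner ℝ (blockSeq x k) (blockSeq v (k + 1)))) +
      ∑ k ∈ Finset.range K, crossWeight K δ k * (inner ℝ (blockSeq e k) (blockSeq x (k + 1)) +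
        inner ℝ (blockSeq x k) (blockSeq e (k + 1))) := by
    rw [← Finset.sum_add_distrib]
    exact Finset.sum_congr rfl fun k _ => by ring
  rw [this]
  ring

lemma lyapunovDeriv_le (hℓ : 0 ≤ ℓ) (hg : ∀ z, ‖gradient U z‖ ≤ ℓ * ‖z‖) (hδ : 0 < δ)
    (hδ1 : δ ≤ 1) (x v : State K d) :
    lyapunovDeriv U δ x v ≤ (ℓ + 3 * K) * (‖x‖ * ‖v‖) := by
  have h1 : inner ℝ (gradient U (blockSeq x 0)) (blockSeq v 0) ≤ ℓ * (‖x‖ * ‖v‖) := by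
    refine (real_inner_le_norm _ _).trans ?_
    rw [← mul_assoc]
    refine mul_le_mul ((hg _).trans (mul_le_mul_of_nonneg_left (norm_blockSeq_le _ _) hℓ))
      (norm_blockSeq_le _ _) (norm_nonneg _) (by positivity)
  have h2 : ∑ k ∈ Finset.range K, inner ℝ (blockSeq x (k + 1)) (blockSeq v (k + 1)) ≤
      K * (‖x‖ * ‖v‖) :=
    sum_range_le_mul fun k _ => (le_abs_self _).trans (inner_blockSeq_le _ _ _ _)
  have h3 : ∑ k ∈ Finset.range K, crossWeight K δ k * (inner ℝ (blockSeq v k) (blockSeq x (k + 1)) +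
      inner ℝ (blockSeq x k) (blockSeq v (k + 1))) ≤ K * (2 * (‖x‖ * ‖v‖)) := by
    refine sum_range_le_mul fun k _ => ?_
    have h5 := (le_abs_self _).trans (inner_blockSeq_le v x k (k + 1))
    have h5' := (le_abs_self _).trans (inner_blockSeq_le x v k (k + 1))
    have h6 := crossWeight_le_one (K := K) hδ.le hδ1 k
    have h7 := crossWeight_pos (K := K) hδ k
    have h8 : inner ℝ (blockSeq v k) (blockSeq x (k + 1)) +
      inner ℝ (blockSeq x k) (blockSeq v (k + 1)) ≤ 2 * (‖x‖ * ‖v‖) := by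
      rw [mul_comm ‖v‖] at h5; linarith
    calc _ ≤ crossWeight K δ k * (2 * (‖x‖ * ‖v‖)) := mul_le_mul_of_nonneg_left h8 h7.le
      _ ≤ _ := mul_le_of_le_one_left (by positivity) h6
  unfold lyapunovDeriv
  linarith

lemma abs_sum_cross_le (hδ : 0 < δ) (hδ1 : δ ≤ 1) (x : State K d) :
    |∑ k ∈ Finset.range K, crossWeight K δ k * inner ℝ (blockSeq x k) (blockSeq x (k + 1))| ≤
      K * (δ * ‖x‖ ^ 2) := by
  refine (Finset.abs_sum_le_sum_abs _ _).trans (sum_range_le_mul fun k _ => ?_)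
  by_cases hk : k + 1 < K
  · rw [abs_mul, abs_of_pos (crossWeight_pos hδ k), sq]
    exact mul_le_mul (crossWeight_le hδ.le hδ1 hk) (inner_blockSeq_le x x k (k + 1))
      (abs_nonneg _) hδ.le
  · rw [blockSeq_of_le x (by omega : K ≤ k + 1), inner_zero_right, mul_zero, abs_zero]
    positivity

lemma lyapunov_ge [NeZero K] (hm : 0 < m) (hU : StronglyConvexSmooth U m L) (h0 : Centered U)
    (hδ : 0 < δ) (hδ1 : δ ≤ 1) (hsmall : K * δ ≤ min m 1 / 4) (x : State K d) :
    min m 1 / 4 * ‖x‖ ^ 2 ≤ lyapunov U δ x := by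
  have h1 := (hU 0 (blockSeq x 0)).1
  simp only [h0.1, h0.2, sub_zero, inner_zero_left] at h1
  have h2 := (abs_le.1 (abs_sum_cross_le hδ hδ1 x)).1
  obtain ⟨i, hi⟩ := exists_norm_eq_norm_apply x
  have hnn : ∀ k, 0 ≤ 1 / 2 * ‖blockSeq x (k + 1)‖ ^ 2 := fun k => by positivity
  have h3 : min m 1 / 2 * ‖x‖ ^ 2 ≤ m / 2 * ‖blockSeq x 0‖ ^ 2 +
      ∑ k ∈ Finset.range K, 1 / 2 * ‖blockSeq x (k + 1)‖ ^ 2 := by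
    rcases Nat.eq_zero_or_pos (i : ℕ) with hz | hz
    · have h4 : 0 ≤ ∑ k ∈ Finset.range K, 1 / 2 * ‖blockSeq x (k + 1)‖ ^ 2 :=
        Finset.sum_nonneg fun k _ => hnn k
      have h5 : ‖x‖ = ‖blockSeq x 0‖ := by
        rw [hi, ← blockSeq_val x i, hz]
      rw [h5]
      have := min_le_left m 1
      nlinarith [sq_nonneg ‖blockSeq x 0‖]
    · have h4 := Finset.single_le_sum (f := fun k => 1 / 2 * ‖blockSeq x (k + 1)‖ ^ 2)
        (fun k _ => hnn k) (Finset.mem_range.2 (by omega : (i : ℕ) - 1 < K))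
      have h5 : ‖x‖ = ‖blockSeq x ((i : ℕ) - 1 + 1)‖ := by
        rw [hi, ← blockSeq_val x i, Nat.sub_add_cancel hz]
      simp only [← h5] at h4
      have := min_le_right m 1
      have h6 : 0 ≤ m / 2 * ‖blockSeq x 0‖ ^ 2 := by positivity
      nlinarith [sq_nonneg ‖x‖]
  have h7 : (K : ℝ) * (δ * ‖x‖ ^ 2) ≤ min m 1 / 4 * ‖x‖ ^ 2 := by
    rw [← mul_assoc]; gcongr
  unfold lyapunov
  linarith

lemma lyapunov_le (hL : 0 ≤ L) (hU : StronglyConvexSmooth U m L) (h0 : Centered U)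
    (hδ : 0 < δ) (hδ1 : δ ≤ 1) (x : State K d) :
    lyapunov U δ x ≤ (L + 2 * K) * ‖x‖ ^ 2 := by
  have hz : (blockSeq (0 : State K d)) = fun _ => 0 := by
    funext k; simp [blockSeq]
  have h1 := lyapunov_add_le hL hU hδ hδ1 (0 : State K d) x
  have h2 : lyapunov U δ (0 : State K d) = 0 := by
    simp [lyapunov, hz, h0.2]
  have h3 : lyapunovDeriv U δ (0 : State K d) x = 0 := by
    simp [lyapunovDeriv, hz, h0.1]
  rw [zero_add, h2, h3] at h1
  linarith

/-- The dynamics without noise dissipates the energy through the last block only. -/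
lemma energy_dissipation [NeZero K] (hK : 2 ≤ K) (x : State K d) :
    inner ℝ (gradient U (blockSeq x 0)) (blockSeq (-drift γ (gradient U (x 0)) x) 0) +
      ∑ k ∈ Finset.range K, inner ℝ (blockSeq x (k + 1))
        (blockSeq (-drift γ (gradient U (x 0)) x) (k + 1)) = -γ * ‖blockSeq x (K - 1)‖ ^ 2 := by
  set F := -drift γ (gradient U (x 0)) x
  set q : ℕ → EuclideanSpace ℝ (Fin d) :=
    fun k => if k = 0 then gradient U (x 0) else blockSeq x k with hq
  have hq0 : q 0 = gradient U (x 0) := by simp [hq]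
  have hqk : ∀ k, k ≠ 0 → q k = blockSeq x k := fun k hk => by simp [hq, hk]
  -- Tested with the derivative `q` of the energy, the skew couplings telescope.
  have e1 : inner ℝ (gradient U (blockSeq x 0)) (blockSeq F 0) +
      ∑ k ∈ Finset.range K, inner ℝ (blockSeq x (k + 1)) (blockSeq F (k + 1)) =
      ∑ k ∈ Finset.range K, inner ℝ (q k) (blockSeq F k) := by
    have h1 := Finset.sum_range_succ' (fun k => inner ℝ (q k) (blockSeq F k)) K
    rw [Finset.sum_range_succ, blockSeq_of_le F le_rfl, inner_zero_right, add_zero] at h1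
    rw [h1, hq0, blockSeq_zero_index x, add_comm]
    congr 1
  set t : ℕ → ℝ := fun k => if k = 0 then 0 else coupling γ (k - 1) * inner ℝ (q (k - 1)) (q k)
    with ht
  have e2 : ∀ k ∈ Finset.range K, inner ℝ (q k) (blockSeq F k) = (t (k + 1) - t k) -
      (if k + 1 = K then γ * ‖q k‖ ^ 2 else 0) := by
    intro k hk
    rw [blockSeq_neg_drift γ (gradient U (x 0)) x (Finset.mem_range.1 hk) q hq0 hqk,
      inner_sub_right, inner_sub_right, inner_smul_right]
    congr 1
    · congr 1
      · by_cases h : k = 0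
        · simp [ht, h]
        · simp only [ht, h, if_false, inner_smul_right, real_inner_comm]
    · by_cases h : k + 1 = K
      · simp [h, inner_smul_right]
      · simp [h]
  rw [e1, Finset.sum_congr rfl e2, Finset.sum_sub_distrib, Finset.sum_range_sub]
  have e3 : t K = 0 := by
    simp only [ht]
    rw [if_neg (by omega), hqk K (by omega), blockSeq_of_le x le_rfl, inner_zero_right, mul_zero]
  have e4 : t 0 = 0 := by simp [ht]
  have e5 : ∑ k ∈ Finset.range K, (if k + 1 = K then γ * ‖q k‖ ^ 2 else 0) =
      γ * ‖blockSeq x (K - 1)‖ ^ 2 := by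
    rw [Finset.sum_eq_single (K - 1)]
    · rw [if_pos (by omega), hqk _ (by omega)]
    · intro b _ hb; rw [if_neg (by omega)]
    · intro h; exact absurd (Finset.mem_range.2 (by omega)) h
  rw [e3, e4, e5]
  ring

/-- The cross term of the blocks `k` and `k + 1` makes block `k` dissipate, up to terms that involve
other blocks. -/
lemma cross_dissipation [NeZero K] (hγ : 0 < γ) (hℓ : 1 ≤ ℓ)
    (hg : ∀ z, ‖gradient U z‖ ≤ ℓ * ‖z‖) (hm : ∀ z, m * ‖z‖ ^ 2 ≤ inner ℝ (gradient U z) z)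
    (x : State K d) {k : ℕ} (hk : k + 1 < K) :
    inner ℝ (blockSeq (-drift γ (gradient U (x 0)) x) k) (blockSeq x (k + 1)) +
      inner ℝ (blockSeq x k) (blockSeq (-drift γ (gradient U (x 0)) x) (k + 1)) ≤
      -min m γ * ‖blockSeq x k‖ ^ 2 + (1 + γ) * ℓ * (‖blockSeq x (k + 1)‖ ^ 2 +
        (if k = 0 then 0 else ‖blockSeq x (k - 1)‖ * ‖blockSeq x (k + 1)‖) +
        ‖blockSeq x k‖ * ‖blockSeq x (k + 2)‖ + ‖blockSeq x k‖ * ‖blockSeq x (k + 1)‖) := by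
  set F := -drift γ (gradient U (x 0)) x
  set q : ℕ → EuclideanSpace ℝ (Fin d) :=
    fun k => if k = 0 then gradient U (x 0) else blockSeq x k with hq
  have hq0 : q 0 = gradient U (x 0) := by simp [hq]
  have hqk : ∀ k, k ≠ 0 → q k = blockSeq x k := fun k hk => by simp [hq, hk]
  have hqs : ∀ k, q (k + 1) = blockSeq x (k + 1) := fun k => hqk _ (by omega)
  have hqle : ∀ k, ‖q k‖ ≤ ℓ * ‖blockSeq x k‖ := fun k => by
    by_cases h : k = 0
    · rw [h, hq0, ← blockSeq_zero_index x]; exact hg _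
    · rw [hqk k h]; exact le_mul_of_one_le_left (norm_nonneg _) hℓ
  have hα0 : ∀ k, 0 ≤ coupling γ k := fun k => by unfold coupling; split_ifs <;> linarith
  have hα : ∀ k, coupling γ k ≤ 1 + γ := fun k => by unfold coupling; split_ifs <;> linarith
  have hB : 1 + γ ≤ (1 + γ) * ℓ := le_mul_of_one_le_right (by linarith) hℓ
  rw [blockSeq_neg_drift γ (gradient U (x 0)) x (by omega : k < K) q hq0 hqk,
    blockSeq_neg_drift γ (gradient U (x 0)) x hk q hq0 hqk, if_neg (by omega : ¬ k + 1 = K),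
    if_neg (by omega : ¬ k + 1 = 0), sub_zero, Nat.add_sub_cancel, hqs, hqs, inner_sub_left,
    inner_sub_right, inner_sub_right, inner_smul_left, inner_smul_right, inner_smul_right,
    real_inner_self_eq_norm_sq]
  simp only [RCLike.conj_to_real]
  set n0 := ‖blockSeq x k‖ with hn0
  set n1 := ‖blockSeq x (k + 1)‖
  set n2 := ‖blockSeq x (k + 2)‖
  have p1 : 0 ≤ n1 := norm_nonneg _
  have f1 : coupling γ k * n1 ^ 2 ≤ (1 + γ) * ℓ * n1 ^ 2 := by
    gcongr; exact (hα k).trans hB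
  have f2 : -inner ℝ (if k = 0 then 0 else coupling γ (k - 1) • q (k - 1)) (blockSeq x (k + 1)) ≤
      (1 + γ) * ℓ * (if k = 0 then 0 else ‖blockSeq x (k - 1)‖ * n1) := by
    by_cases h : k = 0
    · simp [h]
    · rw [if_neg h, if_neg h, inner_smul_left, RCLike.conj_to_real]
      have h1 := (abs_real_inner_le_norm (q (k - 1)) (blockSeq x (k + 1))).trans
        (mul_le_mul_of_nonneg_right (hqle (k - 1)) p1)
      have h2 := (neg_le_abs _).trans h1
      calc _ = coupling γ (k - 1) * -inner ℝ (q (k - 1)) (blockSeq x (k + 1)) := by ring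
        _ ≤ coupling γ (k - 1) * (ℓ * ‖blockSeq x (k - 1)‖ * n1) :=
          mul_le_mul_of_nonneg_left h2 (hα0 _)
        _ ≤ (1 + γ) * (ℓ * ‖blockSeq x (k - 1)‖ * n1) :=
          mul_le_mul_of_nonneg_right (hα _) (by positivity)
        _ = _ := by ring
  have f3 : coupling γ (k + 1) * inner ℝ (blockSeq x k) (blockSeq x (k + 1 + 1)) ≤
      (1 + γ) * ℓ * (n0 * n2) := by
    have h1 := (le_abs_self _).trans
      (abs_real_inner_le_norm (blockSeq x k) (blockSeq x (k + 1 + 1)))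
    calc _ ≤ coupling γ (k + 1) * (n0 * n2) := mul_le_mul_of_nonneg_left h1 (hα0 _)
      _ ≤ _ := by gcongr; exact (hα _).trans hB
  have f4 : min m γ * n0 ^ 2 ≤ coupling γ k * inner ℝ (blockSeq x k) (q k) := by
    by_cases h : k = 0
    · have h1 := hm (blockSeq x 0)
      have h2 : coupling γ k = 1 := by simp [coupling, h]
      rw [h2, one_mul, hn0, h, hq0, real_inner_comm, ← blockSeq_zero_index x]
      exact (mul_le_mul_of_nonneg_right (min_le_left _ _) (sq_nonneg _)).trans h1
    · have h2 : coupling γ k = γ := by simp [coupling, h]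
      rw [h2, hqk k h, real_inner_self_eq_norm_sq]
      exact mul_le_mul_of_nonneg_right (min_le_right _ _) (sq_nonneg _)
  have f5 : -inner ℝ (blockSeq x k) (if k + 1 + 1 = K then γ • blockSeq x (k + 1) else 0) ≤
      (1 + γ) * ℓ * (n0 * n1) := by
    by_cases h : k + 1 + 1 = K
    · rw [if_pos h, inner_smul_right]
      have h1 := (neg_le_abs _).trans (abs_real_inner_le_norm (blockSeq x k) (blockSeq x (k + 1)))
      calc _ = γ * -inner ℝ (blockSeq x k) (blockSeq x (k + 1)) := by ring
        _ ≤ γ * (n0 * n1) := mul_le_mul_of_nonneg_left h1 hγ.le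
        _ ≤ _ := by gcongr; linarith
    · rw [if_neg h, inner_zero_right, neg_zero]
      have : 0 ≤ (1 + γ) * ℓ := by nlinarith
      positivity
  linarith

/-- The Lyapunov function decreases along the noiseless dynamics at a rate that does not depend on
the dimension. -/
lemma lyapunovDeriv_drift_le [NeZero K] (hK : 2 ≤ K) (hγ : 0 < γ) (hℓ : 1 ≤ ℓ)
    (hg : ∀ z, ‖gradient U z‖ ≤ ℓ * ‖z‖) (hm : ∀ z, m * ‖z‖ ^ 2 ≤ inner ℝ (gradient U z) z)
    (hm0 : 0 < m) (hδ : 0 < δ) (hδ1 : δ ≤ 1)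
    (hsmall : 4 * K * ((1 + γ) * ℓ) * δ ≤ min m γ / 2) (x : State K d) :
    lyapunovDeriv U δ x (-drift γ (gradient U (x 0)) x) ≤
      -(min m γ / 2 * δ ^ (K ^ 2)) * ‖x‖ ^ 2 := by
  have h1 := energy_dissipation (U := U) (γ := γ) hK x
  set F := -drift γ (gradient U (x 0)) x
  have hB : 0 ≤ (1 + γ) * ℓ := by nlinarith
  have h2 := sum_crossWeight_le hK hδ hδ1 hB (min_le_right m γ) hsmall
    (ξ := fun k => ‖blockSeq x k‖) (fun k hk => by simp [blockSeq_of_le x hk])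
  have h3 : ∑ k ∈ Finset.range K, crossWeight K δ k * (inner ℝ (blockSeq F k) (blockSeq x (k + 1)) +
      inner ℝ (blockSeq x k) (blockSeq F (k + 1))) ≤
      ∑ k ∈ Finset.range (K - 1), crossWeight K δ k * (-min m γ * ‖blockSeq x k‖ ^ 2 +
        (1 + γ) * ℓ * (‖blockSeq x (k + 1)‖ ^ 2 +
        (if k = 0 then 0 else ‖blockSeq x (k - 1)‖ * ‖blockSeq x (k + 1)‖) +
        ‖blockSeq x k‖ * ‖blockSeq x (k + 2)‖ + ‖blockSeq x k‖ * ‖blockSeq x (k + 1)‖)) := by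
    have hr : Finset.range K = Finset.range (K - 1 + 1) := by
      rw [Nat.sub_add_cancel (by omega : 1 ≤ K)]
    rw [hr, Finset.sum_range_succ, Nat.sub_add_cancel (by omega : 1 ≤ K), blockSeq_of_le x le_rfl,
      blockSeq_of_le F le_rfl, inner_zero_right, inner_zero_right, add_zero, mul_zero, add_zero]
    refine Finset.sum_le_sum fun k hk => ?_
    refine mul_le_mul_of_nonneg_left ?_ (crossWeight_pos hδ k).le
    exact cross_dissipation hγ hℓ hg hm x (by have := Finset.mem_range.1 hk; omega)
  have h4 : δ ^ (K ^ 2) * ‖x‖ ^ 2 ≤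
      ∑ k ∈ Finset.range K, crossWeight K δ k * ‖blockSeq x k‖ ^ 2 := by
    obtain ⟨i, hi⟩ := exists_norm_eq_norm_apply x
    have h5 := Finset.single_le_sum (f := fun k => crossWeight K δ k * ‖blockSeq x k‖ ^ 2)
      (fun k _ => mul_nonneg (crossWeight_pos hδ k).le (sq_nonneg _)) (Finset.mem_range.2 i.2)
    simp only [blockSeq_val, ← hi] at h5
    exact (mul_le_mul_of_nonneg_right (le_crossWeight hδ.le hδ1 i) (sq_nonneg _)).trans h5
  have h6 : 0 < min m γ := lt_min hm0 hγ
  have h7 := mul_le_mul_of_nonneg_left h4 (by linarith : 0 ≤ min m γ / 2)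
  unfold lyapunovDeriv
  rw [h1]
  linarith

lemma mul_le_quarter_mul_sq_add {Θ : ℝ} (hΘ : 0 < Θ) (s t : ℝ) :
    s * t ≤ Θ / 4 * s ^ 2 + t ^ 2 / Θ := by
  have e1 : Θ / 4 * s ^ 2 + t ^ 2 / Θ - s * t = Θ * (s / 2 - t / Θ) ^ 2 := by field_simp; ring
  have e2 : 0 ≤ Θ * (s / 2 - t / Θ) ^ 2 := by positivity
  linarith

/-- The Lyapunov function contracts along perturbed Euler steps, with constants that do not depend
on the dimension. -/
lemma exists_lyapunov_step {K : ℕ} [NeZero K] {γ m L ℓ C₁ : ℝ} (hK : 2 ≤ K) (hγ : 0 < γ)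
    (hm : 0 < m) (hL : 0 ≤ L) (hℓ : 1 ≤ ℓ) (hC₁ : 0 ≤ C₁) :
    ∃ h₁ cV lam C : ℝ, 0 < h₁ ∧ 0 < cV ∧ 0 < lam ∧ lam * h₁ ≤ 1 ∧ 0 ≤ C ∧
      ∀ (d : ℕ) (U : EuclideanSpace ℝ (Fin d) → ℝ), StronglyConvexSmooth U m L → Centered U →
      (∀ z, ‖gradient U z‖ ≤ ℓ * ‖z‖) → ∃ V : State K d → ℝ, V 0 ≤ 0 ∧
      (∀ x, cV * ‖x‖ ^ 2 ≤ V x) ∧ ∀ h, 0 < h → h ≤ h₁ → ∀ (u u' : State K d) (D : ℝ), 0 ≤ D →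
      ‖u' - (u - h • drift γ (gradient U (u 0)) u)‖ ≤ C₁ * h * (h * ‖u‖ + D) →
      V u' ≤ (1 - lam * h) * V u + lam * h * (C * D ^ 2) := by
  have hden : 0 < 8 * K * ((1 + γ) * ℓ) := by positivity
  -- The weight `δ` is small enough for the dissipation (`hs1`) and for the coercivity (`hs2`).
  set δ := min 1 (min (min m γ / (8 * K * ((1 + γ) * ℓ))) (min m 1 / (4 * K)))
  have hδ : 0 < δ := by
    refine lt_min one_pos (lt_min (by positivity) (by positivity))
  have hδ1 : δ ≤ 1 := min_le_left _ _
  have hs1 : 4 * K * ((1 + γ) * ℓ) * δ ≤ min m γ / 2 := by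
    have : δ ≤ min m γ / (8 * K * ((1 + γ) * ℓ)) := (min_le_right _ _).trans (min_le_left _ _)
    rw [le_div_iff₀ hden] at this
    linarith
  have hs2 : K * δ ≤ min m 1 / 4 := by
    have : δ ≤ min m 1 / (4 * K) := (min_le_right _ _).trans (min_le_right _ _)
    rw [le_div_iff₀ (by positivity)] at this
    linarith
  set Θ := min m γ / 2 * δ ^ (K ^ 2) with hΘ
  have hΘ0 : 0 < Θ := by positivity
  set Q := L + 2 * K with hQ
  have hQ0 : 0 < Q := by positivity
  set R := ℓ + 3 * K with hR
  have hR0 : 0 < R := by positivity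
  have ha := one_le_driftBound K γ
  set Fb := driftBound K γ * (ℓ + 1) with hFb
  set S := R * C₁ + 2 * Q * (Fb + C₁) ^ 2 + 1 with hS
  have hS0 : 0 < S := by positivity
  set lam := Θ / (2 * Q) with hlam
  have hlam0 : 0 < lam := by positivity
  clear_value δ Θ Q R Fb S lam
  refine ⟨min 1 (min (Θ / (4 * S)) (1 / lam)), min m 1 / 4, lam,
    ((R * C₁) ^ 2 / Θ + 2 * Q * C₁ ^ 2) / lam, by positivity, by positivity, hlam0, ?_,
    by positivity, fun d U hU h0 hg => ⟨lyapunov U δ, ?_, ?_, ?_⟩⟩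
  · have : min 1 (min (Θ / (4 * S)) (1 / lam)) ≤ 1 / lam :=
      (min_le_right _ _).trans (min_le_right _ _)
    rw [le_div_iff₀ hlam0] at this
    linarith
  · have := lyapunov_le hL hU h0 hδ hδ1 (0 : State K d)
    simpa using this
  · exact lyapunov_ge hm hU h0 hδ hδ1 hs2
  · intro h hh hh1 u u' D hD hu
    have hhle : h ≤ 1 := hh1.trans (min_le_left _ _)
    have hhS : h * S ≤ Θ / 4 := by
      have : h ≤ Θ / (4 * S) := hh1.trans ((min_le_right _ _).trans (min_le_left _ _))
      rw [le_div_iff₀ (by positivity)] at this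
      linarith
    set F := -drift γ (gradient U (u 0)) u with hF
    set e := u' - (u - h • drift γ (gradient U (u 0)) u) with he
    have hu' : u' = u + (h • F + e) := by rw [he, hF]; module
    have h2 := lyapunovDeriv_drift_le hK hγ hℓ hg (hU.inner_gradient_ge h0) hm hδ hδ1 hs1 u
    rw [← hF, ← hΘ] at h2
    have hFn : ‖F‖ ≤ Fb * ‖u‖ := by
      rw [hF, norm_neg]
      refine (norm_drift_le _ _).trans ?_
      rw [hFb, mul_assoc]
      refine mul_le_mul_of_nonneg_left ?_ (by linarith)
      have h1 := hg (u 0)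
      have h2 := mul_le_mul_of_nonneg_left (norm_le_pi_norm u 0) (by linarith : 0 ≤ ℓ)
      linarith
    have hv : ‖h • F + e‖ ≤ h * ((Fb + C₁) * ‖u‖ + C₁ * D) := by
      refine (norm_add_le _ _).trans ?_
      rw [norm_smul, Real.norm_of_nonneg hh.le]
      have h1 := mul_le_mul_of_nonneg_left hFn hh.le
      have h2 : C₁ * h * (h * ‖u‖) ≤ C₁ * h * (1 * ‖u‖) := by gcongr
      linarith
    have hv2 : ‖h • F + e‖ ^ 2 ≤ 2 * h ^ 2 * ((Fb + C₁) ^ 2 * ‖u‖ ^ 2 + C₁ ^ 2 * D ^ 2) := by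
      refine (pow_le_pow_left₀ (norm_nonneg _) hv 2).trans ?_
      nlinarith [mul_nonneg (sq_nonneg h) (sq_nonneg ((Fb + C₁) * ‖u‖ - C₁ * D))]
    have h1 := lyapunov_add_le hL hU hδ hδ1 u (h • F + e)
    rw [← hu', lyapunovDeriv_smul_add] at h1
    have h3 := lyapunovDeriv_le (by linarith) hg hδ hδ1 u e
    rw [← hR] at h3
    rw [← hQ] at h1
    clear_value F e
    have h4 : R * (‖u‖ * ‖e‖) ≤ R * (‖u‖ * (C₁ * h * (h * ‖u‖ + D))) := by gcongr
    have h5 := lyapunov_le hL hU h0 hδ hδ1 u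
    rw [← hQ] at h5
    have h6 : h * lyapunovDeriv U δ u F ≤ h * (-Θ * ‖u‖ ^ 2) := mul_le_mul_of_nonneg_left h2 hh.le
    have h7 := mul_le_mul_of_nonneg_left hv2 hQ0.le
    -- Young's inequality for the mixed term
    have h8 : ‖u‖ * (R * C₁ * D) ≤ Θ / 4 * ‖u‖ ^ 2 + (R * C₁) ^ 2 / Θ * D ^ 2 := by
      refine (mul_le_quarter_mul_sq_add hΘ0 ‖u‖ (R * C₁ * D)).trans_eq ?_
      rw [mul_pow _ D]; ring
    have h9 := mul_le_mul_of_nonneg_left h8 hh.le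
    have h10 : h * (h * S) * ‖u‖ ^ 2 ≤ h * (Θ / 4) * ‖u‖ ^ 2 := by gcongr
    have h11 : h ^ 2 * (2 * Q * C₁ ^ 2 * D ^ 2) ≤ h * (2 * Q * C₁ ^ 2 * D ^ 2) := by
      exact mul_le_mul_of_nonneg_right (pow_le_of_le_one hh.le hhle two_ne_zero) (by positivity)
    have h12 : h * (h * S) * ‖u‖ ^ 2 = h ^ 2 * (R * C₁ * ‖u‖ ^ 2) +
        h ^ 2 * (2 * Q * (Fb + C₁) ^ 2 * ‖u‖ ^ 2) + h ^ 2 * ‖u‖ ^ 2 := by rw [hS]; ring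
    have h13 : 0 ≤ h ^ 2 * ‖u‖ ^ 2 := by positivity
    have h14 : lam * h * lyapunov U δ u ≤ h * (Θ / 2) * ‖u‖ ^ 2 := by
      calc _ ≤ lam * h * (Q * ‖u‖ ^ 2) := by gcongr
        _ = _ := by rw [hlam]; field_simp
    have h15 : lam * h * (((R * C₁) ^ 2 / Θ + 2 * Q * C₁ ^ 2) / lam * D ^ 2) =
        h * ((R * C₁) ^ 2 / Θ * D ^ 2) + h * (2 * Q * C₁ ^ 2 * D ^ 2) := by
      rw [← mul_assoc, mul_right_comm lam h, mul_div_cancel₀ _ hlam0.ne']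
      ring
    rw [h15]
    linarith

end

/-! ### Pathwise growth of the algorithm -/

/-- The path `b` on the grid of step `h`. -/
def gridValue {K d : ℕ} (b : ℝ≥0 → State K d) (h : ℝ) (n : ℕ) : State K d :=
  b (Real.toNNReal (n * h))

/-- The path on the grid minus its average over the last `M` grid points (times before `0` are
replaced by `0`). For `M ≈ 1 / h` this process stays bounded in law, while its increments are those
of the path up to an error of order `h`. -/
def centeredNoise {K d : ℕ} (b : ℝ≥0 → State K d) (h : ℝ) (M n : ℕ) : State K d :=
  (M : ℝ)⁻¹ • ∑ j ∈ Finset.range M, (gridValue b h n - gridValue b h (n - (j + 1)))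

/-- The size of the forcing that is left in step `n` once `centeredNoise` has been subtracted from
the algorithm. -/
def forcing {K d : ℕ} (b : ℝ≥0 → State K d) (h : ℝ) (M n : ℕ) : ℝ :=
  ‖centeredNoise b h M n‖ + ‖gridValue b h n - gridValue b h (n - M)‖ +
    meanNorm h (stepNoise b h n)

section
variable {K d : ℕ} {b : ℝ≥0 → State K d} {h : ℝ}

lemma stepNoise_step (n : ℕ) :
    stepNoise b h n h = gridValue b h (n + 1) - gridValue b h n := by
  unfold stepNoise gridValue
  congr 3
  push_cast
  ring

lemma continuous_stepNoise (hb : Continuous b) (n : ℕ) : Continuous (stepNoise b h n) := by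
  unfold stepNoise
  fun_prop

lemma forcing_nonneg (hh : 0 < h) (M n : ℕ) : 0 ≤ forcing b h M n := by
  have := meanNorm_nonneg hh (stepNoise b h n)
  unfold forcing
  positivity

lemma centeredNoise_zero (M : ℕ) : centeredNoise b h M 0 = 0 := by
  simp [centeredNoise]

lemma centeredNoise_succ {M : ℕ} (hM : 0 < M) (n : ℕ) :
    centeredNoise b h M (n + 1) - centeredNoise b h M n = stepNoise b h n h -
      (M : ℝ)⁻¹ • (gridValue b h n - gridValue b h (n - M)) := by
  have hM' : (M : ℝ) ≠ 0 := by exact_mod_cast hM.ne'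
  have h1 := Finset.sum_range_sub' (fun j => gridValue b h (n - j)) M
  rw [Nat.sub_zero] at h1
  have h2 : ∀ j ∈ Finset.range M,
      (gridValue b h (n + 1) - gridValue b h (n + 1 - (j + 1))) -
        (gridValue b h n - gridValue b h (n - (j + 1))) =
      (gridValue b h (n + 1) - gridValue b h n) -
        (gridValue b h (n - j) - gridValue b h (n - (j + 1))) := by
    intro j _
    rw [Nat.add_sub_add_right]
    abel
  rw [centeredNoise, centeredNoise, ← smul_sub, ← Finset.sum_sub_distrib,
    Finset.sum_congr rfl h2, Finset.sum_sub_distrib, h1, Finset.sum_const, Finset.card_range,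
    smul_sub, ← Nat.cast_smul_eq_nsmul ℝ, smul_smul, inv_mul_cancel₀ hM', one_smul, stepNoise_step]

end

/-- The recursive averages `T (n + 1) = (1 - θ) T n + θ β n`, started at `0`. -/
def runningAverage (θ : ℝ) (β : ℕ → ℝ) : ℕ → ℝ
  | 0 => 0
  | n + 1 => (1 - θ) * runningAverage θ β n + θ * β n

lemma runningAverage_nonneg {θ : ℝ} (h0 : 0 ≤ θ) (h1 : θ ≤ 1) {β : ℕ → ℝ} (hβ : ∀ n, 0 ≤ β n)
    (n : ℕ) : 0 ≤ runningAverage θ β n := by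
  induction n with
  | zero => exact le_rfl
  | succ n ih =>
    exact add_nonneg (mul_nonneg (by linarith) ih) (mul_nonneg h0 (hβ n))

lemma runningAverage_const_mul (θ a : ℝ) (β : ℕ → ℝ) (n : ℕ) :
    runningAverage θ (fun k => a * β k) n = a * runningAverage θ β n := by
  induction n with
  | zero => simp [runningAverage]
  | succ n ih => simp only [runningAverage, ih]; ring

/-- Powers of a sequence that grows by averaging, by convexity of the power. -/
lemma pow_le_runningAverage {θ r : ℝ} (h0 : 0 ≤ θ) (h1 : θ ≤ 1) (hr : 1 ≤ r) {v b β : ℕ → ℝ}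
    (hv : ∀ n, 0 ≤ v n) (hv0 : v 0 = 0) (hb : ∀ n, 0 ≤ b n)
    (hstep : ∀ n, v (n + 1) ≤ r * ((1 - θ) * v n + θ * b n)) {q : ℕ} (hq : q ≠ 0)
    (hβ : ∀ n, b n ^ q ≤ β n) (n : ℕ) : v n ^ q ≤ r ^ (q * n) * runningAverage θ β n := by
  induction n with
  | zero => simp [hv0, hq, runningAverage]
  | succ n ih =>
    have hθ' : 0 ≤ 1 - θ := by linarith
    have hconv := (convexOn_pow q).2 (hv n) (hb n) hθ' h0 (by ring)
    simp only [smul_eq_mul] at hconv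
    have hrn : 1 ≤ r ^ (q * n) := one_le_pow₀ hr
    have hβ0 : 0 ≤ β n := (pow_nonneg (hb n) q).trans (hβ n)
    calc v (n + 1) ^ q ≤ (r * ((1 - θ) * v n + θ * b n)) ^ q :=
          pow_le_pow_left₀ (hv _) (hstep n) q
      _ = r ^ q * ((1 - θ) * v n + θ * b n) ^ q := mul_pow _ _ _
      _ ≤ r ^ q * ((1 - θ) * v n ^ q + θ * b n ^ q) := by gcongr
      _ ≤ r ^ q * ((1 - θ) * (r ^ (q * n) * runningAverage θ β n) + θ * (r ^ (q * n) * β n)) := by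
          gcongr
          exact (hβ n).trans (le_mul_of_one_le_left hβ0 hrn)
      _ = r ^ (q * (n + 1)) * runningAverage θ β (n + 1) := by
          simp only [runningAverage]; ring

lemma integrable_runningAverage {Ω : Type*} [MeasurableSpace Ω] {μ : Measure Ω} {θ Cβ : ℝ}
    (h0 : 0 ≤ θ) (h1 : θ ≤ 1) {β : ℕ → Ω → ℝ} (hβ : ∀ n, Integrable (β n) μ) (hC : 0 ≤ Cβ)
    (hβC : ∀ n, ∫ ω, β n ω ∂μ ≤ Cβ) (n : ℕ) :
    Integrable (fun ω => runningAverage θ (fun k => β k ω) n) μ ∧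
      ∫ ω, runningAverage θ (fun k => β k ω) n ∂μ ≤ Cβ := by
  induction n with
  | zero => simpa [runningAverage] using hC
  | succ n ih =>
    have i1 := ih.1.const_mul (1 - θ)
    have i2 := (hβ n).const_mul θ
    refine ⟨i1.add i2, ?_⟩
    simp only [runningAverage]
    rw [integral_add i1 i2, integral_const_mul, integral_const_mul]
    nlinarith [hβC n, ih.2]

section
variable {K d M : ℕ} [NeZero K] {γ : ℝ} {U : EuclideanSpace ℝ (Fin d) → ℝ} {c : Fin M → ℝ}
  {ℓ Lb h : ℝ} {b : ℝ≥0 → State K d}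

/-- The constant in `StepAssumptions.shifted_step`. -/
def shiftConstant (K : ℕ) (γ ℓ Lb : ℝ) : ℝ :=
  8 * driftBound K γ ^ 2 * (Lb * ℓ) ^ 2 * noiseBound K γ * noiseBound K γ +
    driftBound K γ * ℓ * noiseBound K γ + noiseBound K γ

lemma shiftConstant_nonneg (K : ℕ) (γ : ℝ) {ℓ : ℝ} (hℓ : 0 ≤ ℓ) (Lb : ℝ) :
    0 ≤ shiftConstant K γ ℓ Lb := by
  have := one_le_driftBound K γ
  have := one_le_noiseBound K γ
  unfold shiftConstant
  positivity

/-- The algorithm with the centered noise subtracted. -/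
def shiftedIterate (γ : ℝ) (U : EuclideanSpace ℝ (Fin d) → ℝ) (c : Fin M → ℝ) (h : ℝ) (ν : ℕ)
    (b : ℝ≥0 → State K d) (m n : ℕ) : State K d :=
  iterate γ U c h ν b n - blockMul (noiseMatrix K γ) (centeredNoise b h m n)

/-- After subtraction of the centered noise, the algorithm performs Euler steps of the noiseless
dynamics with a forcing of order `h`. No Brownian increment of size `√h` is left, so that growth can
be estimated path by path. -/
lemma StepAssumptions.shifted_step (H : StepAssumptions K γ U c ℓ Lb h) (hb : Continuous b) {m : ℕ}
    (hm : 0 < m) (hmh : (m : ℝ)⁻¹ ≤ h) (ν n : ℕ) :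
    ‖shiftedIterate γ U c h (ν + 1) b m (n + 1) - (shiftedIterate γ U c h (ν + 1) b m n -
      h • drift γ (gradient U (shiftedIterate γ U c h (ν + 1) b m n 0))
        (shiftedIterate γ U c h (ν + 1) b m n))‖ ≤
      shiftConstant K γ ℓ Lb * h *
        (h * ‖shiftedIterate γ U c h (ν + 1) b m n‖ + forcing b h m n) := by
  set y := iterate γ U c h (ν + 1) b n
  set z := centeredNoise b h m n with hz
  set z' := centeredNoise b h m (n + 1) with hz'
  set y' := iterate γ U c h (ν + 1) b (n + 1)
  set w := stepNoise b h n
  set G := noiseMatrix K γ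
  set g := gridValue b h n - gridValue b h (n - m)
  have hu : shiftedIterate γ U c h (ν + 1) b m n = y - blockMul G z := rfl
  have hu' : shiftedIterate γ U c h (ν + 1) b m (n + 1) = y' - blockMul G z' := rfl
  rw [hu, hu']
  set u := y - blockMul G z with hudef
  have hwc : ContinuousOn w (Icc 0 h) := (continuous_stepNoise hb n).continuousOn
  have h1 := H.euler_error_le hwc (H.discreteOp_spec hwc y (picard γ U c h w y ν))
    (fun t ht => H.picard_norm_sub_le hwc y ν ht)
  have h2 : discreteOp γ U c h w y (picard γ U c h w y ν) h = y' := rfl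
  rw [h2] at h1
  have ha := one_le_driftBound K γ
  have hbb := one_le_noiseBound K γ
  have hℓ := H.one_le_lip
  have hh := H.pos
  have hzz : blockMul G z' - blockMul G z = blockMul G (w h) - blockMul G ((m : ℝ)⁻¹ • g) := by
    rw [← blockMul_sub, ← blockMul_sub, hz, hz', centeredNoise_succ hm]
  have h3 : y' - blockMul G z' - (u - h • drift γ (gradient U (u 0)) u) =
      (y' - (y - h • drift γ (gradient U (y 0)) y + blockMul G (w h))) -
      h • drift γ (gradient U (y 0) - gradient U (u 0)) (y - u) +
      blockMul G ((m : ℝ)⁻¹ • g) := by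
    rw [drift_sub, smul_sub]
    have : blockMul G z' = blockMul G z + blockMul G (w h) - blockMul G ((m : ℝ)⁻¹ • g) := by
      rw [add_sub_assoc, ← hzz]; abel
    rw [this, hudef]
    abel
  have hyu : ‖y - u‖ ≤ noiseBound K γ * ‖z‖ := by
    rw [hudef, sub_sub_cancel]; exact norm_noise_le γ z
  have h4 : ‖h • drift γ (gradient U (y 0) - gradient U (u 0)) (y - u)‖ ≤
      h * (driftBound K γ * (ℓ * (noiseBound K γ * ‖z‖))) := by
    rw [norm_smul, Real.norm_of_nonneg hh.le]
    refine mul_le_mul_of_nonneg_left (norm_drift_le_of_le ?_ fun k _ => ?_) hh.le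
    · refine (H.lip _ _).trans (mul_le_mul_of_nonneg_left ?_ (by linarith))
      exact (norm_le_pi_norm (y - u) 0).trans hyu
    · exact ((norm_le_pi_norm (y - u) k).trans hyu).trans
        (le_mul_of_one_le_left (by positivity) hℓ)
  have h5 : ‖blockMul G ((m : ℝ)⁻¹ • g)‖ ≤ noiseBound K γ * (h * ‖g‖) := by
    refine (norm_noise_le γ _).trans (mul_le_mul_of_nonneg_left ?_ (by linarith))
    rw [norm_smul, norm_inv, Real.norm_natCast]
    exact mul_le_mul_of_nonneg_right hmh (norm_nonneg _)
  have h6 : ‖y‖ ≤ ‖u‖ + noiseBound K γ * ‖z‖ := by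
    have := norm_add_le u (y - u)
    rw [add_sub_cancel] at this
    linarith
  rw [h3]
  refine (norm_add_le _ _).trans ((add_le_add_left (norm_sub_le _ _) _).trans ?_)
  set e := 8 * driftBound K γ ^ 2 * (Lb * ℓ) ^ 2 * noiseBound K γ
  have hJ := meanNorm_nonneg hh w
  have h7 : e * h * (h * ‖y‖ + meanNorm h w) ≤
      e * noiseBound K γ * h * (h * ‖u‖ + ‖z‖ + meanNorm h w) := by
    have e1 : h * ‖y‖ + meanNorm h w ≤ noiseBound K γ * (h * ‖u‖ + ‖z‖ + meanNorm h w) := by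
      have f1 : h * ‖y‖ ≤ h * ‖u‖ + noiseBound K γ * ‖z‖ := by
        have : h * (noiseBound K γ * ‖z‖) ≤ 1 * (noiseBound K γ * ‖z‖) :=
          mul_le_mul_of_nonneg_right H.le_one (by positivity)
        have := mul_le_mul_of_nonneg_left h6 hh.le
        linarith
      have f2 : h * ‖u‖ ≤ noiseBound K γ * (h * ‖u‖) := le_mul_of_one_le_left (by positivity) hbb
      have f3 : meanNorm h w ≤ noiseBound K γ * meanNorm h w := le_mul_of_one_le_left hJ hbb
      linarith
    calc _ ≤ e * h * (noiseBound K γ * (h * ‖u‖ + ‖z‖ + meanNorm h w)) := by gcongr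
      _ = _ := by ring
  have h8 : forcing b h m n = ‖z‖ + ‖g‖ + meanNorm h w := rfl
  rw [h8]
  have h9 : shiftConstant K γ ℓ Lb = e * noiseBound K γ + driftBound K γ * ℓ * noiseBound K γ +
      noiseBound K γ := rfl
  rw [h9]
  have p1 : 0 ≤ e * noiseBound K γ * h * ‖g‖ := by positivity
  have p2 : 0 ≤ driftBound K γ * ℓ * noiseBound K γ * h * (h * ‖u‖ + ‖g‖ + meanNorm h w) := by
    positivity
  have p3 : 0 ≤ noiseBound K γ * h * (h * ‖u‖ + ‖z‖ + meanNorm h w) := by positivity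
  linarith

lemma shiftedIterate_zero (ν m : ℕ) :
    shiftedIterate γ U c h ν b m 0 = 0 := by
  have h0 : blockMul (noiseMatrix K γ) (0 : State K d) = 0 := by
    have := blockMul_smul (noiseMatrix K γ) 0 (0 : State K d)
    simpa using this
  rw [shiftedIterate, centeredNoise_zero, h0]
  simp [iterate]

/-- Growth over a bounded time, with constants that do not involve the convexity of `U`. -/
lemma StepAssumptions.shifted_pow_le_of_short (H : StepAssumptions K γ U c ℓ Lb h)
    (hb : Continuous b) {m : ℕ} (hm : 0 < m) (hmh : (m : ℝ)⁻¹ ≤ h) (ν : ℕ) {A : ℝ}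
    (hA : driftBound K γ * (ℓ + 1) + shiftConstant K γ ℓ Lb ≤ A)
    {q : ℕ} (hq : q ≠ 0) {β : ℕ → ℝ} (hβ : ∀ k, forcing b h m k ^ q ≤ β k) {n : ℕ}
    (hn : n * h ≤ 1) :
    ‖shiftedIterate γ U c h (ν + 1) b m n‖ ^ q ≤
      Real.exp (2 * A * q) * runningAverage (A * h / (1 + 2 * A * h)) β n := by
  have ha := one_le_driftBound K γ
  have hℓ := H.one_le_lip
  have hh := H.pos
  have hsc := shiftConstant_nonneg K γ (by linarith : 0 ≤ ℓ) Lb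
  have hda : 0 ≤ driftBound K γ * (ℓ + 1) := by positivity
  have hA0 : 0 ≤ A := by linarith
  have hAh : 0 ≤ A * h := by positivity
  have hθ0 : 0 ≤ A * h / (1 + 2 * A * h) := by positivity
  have hθ1 : A * h / (1 + 2 * A * h) ≤ 1 := by
    rw [div_le_one (by nlinarith)]; nlinarith
  have hβ0 : ∀ k, 0 ≤ β k := fun k => (pow_nonneg (forcing_nonneg hh m k) q).trans (hβ k)
  have key := pow_le_runningAverage hθ0 hθ1 (by nlinarith : 1 ≤ 1 + 2 * A * h)
    (v := fun n => ‖shiftedIterate γ U c h (ν + 1) b m n‖) (b := fun k => forcing b h m k)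
    (fun _ => norm_nonneg _) (by simp [shiftedIterate_zero]) (fun k => forcing_nonneg hh m k)
    (fun k => by
      have h1 := H.shifted_step hb hm hmh ν k
      set u := shiftedIterate γ U c h (ν + 1) b m k
      set u' := shiftedIterate γ U c h (ν + 1) b m (k + 1)
      have hf := forcing_nonneg (b := b) hh m k
      have h2 : ‖drift γ (gradient U (u 0)) u‖ ≤ driftBound K γ * (ℓ + 1) * ‖u‖ := by
        refine (norm_drift_le _ _).trans ?_
        rw [mul_assoc]
        refine mul_le_mul_of_nonneg_left ?_ (by linarith)
        have e1 := H.norm_gradient_le (u 0)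
        have e2 := mul_le_mul_of_nonneg_left (norm_le_pi_norm u 0) (by linarith : 0 ≤ ℓ)
        linarith
      have h3 : ‖u'‖ ≤ ‖u' - (u - h • drift γ (gradient U (u 0)) u)‖ +
          (‖u‖ + h * ‖drift γ (gradient U (u 0)) u‖) := by
        have e1 := norm_add_le (u' - (u - h • drift γ (gradient U (u 0)) u))
          (u - h • drift γ (gradient U (u 0)) u)
        rw [sub_add_cancel] at e1
        have e2 := norm_sub_le u (h • drift γ (gradient U (u 0)) u)
        rw [norm_smul, Real.norm_of_nonneg hh.le] at e2
        linarith
      have h4 : (1 + 2 * A * h) * ((1 - A * h / (1 + 2 * A * h)) * ‖u‖ +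
          A * h / (1 + 2 * A * h) * forcing b h m k) = ‖u‖ + A * h * ‖u‖ +
          A * h * forcing b h m k := by
        have : 1 + 2 * A * h ≠ 0 := by positivity
        field_simp
        ring
      rw [h4]
      have hn := norm_nonneg u
      have h5 := mul_le_mul_of_nonneg_left h2 hh.le
      have h6 : shiftConstant K γ ℓ Lb * h * (h * ‖u‖) ≤ shiftConstant K γ ℓ Lb * h * ‖u‖ := by
        refine mul_le_mul_of_nonneg_left ?_ (by positivity)
        exact mul_le_of_le_one_left hn H.le_one
      have h7 : (driftBound K γ * (ℓ + 1) + shiftConstant K γ ℓ Lb) * (h * ‖u‖) ≤ A * (h * ‖u‖) :=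
        mul_le_mul_of_nonneg_right hA (by positivity)
      have h8 : shiftConstant K γ ℓ Lb * (h * forcing b h m k) ≤ A * (h * forcing b h m k) :=
        mul_le_mul_of_nonneg_right (by linarith) (by positivity)
      linarith) hq hβ n
  refine key.trans (mul_le_mul_of_nonneg_right ?_ (runningAverage_nonneg hθ0 hθ1 hβ0 n))
  have h1 : 1 + 2 * A * h ≤ Real.exp (2 * A * h) := by
    have := Real.add_one_le_exp (2 * A * h); linarith
  calc (1 + 2 * A * h) ^ (q * n) ≤ Real.exp (2 * A * h) ^ (q * n) :=
        pow_le_pow_left₀ (by nlinarith) h1 _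
    _ = Real.exp (2 * A * q * (n * h)) := by
        rw [← Real.exp_nat_mul]; congr 1; push_cast; ring
    _ ≤ Real.exp (2 * A * q) := by
        refine Real.exp_le_exp.2 (mul_le_of_le_one_right (by positivity) hn)

/-- Growth over arbitrary times, by means of a Lyapunov function. -/
lemma StepAssumptions.shifted_pow_le_of_lyapunov (H : StepAssumptions K γ U c ℓ Lb h)
    (hb : Continuous b) {m : ℕ} (hm : 0 < m) (hmh : (m : ℝ)⁻¹ ≤ h) (ν : ℕ) {cV lam C : ℝ}
    (hcV : 0 < cV) (hlam : 0 < lam) (hlamh : lam * h ≤ 1) (hC : 0 ≤ C) {V : State K d → ℝ}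
    (hV0 : V 0 ≤ 0) (hV : ∀ x, cV * ‖x‖ ^ 2 ≤ V x)
    (hstep : ∀ (u u' : State K d) (D : ℝ), 0 ≤ D →
      ‖u' - (u - h • drift γ (gradient U (u 0)) u)‖ ≤
        shiftConstant K γ ℓ Lb * h * (h * ‖u‖ + D) →
      V u' ≤ (1 - lam * h) * V u + lam * h * (C * D ^ 2))
    {p : ℕ} (hp : p ≠ 0) {β : ℕ → ℝ} (hβ : ∀ k, forcing b h m k ^ (2 * p) ≤ β k) (n : ℕ) :
    ‖shiftedIterate γ U c h (ν + 1) b m n‖ ^ (2 * p) ≤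
      (C / cV) ^ p * runningAverage (lam * h) β n := by
  have hh := H.pos
  have hVn : ∀ x, 0 ≤ V x := fun x => (by positivity : 0 ≤ cV * ‖x‖ ^ 2).trans (hV x)
  have key := pow_le_runningAverage (θ := lam * h) (by positivity) hlamh le_rfl
    (v := fun n => V (shiftedIterate γ U c h (ν + 1) b m n))
    (b := fun k => C * forcing b h m k ^ 2) (β := fun k => C ^ p * β k)
    (fun _ => hVn _) (by
      simp only [shiftedIterate_zero]; exact le_antisymm hV0 (hVn 0))
    (fun k => by positivity) (fun k => by
      rw [one_mul]
      exact hstep _ _ _ (forcing_nonneg hh m k) (H.shifted_step hb hm hmh ν k)) hp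
    (fun k => by
      rw [mul_pow, ← pow_mul]
      exact mul_le_mul_of_nonneg_left (hβ k) (by positivity)) n
  rw [one_pow, one_mul, runningAverage_const_mul] at key
  have h1 := pow_le_pow_left₀ (by positivity) (hV (shiftedIterate γ U c h (ν + 1) b m n)) p
  rw [mul_pow, ← pow_mul] at h1
  rw [div_pow, div_mul_eq_mul_div, le_div_iff₀ (by positivity), mul_comm]
  exact h1.trans key

lemma iterate_zero_picard (n : ℕ) : iterate γ U c h 0 b n = 0 := by
  induction n with
  | zero => rfl
  | succ n ih => simpa [iterate, picard] using ih

lemma norm_iterate_le (ν m n : ℕ) : ‖iterate γ U c h ν b n‖ ≤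
    ‖shiftedIterate γ U c h ν b m n‖ + noiseBound K γ * ‖centeredNoise b h m n‖ := by
  have : iterate γ U c h ν b n = shiftedIterate γ U c h ν b m n +
      blockMul (noiseMatrix K γ) (centeredNoise b h m n) := by simp [shiftedIterate]
  rw [this]
  exact (norm_add_le _ _).trans (add_le_add_right (norm_noise_le γ _) _)

end

/-! ### Measurability of path functionals -/

lemma tendsto_of_le_add {α : Type*} {l : Filter α} {u e : α → ℝ≥0∞} {a : ℝ≥0∞} (ha : a ≠ ∞)
    (h1 : ∀ k, u k ≤ a + e k) (h2 : ∀ k, a ≤ u k + e k) (he : Filter.Tendsto e l (nhds 0)) :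
    Filter.Tendsto u l (nhds a) := by
  refine (ENNReal.tendsto_nhds ha).2 fun ε hε => ?_
  filter_upwards [(ENNReal.tendsto_nhds_zero.1 he) ε hε] with k hk
  exact ⟨tsub_le_iff_right.2 ((h2 k).trans (by gcongr)), (h1 k).trans (by gcongr)⟩

lemma tendsto_ofReal_const_mul {α : Type*} {l : Filter α} {e : α → ℝ} (C : ℝ)
    (he : Filter.Tendsto e l (nhds 0)) :
    Filter.Tendsto (fun k => ENNReal.ofReal (C * e k)) l (nhds 0) := by
  simpa using ENNReal.tendsto_ofReal (he.const_mul C)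

section
variable {E : Type*} [NormedAddCommGroup E] [NormedSpace ℝ E]

/-- The Bernstein polynomial on `[0, T]` with the values `v` at the nodes. -/
def bernsteinPath (T : ℝ) (k : ℕ) (v : Fin (k + 1) → E) (t : ℝ≥0) : E :=
  ∑ j : Fin (k + 1), bernstein k j (projIcc 0 1 zero_le_one ((t : ℝ) / T)) • v j

lemma continuous_bernsteinPath (T : ℝ) (k : ℕ) (v : Fin (k + 1) → E) :
    Continuous (bernsteinPath T k v) := by
  unfold bernsteinPath
  refine continuous_finsetSum _ fun j _ => Continuous.smul ?_ continuous_const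
  exact (bernstein k j).continuous.comp
    (continuous_projIcc.comp (NNReal.continuous_coe.div_const T))

lemma norm_bernsteinPath_sub_le (T : ℝ) (k : ℕ) (v v' : Fin (k + 1) → E) (t : ℝ≥0) :
    ‖bernsteinPath T k v t - bernsteinPath T k v' t‖ ≤ ‖v - v'‖ := by
  rw [bernsteinPath, bernsteinPath, ← Finset.sum_sub_distrib]
  simp only [← smul_sub]
  refine (norm_sum_le _ _).trans ?_
  have h1 : ∀ j ∈ (Finset.univ : Finset (Fin (k + 1))),
      ‖bernstein k j (projIcc 0 1 zero_le_one ((t : ℝ) / T)) • (v j - v' j)‖ ≤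
        bernstein k j (projIcc 0 1 zero_le_one ((t : ℝ) / T)) * ‖v - v'‖ := by
    intro j _
    rw [norm_smul, Real.norm_of_nonneg bernstein_nonneg]
    exact mul_le_mul_of_nonneg_left (norm_le_pi_norm (v - v') j) bernstein_nonneg
  refine (Finset.sum_le_sum h1).trans ?_
  rw [← Finset.sum_mul, bernstein.probability, one_mul]

/-- The nodes of `bernsteinPath`. -/
def bernsteinNode (T : ℝ) (k : ℕ) (j : Fin (k + 1)) : ℝ≥0 :=
  Real.toNNReal (T * (bernstein.z j : unitInterval))

lemma exists_bernsteinPath_error {T : ℝ} (hT : 0 < T) {b : ℝ≥0 → E} (hb : Continuous b) :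
    ∃ e : ℕ → ℝ, Filter.Tendsto e Filter.atTop (nhds 0) ∧ ∀ k, ∀ t : ℝ≥0, (t : ℝ) ≤ T →
      ‖b t - bernsteinPath T k (fun j => b (bernsteinNode T k j)) t‖ ≤ e k := by
  set f : C(unitInterval, E) := ⟨fun x => b (Real.toNNReal (T * x)), by fun_prop⟩
  have h1 := bernsteinApproximation_uniform f
  rw [tendsto_iff_dist_tendsto_zero] at h1
  refine ⟨_, h1, fun k t ht => ?_⟩
  have hmem : (t : ℝ) / T ∈ Icc (0 : ℝ) 1 := ⟨by positivity, (div_le_one hT).2 ht⟩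
  set x := projIcc (0 : ℝ) 1 zero_le_one ((t : ℝ) / T) with hx
  have h2 : bernsteinPath T k (fun j => b (bernsteinNode T k j)) t =
      bernsteinApproximation k f x := by
    rw [bernsteinApproximation.apply]
    rfl
  have h3 : b t = f x := by
    show b t = b (Real.toNNReal (T * x))
    rw [hx, projIcc_of_mem _ hmem, mul_div_cancel₀ _ hT.ne', Real.toNNReal_coe]
  rw [h2, h3, ← dist_eq_norm, dist_comm]
  exact ContinuousMap.dist_apply_le_dist x

/-- A functional of continuous paths which is Lipschitz in the supremum norm on `[0, T]` is a limit
of functions of finitely many values of the path. -/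
lemma aemeasurable_of_stable [SecondCountableTopology E] [MeasurableSpace E] [BorelSpace E]
    {Ω : Type*} [MeasurableSpace Ω] {μ : Measure Ω} {B : ℝ≥0 → Ω → E}
    (hB : ∀ t, AEMeasurable (B t) μ) (hc : ∀ᵐ ω ∂μ, Continuous fun t => B t ω)
    {F : (ℝ≥0 → E) → ℝ≥0∞} {T C : ℝ} (hT : 0 < T) (hF : ∀ b, Continuous b → F b ≠ ∞)
    (hstab : ∀ b b' η, Continuous b → Continuous b' →
      (∀ t : ℝ≥0, (t : ℝ) ≤ T → ‖b t - b' t‖ ≤ η) → F b ≤ F b' + ENNReal.ofReal (C * η)) :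
    AEMeasurable (fun ω => F fun t => B t ω) μ := by
  refine aemeasurable_of_tendsto_metrizable_ae (u := Filter.atTop)
    (f := fun k ω => F (bernsteinPath T k fun j => B (bernsteinNode T k j) ω)) (fun k => ?_) ?_
  · have hcont : Continuous fun v : Fin (k + 1) → E => F (bernsteinPath T k v) := by
      refine continuous_iff_continuousAt.2 fun v => ?_
      refine tendsto_of_le_add (hF _ (continuous_bernsteinPath T k v))
        (e := fun v' => ENNReal.ofReal (C * ‖v - v'‖)) (fun v' => ?_) (fun v' => ?_) ?_
      · exact hstab _ _ _ (continuous_bernsteinPath T k v') (continuous_bernsteinPath T k v)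
          fun t _ => by
            rw [norm_sub_rev]; exact norm_bernsteinPath_sub_le T k v v' t
      · exact hstab _ _ _ (continuous_bernsteinPath T k v) (continuous_bernsteinPath T k v')
          fun t _ => norm_bernsteinPath_sub_le T k v v' t
      · refine tendsto_ofReal_const_mul C ?_
        have : Continuous fun v' => ‖v - v'‖ := by fun_prop
        simpa using this.tendsto v
    exact hcont.measurable.comp_aemeasurable (aemeasurable_pi_lambda _ fun j => hB _)
  · filter_upwards [hc] with ω hω
    obtain ⟨e, he, hle⟩ := exists_bernsteinPath_error hT hω
    refine tendsto_of_le_add (hF _ hω) (e := fun k => ENNReal.ofReal (C * e k)) (fun k => ?_)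
      (fun k => ?_) (tendsto_ofReal_const_mul C he)
    · exact hstab _ _ _ (continuous_bernsteinPath T k _) hω fun t ht => by
        rw [norm_sub_rev]; exact hle k t ht
    · exact hstab _ _ _ hω (continuous_bernsteinPath T k _) fun t ht => hle k t ht

end

lemma norm_stepNoise_sub_le {K d : ℕ} {h : ℝ} {b b' : ℝ≥0 → State K d} {η : ℝ} {n k : ℕ}
    (hk : k ≤ n) (hh : 0 ≤ h) (hη : ∀ t : ℝ≥0, (t : ℝ) ≤ (n + 1) * h → ‖b t - b' t‖ ≤ η)
    {t : ℝ} (ht : t ∈ Icc 0 h) :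
    ‖stepNoise b h k t - stepNoise b' h k t‖ ≤ 2 * η := by
  have hk' : (k : ℝ) ≤ n := by exact_mod_cast hk
  have h1 : (k : ℝ) * h ≤ n * h := mul_le_mul_of_nonneg_right hk' hh
  have h0 : 0 ≤ (k : ℝ) * h := by positivity
  have e1 := hη (Real.toNNReal (k * h + t)) (by
    rw [Real.coe_toNNReal _ (add_nonneg h0 ht.1)]; linarith [ht.2])
  have e2 := hη (Real.toNNReal (k * h)) (by
    rw [Real.coe_toNNReal _ h0]; linarith)
  have e3 : stepNoise b h k t - stepNoise b' h k t =
      (b (Real.toNNReal (k * h + t)) - b' (Real.toNNReal (k * h + t))) -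
        (b (Real.toNNReal (k * h)) - b' (Real.toNNReal (k * h))) := by
    unfold stepNoise; abel
  rw [e3]
  exact (norm_sub_le _ _).trans (by linarith)

section
variable {K d M : ℕ} [NeZero K] {γ : ℝ} {U : EuclideanSpace ℝ (Fin d) → ℝ} {c : Fin M → ℝ}
  {ℓ Lb h : ℝ}

lemma StepAssumptions.norm_picard_sub_le (H : StepAssumptions K γ U c ℓ Lb h)
    {w w' : ℝ → State K d} (hw : ContinuousOn w (Icc 0 h)) (hw' : ContinuousOn w' (Icc 0 h))
    {y y' : State K d} {η : ℝ} (hη : ∀ t ∈ Icc 0 h, ‖w t - w' t‖ ≤ η) (hy : ‖y - y'‖ ≤ η)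
    (ν : ℕ) {t : ℝ} (ht : t ∈ Icc 0 h) :
    ‖picard γ U c h w y ν t - picard γ U c h w' y' ν t‖ ≤ 8 * noiseBound K γ * η := by
  have hbb := one_le_noiseBound K γ
  have hη0 : 0 ≤ η := (norm_nonneg _).trans hy
  induction ν generalizing t with
  | zero => exact hy.trans (by nlinarith)
  | succ ν ih =>
    have := H.stability hw hw' (H.discreteOp_spec hw y (picard γ U c h w y ν))
      (H.discreteOp_spec hw' y' (picard γ U c h w' y' ν)) hη hy (fun t ht => ih ht) ht
    exact this.trans (by linarith)

lemma StepAssumptions.norm_iterate_sub_le (H : StepAssumptions K γ U c ℓ Lb h)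
    {b b' : ℝ≥0 → State K d} (hb : Continuous b) (hb' : Continuous b') {η : ℝ} {n : ℕ}
    (hη : ∀ t : ℝ≥0, (t : ℝ) ≤ (n + 1) * h → ‖b t - b' t‖ ≤ η) (ν : ℕ) {k : ℕ} (hk : k ≤ n) :
    ‖iterate γ U c h ν b k - iterate γ U c h ν b' k‖ ≤ (8 * noiseBound K γ) ^ k * (2 * η) := by
  have hbb := one_le_noiseBound K γ
  have hh := H.pos
  have hη0 : 0 ≤ η := (norm_nonneg _).trans (hη 0 (by push_cast; positivity))
  induction k with
  | zero => simpa [iterate] using hη0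
  | succ k ih =>
    have hp : 1 ≤ (8 * noiseBound K γ) ^ k := one_le_pow₀ (by linarith)
    have := H.norm_picard_sub_le (continuous_stepNoise hb k).continuousOn
      (continuous_stepNoise hb' k).continuousOn (η := (8 * noiseBound K γ) ^ k * (2 * η))
      (fun t ht => (norm_stepNoise_sub_le (by omega) hh.le hη ht).trans
        (le_mul_of_one_le_left (by positivity) hp)) (ih (by omega)) ν (right_mem_Icc.2 hh.le)
    exact this.trans (le_of_eq (by ring))

lemma StepAssumptions.norm_stepFixedPath_sub_le (H : StepAssumptions K γ U c ℓ Lb h)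
    {b b' : ℝ≥0 → State K d} (hb : Continuous b) (hb' : Continuous b') {η : ℝ} {n : ℕ}
    (hη : ∀ t : ℝ≥0, (t : ℝ) ≤ (n + 1) * h → ‖b t - b' t‖ ≤ η) (ν : ℕ) {t : ℝ}
    (ht : t ∈ Icc 0 h) :
    ‖stepFixedPath γ U c h ν b n t - stepFixedPath γ U c h ν b' n t‖ ≤
      (8 * noiseBound K γ) ^ (n + 1) * (2 * η) := by
  have hbb := one_le_noiseBound K γ
  have hh := H.pos
  have hη0 : 0 ≤ η := (norm_nonneg _).trans (hη 0 (by push_cast; positivity))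
  have hp : 1 ≤ (8 * noiseBound K γ) ^ n := one_le_pow₀ (by linarith)
  have hw := (continuous_stepNoise (h := h) hb n).continuousOn (s := Icc 0 h)
  have hw' := (continuous_stepNoise (h := h) hb' n).continuousOn (s := Icc 0 h)
  have := H.fixed_stability hw hw' (H.fixedPath_spec hw (iterate γ U c h ν b n))
    (H.fixedPath_spec hw' (iterate γ U c h ν b' n)) (η := (8 * noiseBound K γ) ^ n * (2 * η))
    (fun t ht => (norm_stepNoise_sub_le le_rfl hh.le hη ht).trans
      (le_mul_of_one_le_left (by positivity) hp)) (H.norm_iterate_sub_le hb hb' hη ν le_rfl) ht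
  exact this.trans (le_of_eq (by ring))

/-- The interpolation error depends on the Brownian path in a measurable way. -/
lemma StepAssumptions.aemeasurable_interpolationError (H : StepAssumptions K γ U c ℓ Lb h)
    {Ω : Type*} [MeasurableSpace Ω] {μ : Measure Ω} {B : ℝ≥0 → Ω → State K d}
    (hB : ∀ t, AEMeasurable (B t) μ) (hc : ∀ᵐ ω ∂μ, Continuous fun t => B t ω) (ν n : ℕ) :
    AEMeasurable (fun ω => interpolationError U c h
      (stepFixedPath γ U c h ν (fun t => B t ω) n)) μ := by
  set e : (ℝ → State K d) → ℝ → EuclideanSpace ℝ (Fin d) := fun X s =>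
    gradient U (X s 0) - interpolant U c h X s with he
  have hh := H.pos
  have hℓ := H.one_le_lip
  have hsq : ∀ X, interpolationError U c h X = (⨆ s ∈ Icc (0 : ℝ) h, ‖e X s‖ₑ) ^ 2 := by
    intro X
    simp only [interpolationError, ENNReal.iSup_pow_of_ne_zero two_ne_zero, he]
  simp only [hsq]
  refine AEMeasurable.pow_const ?_ 2
  refine aemeasurable_of_stable (F := fun b => ⨆ s ∈ Icc (0 : ℝ) h,
      ‖e (stepFixedPath γ U c h ν b n) s‖ₑ) (T := (n + 1) * h)
    (C := (ℓ + Lb * ℓ) * ((8 * noiseBound K γ) ^ (n + 1) * 2)) hB hc (by positivity)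
    (fun b hb => ?_) (fun b b' η hb hb' hη => ?_)
  · have hw := (continuous_stepNoise (h := h) hb n).continuousOn (s := Icc 0 h)
    have hX : ContinuousOn (stepFixedPath γ U c h ν b n) (Icc 0 h) :=
      (H.fixedPath_spec hw (iterate γ U c h ν b n)).1
    have hg : Continuous (gradient U) :=
      (LipschitzWith.of_dist_le_mul (K := Real.toNNReal ℓ) fun x x' => by
        rw [dist_eq_norm, dist_eq_norm, Real.coe_toNNReal _ (by linarith)]
        exact H.lip x x').continuous
    have hec : ContinuousOn (e (stepFixedPath γ U c h ν b n)) (Icc 0 h) :=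
      (hg.comp_continuousOn ((continuous_apply 0).comp_continuousOn hX)).sub
        (continuous_interpolant U c h _).continuousOn
    obtain ⟨R, hR⟩ := isCompact_Icc.exists_bound_of_continuousOn hec
    refine ne_top_of_le_ne_top (ENNReal.ofReal_ne_top (r := R)) (iSup₂_le fun s hs => ?_)
    rw [← ofReal_norm]
    exact ENNReal.ofReal_le_ofReal (hR s hs)
  · refine iSup₂_le fun s hs => ?_
    have hX := fun t (ht : t ∈ Icc 0 h) =>
      (norm_le_pi_norm _ 0).trans (H.norm_stepFixedPath_sub_le hb hb' hη ν ht)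
    set X := stepFixedPath γ U c h ν b n
    set X' := stepFixedPath γ U c h ν b' n
    have h1 : ‖e X s - e X' s‖ ≤
        (ℓ + Lb * ℓ) * ((8 * noiseBound K γ) ^ (n + 1) * 2) * η := by
      have e1 : e X s - e X' s = (gradient U (X s 0) - gradient U (X' s 0)) -
          (interpolant U c h X s - interpolant U c h X' s) := by
        simp only [he]; abel
      have e2 := H.norm_interpolant_sub_le hX hs
      have e3 := (H.lip (X s 0) (X' s 0)).trans
        (mul_le_mul_of_nonneg_left (hX s hs) (by linarith))
      rw [e1]
      refine (norm_sub_le _ _).trans ((add_le_add e3 e2).trans (le_of_eq (by ring)))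
    calc ‖e X s‖ₑ = ‖e X' s + (e X s - e X' s)‖ₑ := by rw [add_sub_cancel]
      _ ≤ ‖e X' s‖ₑ + ‖e X s - e X' s‖ₑ := enorm_add_le _ _
      _ ≤ _ := by
        refine add_le_add (le_iSup₂ (f := fun s (_ : s ∈ Icc (0 : ℝ) h) => ‖e X' s‖ₑ) s hs) ?_
        rw [← ofReal_norm]
        exact ENNReal.ofReal_le_ofReal h1

end

/-! ### Moments of the noise -/

/-- The `q`-th power of an average of nonnegative numbers is at most the average of their `q`-th
powers. -/
lemma average_pow_le {ι : Type*} (s : Finset ι) {n : ℕ} (hs : s.card = n) (hn : 0 < n) {f : ι → ℝ}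
    (hf : ∀ i ∈ s, 0 ≤ f i) (q : ℕ) :
    ((n : ℝ)⁻¹ * ∑ i ∈ s, f i) ^ q ≤ (n : ℝ)⁻¹ * ∑ i ∈ s, f i ^ q := by
  have hn' : (n : ℝ) ≠ 0 := by exact_mod_cast hn.ne'
  rw [Finset.mul_sum, Finset.mul_sum]
  refine Real.pow_arith_mean_le_arith_mean_pow s (fun _ => (n : ℝ)⁻¹) f
    (fun _ _ => by positivity) ?_ hf q
  rw [Finset.sum_const, hs, nsmul_eq_mul, mul_inv_cancel₀ hn']

lemma add_add_pow_le {a b c : ℝ} (ha : 0 ≤ a) (hb : 0 ≤ b) (hc : 0 ≤ c) (q : ℕ) :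
    (a + b + c) ^ q ≤ 3 ^ q * (a ^ q + b ^ q + c ^ q) := by
  have h := average_pow_le (Finset.univ : Finset (Fin 3)) (n := 3) (by simp) (by norm_num)
    (f := ![a, b, c]) (fun i _ => by fin_cases i <;> simpa) q
  simp only [Fin.sum_univ_three, Matrix.cons_val_zero, Matrix.cons_val_one, Matrix.cons_val] at h
  have h1 : (a + b + c) ^ q = 3 ^ q * ((((3 : ℕ) : ℝ))⁻¹ * (a + b + c)) ^ q := by
    rw [← mul_pow]; congr 1; push_cast; ring
  rw [h1]
  refine mul_le_mul_of_nonneg_left (h.trans ?_) (by positivity)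
  have h2 : 0 ≤ a ^ q + b ^ q + c ^ q := by positivity
  push_cast
  linarith

/-- Powers of the norm of a state are controlled by its coordinates. The factor `d ^ p`, with an
average over the coordinates, is the source of the power of the dimension in the final bound. -/
lemma norm_pow_le_sum {K d : ℕ} (hK : 0 < K) (hd : 0 < d) (p : ℕ) (x : State K d) :
    ‖x‖ ^ (2 * p) ≤ ∑ k, (d : ℝ) ^ p * ((d : ℝ)⁻¹ * ∑ i, x k i ^ (2 * p)) := by
  have : NeZero K := ⟨hK.ne'⟩
  obtain ⟨k, hk⟩ := exists_norm_eq_norm_apply x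
  have hd' : (d : ℝ) ≠ 0 := by exact_mod_cast hd.ne'
  have hpos : ∀ k : Fin K, ∀ i, 0 ≤ x k i ^ (2 * p) := fun k i => (even_two_mul p).pow_nonneg _
  have h1 : ‖x k‖ ^ (2 * p) ≤ (d : ℝ) ^ p * ((d : ℝ)⁻¹ * ∑ i, x k i ^ (2 * p)) := by
    have e1 := average_pow_le (Finset.univ : Finset (Fin d)) (by simp) hd
      (f := fun i => x k i ^ 2) (fun i _ => sq_nonneg _) p
    simp only [← pow_mul] at e1
    rw [pow_mul, EuclideanSpace.real_norm_sq_eq]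
    have e2 : (∑ i, x k i ^ 2) ^ p = (d : ℝ) ^ p * ((d : ℝ)⁻¹ * ∑ i, x k i ^ 2) ^ p := by
      rw [← mul_pow, mul_inv_cancel_left₀ hd']
    rw [e2]
    exact mul_le_mul_of_nonneg_left e1 (by positivity)
  rw [hk]
  refine h1.trans ?_
  exact Finset.single_le_sum (f := fun k => (d : ℝ) ^ p * ((d : ℝ)⁻¹ * ∑ i, x k i ^ (2 * p)))
    (fun j _ => mul_nonneg (by positivity) (mul_nonneg (by positivity)
      (Finset.sum_nonneg fun i _ => hpos j i))) (Finset.mem_univ k)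

/-- The even moments of the standard normal distribution. -/
def gaussianMoment (p : ℕ) : ℝ := ∫ x, x ^ (2 * p) ∂gaussianReal 0 1

lemma gaussianMoment_nonneg (p : ℕ) : 0 ≤ gaussianMoment p :=
  integral_nonneg fun _ => (even_two_mul p).pow_nonneg _

lemma integrable_pow_gaussianReal (v : ℝ≥0) {p : ℕ} (hp : p ≠ 0) :
    Integrable (fun x => x ^ (2 * p)) (gaussianReal 0 v) := by
  have h := (memLp_id_gaussianReal (μ := 0) (v := v) ((2 * p : ℕ) : ℝ≥0)).integrable_norm_pow
    (by omega)
  simpa [(even_two_mul p).pow_abs] using h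

lemma integral_pow_gaussianReal (v : ℝ≥0) (p : ℕ) :
    ∫ x, x ^ (2 * p) ∂gaussianReal 0 v = (v : ℝ) ^ p * gaussianMoment p := by
  have h1 : gaussianReal 0 v = (gaussianReal 0 1).map (fun x => Real.sqrt v * x) := by
    rw [gaussianReal_map_const_mul, mul_zero, mul_one]
    congr
    ext
    exact (Real.sq_sqrt v.2).symm
  rw [h1, integral_map (by fun_prop) (by fun_prop), gaussianMoment, ← integral_const_mul]
  refine integral_congr_ae (Filter.Eventually.of_forall fun x => ?_)
  simp only [mul_pow]
  rw [pow_mul, Real.sq_sqrt v.coe_nonneg]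

section
variable {K d : ℕ} {Ω : Type*} [MeasurableSpace Ω] {μ : Measure Ω} {B : ℝ≥0 → Ω → State K d}

lemma IsBrownianMotion.aemeasurable (hB : IsBrownianMotion B μ) (t : ℝ≥0) :
    AEMeasurable (B t) μ := by
  refine aemeasurable_pi_lambda _ fun k => ?_
  have h1 : AEMeasurable (fun ω => WithLp.ofLp (B t ω k)) μ :=
    aemeasurable_pi_lambda _ fun i => (hB.1 k i).toIsPreBrownianReal.aemeasurable t
  exact (WithLp.measurable_toLp 2 _).comp_aemeasurable h1

lemma IsBrownianMotion.continuous_ae (hB : IsBrownianMotion B μ) :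
    ∀ᵐ ω ∂μ, Continuous fun t => B t ω := by
  have h1 : ∀ᵐ ω ∂μ, ∀ k i, Continuous fun t => B t ω k i :=
    ae_all_iff.2 fun k => ae_all_iff.2 fun i => (hB.1 k i).cont
  filter_upwards [h1] with ω hω
  refine continuous_pi fun k => ?_
  exact (PiLp.continuous_toLp 2 _).comp (continuous_pi fun i => hω k i)

/-- Moments of the Brownian increments over a time of at most `2`. -/
lemma IsBrownianMotion.increment_moment (hB : IsBrownianMotion B μ) (hK : 0 < K) (hd : 0 < d)
    {p : ℕ} (hp : p ≠ 0) {s t : ℝ≥0} (hst : dist s t ≤ 2) :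
    Integrable (fun ω => ‖B s ω - B t ω‖ ^ (2 * p)) μ ∧
      ∫ ω, ‖B s ω - B t ω‖ ^ (2 * p) ∂μ ≤ K * 2 ^ p * gaussianMoment p * (d : ℝ) ^ p := by
  have hd' : (d : ℝ) ≠ 0 := by exact_mod_cast hd.ne'
  have hG := gaussianMoment_nonneg p
  have hlaw := fun k i => (hB.1 k i).toIsPreBrownianReal.hasLaw_sub s t
  have hi : ∀ k i, Integrable (fun ω => (B s ω - B t ω) k i ^ (2 * p)) μ := by
    intro k i
    have h1 := integrable_pow_gaussianReal (nndist (s : ℝ) t) hp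
    have h2 := (hlaw k i).map_eq
    exact Integrable.comp_aemeasurable (h2.symm ▸ h1) (hlaw k i).aemeasurable
  have hle : ∀ k i, ∫ ω, (B s ω - B t ω) k i ^ (2 * p) ∂μ ≤ 2 ^ p * gaussianMoment p := by
    intro k i
    have h1 := (hlaw k i).integral_comp (f := fun x => x ^ (2 * p)) (by fun_prop)
    rw [integral_pow_gaussianReal] at h1
    refine (le_of_eq h1).trans (mul_le_mul_of_nonneg_right ?_ hG)
    exact pow_le_pow_left₀ (by positivity) hst p
  have hI : Integrable (fun ω => ∑ k, (d : ℝ) ^ p *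
      ((d : ℝ)⁻¹ * ∑ i, (B s ω - B t ω) k i ^ (2 * p))) μ :=
    integrable_finsetSum _ fun k _ => ((integrable_finsetSum _ fun i _ => hi k i).const_mul
      _).const_mul _
  have hpt := fun ω => norm_pow_le_sum hK hd p (B s ω - B t ω)
  have hint : Integrable (fun ω => ‖B s ω - B t ω‖ ^ (2 * p)) μ := by
    refine hI.mono' (((hB.aemeasurable s).sub (hB.aemeasurable t)).norm.pow_const
      _).aestronglyMeasurable (Filter.Eventually.of_forall fun ω => ?_)
    rw [Real.norm_of_nonneg (by positivity)]
    exact hpt ω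
  refine ⟨hint, (integral_mono hint hI hpt).trans ?_⟩
  rw [integral_finsetSum _ fun k _ => ((integrable_finsetSum _ fun i _ => hi k i).const_mul
      _).const_mul _]
  have h2 : ∀ k ∈ (Finset.univ : Finset (Fin K)), ∫ ω, (d : ℝ) ^ p *
      ((d : ℝ)⁻¹ * ∑ i, (B s ω - B t ω) k i ^ (2 * p)) ∂μ ≤
      (d : ℝ) ^ p * (2 ^ p * gaussianMoment p) := by
    intro k _
    rw [integral_const_mul, integral_const_mul, integral_finsetSum _ fun i _ => hi k i]
    refine mul_le_mul_of_nonneg_left ?_ (by positivity)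
    refine (mul_le_mul_of_nonneg_left (Finset.sum_le_sum fun i _ => hle k i)
      (by positivity)).trans (le_of_eq ?_)
    rw [Finset.sum_const, Finset.card_univ, Fintype.card_fin, nsmul_eq_mul,
      inv_mul_cancel_left₀ hd']
  refine (Finset.sum_le_sum h2).trans (le_of_eq ?_)
  rw [Finset.sum_const, Finset.card_univ, Fintype.card_fin, nsmul_eq_mul]
  ring

end

/-- The weights of the quadrature rule that integrates Bernstein polynomials exactly. -/
def bernsteinWeight (h : ℝ) (k : ℕ) (j : Fin (k + 1)) : ℝ :=
  h⁻¹ * ∫ s in (0 : ℝ)..h, bernstein k j (projIcc 0 1 zero_le_one ((Real.toNNReal s : ℝ) / h))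

section
variable {h : ℝ}

lemma continuous_bernstein_time (h : ℝ) (k : ℕ) (j : Fin (k + 1)) : Continuous fun s : ℝ =>
    bernstein k j (projIcc 0 1 zero_le_one ((Real.toNNReal s : ℝ) / h)) :=
  (bernstein k j).continuous.comp (continuous_projIcc.comp
    ((NNReal.continuous_coe.comp continuous_real_toNNReal).div_const h))

lemma bernsteinWeight_nonneg (hh : 0 < h) (k : ℕ) (j : Fin (k + 1)) :
    0 ≤ bernsteinWeight h k j :=
  mul_nonneg (by positivity) (intervalIntegral.integral_nonneg hh.le fun _ _ => bernstein_nonneg)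

lemma mean_bernsteinPath (h : ℝ) (k : ℕ) (v : Fin (k + 1) → ℝ) :
    h⁻¹ * ∫ s in (0 : ℝ)..h, bernsteinPath h k v (Real.toNNReal s) =
      ∑ j, bernsteinWeight h k j * v j := by
  have h1 : ∀ j ∈ (Finset.univ : Finset (Fin (k + 1))), IntervalIntegrable (fun s : ℝ =>
      bernstein k j (projIcc 0 1 zero_le_one ((Real.toNNReal s : ℝ) / h)) • v j) volume 0 h :=
    fun j _ => ((continuous_bernstein_time h k j).smul continuous_const).intervalIntegrable _ _
  simp only [bernsteinPath]
  rw [intervalIntegral.integral_finsetSum h1, Finset.mul_sum]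
  refine Finset.sum_congr rfl fun j _ => ?_
  rw [intervalIntegral.integral_smul_const, smul_eq_mul, ← mul_assoc]
  rfl

lemma sum_bernsteinWeight (hh : 0 < h) (k : ℕ) : ∑ j, bernsteinWeight h k j = 1 := by
  have h1 := mean_bernsteinPath h k (fun _ => 1)
  simp only [mul_one] at h1
  rw [← h1]
  simp [bernsteinPath, inv_mul_cancel₀ hh.ne']

/-- The time average of a continuous function is a limit of quadrature sums. -/
lemma tendsto_bernstein_quadrature (hh : 0 < h) {f : ℝ≥0 → ℝ} (hf : Continuous f) :
    Filter.Tendsto (fun k => ∑ j, bernsteinWeight h k j * f (bernsteinNode h k j)) Filter.atTop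
      (nhds (h⁻¹ * ∫ s in (0 : ℝ)..h, f (Real.toNNReal s))) := by
  obtain ⟨e, he, hle⟩ := exists_bernsteinPath_error hh hf
  refine tendsto_iff_norm_sub_tendsto_zero.2
    (squeeze_zero (fun _ => norm_nonneg _) (fun k => ?_) he)
  have i1 : IntervalIntegrable (fun s : ℝ => bernsteinPath h k
      (fun j => f (bernsteinNode h k j)) (Real.toNNReal s)) volume 0 h :=
    ((continuous_bernsteinPath h k _).comp continuous_real_toNNReal).intervalIntegrable _ _
  have i2 : IntervalIntegrable (fun s : ℝ => f (Real.toNNReal s)) volume 0 h :=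
    (hf.comp continuous_real_toNNReal).intervalIntegrable _ _
  rw [← mean_bernsteinPath, ← mul_sub, ← intervalIntegral.integral_sub i1 i2, norm_mul, norm_inv,
    Real.norm_of_nonneg hh.le]
  have h1 := intervalIntegral.norm_integral_le_of_norm_le_const (a := (0 : ℝ)) (b := h) (C := e k)
    (f := fun s => bernsteinPath h k (fun j => f (bernsteinNode h k j)) (Real.toNNReal s) -
      f (Real.toNNReal s)) (fun s hs => by
        rw [uIoc_of_le hh.le] at hs
        rw [norm_sub_rev]
        exact hle k _ (by rw [Real.coe_toNNReal _ hs.1.le]; exact hs.2))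
  rw [sub_zero, abs_of_pos hh] at h1
  calc _ ≤ h⁻¹ * (e k * h) := mul_le_mul_of_nonneg_left h1 (by positivity)
    _ = e k := by field_simp

/-- A moment of the time average of a nonnegative process is at most the largest moment of the
process. Fatou's lemma for quadrature sums avoids joint measurability in time and chance. -/
lemma mean_pow_moment {Ω : Type*} [MeasurableSpace Ω] {μ : Measure Ω} {Z : ℝ≥0 → Ω → ℝ}
    (hZm : ∀ t, AEMeasurable (Z t) μ) (hZc : ∀ᵐ ω ∂μ, Continuous fun t => Z t ω)
    (hZ0 : ∀ t ω, 0 ≤ Z t ω) (hh : 0 < h) {q : ℕ} {R : ℝ} (hR0 : 0 ≤ R)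
    (hR : ∀ t : ℝ≥0, (t : ℝ) ≤ h →
      Integrable (fun ω => Z t ω ^ q) μ ∧ ∫ ω, Z t ω ^ q ∂μ ≤ R) :
    Integrable (fun ω => (h⁻¹ * ∫ s in (0 : ℝ)..h, Z (Real.toNNReal s) ω) ^ q) μ ∧
      ∫ ω, (h⁻¹ * ∫ s in (0 : ℝ)..h, Z (Real.toNNReal s) ω) ^ q ∂μ ≤ R := by
  set J : Ω → ℝ := fun ω => h⁻¹ * ∫ s in (0 : ℝ)..h, Z (Real.toNNReal s) ω
  set Jk : ℕ → Ω → ℝ := fun k ω => ∑ j, bernsteinWeight h k j * Z (bernsteinNode h k j) ω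
  have hJ0 : ∀ ω, 0 ≤ J ω ^ q := fun ω => pow_nonneg (mul_nonneg (by positivity)
    (intervalIntegral.integral_nonneg hh.le fun s _ => hZ0 _ ω)) q
  have hJk0 : ∀ k ω, 0 ≤ Jk k ω := fun k ω => Finset.sum_nonneg fun j _ =>
    mul_nonneg (bernsteinWeight_nonneg hh k j) (hZ0 _ ω)
  have hlim : ∀ᵐ ω ∂μ, Filter.Tendsto (fun k => Jk k ω) Filter.atTop (nhds (J ω)) := by
    filter_upwards [hZc] with ω hω
    exact tendsto_bernstein_quadrature hh hω
  have hJkm : ∀ k, AEMeasurable (Jk k) μ := fun k =>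
    Finset.aemeasurable_fun_sum _ fun j _ => (hZm _).const_mul _
  have hJm : AEMeasurable J μ := aemeasurable_of_tendsto_metrizable_ae Filter.atTop hJkm hlim
  have hnode : ∀ k j, (bernsteinNode h k j : ℝ) ≤ h := by
    intro k j
    have h1 := (bernstein.z j).2
    rw [bernsteinNode, Real.coe_toNNReal _ (mul_nonneg hh.le h1.1)]
    exact mul_le_of_le_one_right hh.le h1.2
  have hk : ∀ k, ∫⁻ ω, ENNReal.ofReal (Jk k ω ^ q) ∂μ ≤ ENNReal.ofReal R := by
    intro k
    have hi : ∀ j ∈ (Finset.univ : Finset (Fin (k + 1))), Integrable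
        (fun ω => bernsteinWeight h k j * Z (bernsteinNode h k j) ω ^ q) μ :=
      fun j _ => (hR _ (hnode k j)).1.const_mul _
    have h1 : ∀ ω, Jk k ω ^ q ≤ ∑ j, bernsteinWeight h k j * Z (bernsteinNode h k j) ω ^ q :=
      fun ω => Real.pow_arith_mean_le_arith_mean_pow _ _ _
        (fun j _ => bernsteinWeight_nonneg hh k j) (sum_bernsteinWeight hh k)
        (fun j _ => hZ0 _ ω) q
    refine (lintegral_mono fun ω => ENNReal.ofReal_le_ofReal (h1 ω)).trans ?_
    rw [← ofReal_integral_eq_lintegral_ofReal (integrable_finsetSum _ hi)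
      (Filter.Eventually.of_forall fun ω => (pow_nonneg (hJk0 k ω) q).trans (h1 ω))]
    refine ENNReal.ofReal_le_ofReal ?_
    rw [integral_finsetSum _ hi]
    calc _ ≤ ∑ j, bernsteinWeight h k j * R := Finset.sum_le_sum fun j _ => by
          rw [integral_const_mul]
          exact mul_le_mul_of_nonneg_left (hR _ (hnode k j)).2 (bernsteinWeight_nonneg hh k j)
      _ = R := by rw [← Finset.sum_mul, sum_bernsteinWeight hh, one_mul]
  have hle : ∫⁻ ω, ENNReal.ofReal (J ω ^ q) ∂μ ≤ ENNReal.ofReal R := by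
    calc ∫⁻ ω, ENNReal.ofReal (J ω ^ q) ∂μ
        = ∫⁻ ω, Filter.liminf (fun k => ENNReal.ofReal (Jk k ω ^ q)) Filter.atTop ∂μ := by
          refine lintegral_congr_ae ?_
          filter_upwards [hlim] with ω hω
          exact (ENNReal.tendsto_ofReal (hω.pow q)).liminf_eq.symm
      _ ≤ Filter.liminf (fun k => ∫⁻ ω, ENNReal.ofReal (Jk k ω ^ q) ∂μ) Filter.atTop :=
          lintegral_liminf_le' fun k => ((hJkm k).pow_const q).ennreal_ofReal
      _ ≤ ENNReal.ofReal R := by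
          refine (Filter.liminf_le_liminf (Filter.Eventually.of_forall hk)).trans ?_
          simp
  have hJs : AEStronglyMeasurable (fun ω => J ω ^ q) μ := (hJm.pow_const q).aestronglyMeasurable
  refine ⟨(lintegral_ofReal_ne_top_iff_integrable hJs (Filter.Eventually.of_forall hJ0)).1
    (ne_top_of_le_ne_top ENNReal.ofReal_ne_top hle), ?_⟩
  rw [integral_eq_lintegral_of_nonneg_ae (Filter.Eventually.of_forall hJ0) hJs]
  exact ENNReal.toReal_le_of_le_ofReal hR0 hle

end

/-- The constant in `IsBrownianMotion.exists_forcing_majorant`. -/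
def forcingMoment (K p : ℕ) : ℝ := 3 ^ (2 * p) * (3 * (K * 2 ^ p * gaussianMoment p))

lemma forcingMoment_nonneg (K p : ℕ) : 0 ≤ forcingMoment K p := by
  have := gaussianMoment_nonneg p
  unfold forcingMoment
  positivity

lemma dist_gridTime_le {h : ℝ} (hh : 0 < h) {m : ℕ} (hmh : m * h ≤ 2) (n : ℕ) {j : ℕ}
    (hj : j ≤ m) :
    dist (Real.toNNReal (n * h)) (Real.toNNReal ((n - j : ℕ) * h)) ≤ 2 := by
  rw [NNReal.dist_eq, Real.coe_toNNReal _ (by positivity), Real.coe_toNNReal _ (by positivity),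
    ← sub_mul, abs_mul, abs_of_pos hh]
  refine le_trans (mul_le_mul_of_nonneg_right ?_ hh.le) hmh
  have h1 : n - j ≤ n := Nat.sub_le n j
  have h2 : n ≤ (n - j) + m := by omega
  have h1' : ((n - j : ℕ) : ℝ) ≤ n := by exact_mod_cast h1
  have h2' : (n : ℝ) ≤ ((n - j : ℕ) : ℝ) + m := by exact_mod_cast h2
  rw [abs_of_nonneg (by linarith)]
  linarith

/-- The powers of the forcing are dominated by integrable functions whose integrals are bounded
uniformly in time. -/
lemma IsBrownianMotion.exists_forcing_majorant {K d : ℕ} {Ω : Type*} [MeasurableSpace Ω]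
    {μ : Measure Ω} {B : ℝ≥0 → Ω → State K d} (hB : IsBrownianMotion B μ) (hK : 0 < K)
    (hd : 0 < d) {p : ℕ} (hp : p ≠ 0) {h : ℝ} (hh : 0 < h) (hh1 : h ≤ 1) {m : ℕ} (hm : 0 < m)
    (hmh : m * h ≤ 2) :
    ∃ β : ℕ → Ω → ℝ, (∀ n, Integrable (β n) μ) ∧
      (∀ n, ∫ ω, β n ω ∂μ ≤ forcingMoment K p * (d : ℝ) ^ p) ∧
      ∀ n ω, forcing (fun t => B t ω) h m n ^ (2 * p) ≤ β n ω := by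
  have hG := gaussianMoment_nonneg p
  set R := K * 2 ^ p * gaussianMoment p * (d : ℝ) ^ p with hR
  have hR0 : 0 ≤ R := by positivity
  have hm' : (m : ℝ) ≠ 0 := by exact_mod_cast hm.ne'
  set D : ℕ → ℕ → Ω → ℝ := fun n j ω =>
    ‖gridValue (fun t => B t ω) h n - gridValue (fun t => B t ω) h (n - j)‖ ^ (2 * p)
  have hDm : ∀ n j, j ≤ m → Integrable (D n j) μ ∧ ∫ ω, D n j ω ∂μ ≤ R := fun n j hj =>
    hB.increment_moment hK hd hp (dist_gridTime_le hh hmh n hj)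
  set J : ℕ → Ω → ℝ := fun n ω => meanNorm h (stepNoise (fun t => B t ω) h n) ^ (2 * p)
  have hJm : ∀ n, Integrable (J n) μ ∧ ∫ ω, J n ω ∂μ ≤ R := by
    intro n
    have h1 := mean_pow_moment (μ := μ)
      (Z := fun t ω => ‖stepNoise (fun t => B t ω) h n (t : ℝ)‖) (q := 2 * p) (R := R)
      (fun t => ((hB.aemeasurable _).sub (hB.aemeasurable _)).norm)
      (by
        filter_upwards [hB.continuous_ae] with ω hω
        exact ((continuous_stepNoise hω n).comp NNReal.continuous_coe).norm)
      (fun _ _ => norm_nonneg _) hh hR0 (fun t ht => hB.increment_moment hK hd hp (by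
        rw [NNReal.dist_eq, Real.coe_toNNReal _ (by positivity),
          Real.coe_toNNReal _ (by positivity), add_sub_cancel_left, abs_of_nonneg t.coe_nonneg]
        linarith))
    have h2 : ∀ ω, h⁻¹ * ∫ s in (0 : ℝ)..h,
        ‖stepNoise (fun t => B t ω) h n ((Real.toNNReal s : ℝ≥0) : ℝ)‖ =
        meanNorm h (stepNoise (fun t => B t ω) h n) := by
      intro ω
      rw [meanNorm]
      congr 1
      refine intervalIntegral.integral_congr fun s hs => ?_
      rw [uIcc_of_le hh.le] at hs
      simp only [Real.coe_toNNReal _ hs.1]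
    simp only [h2] at h1
    exact h1
  set S : ℕ → Ω → ℝ := fun n ω => (m : ℝ)⁻¹ * ∑ j ∈ Finset.range m, D n (j + 1) ω with hS
  have hSi : ∀ n, ∀ j ∈ Finset.range m, Integrable (D n (j + 1)) μ := fun n j hj =>
    (hDm n (j + 1) (by have := Finset.mem_range.1 hj; omega)).1
  have hSm : ∀ n, Integrable (S n) μ ∧ ∫ ω, S n ω ∂μ ≤ R := by
    intro n
    refine ⟨(integrable_finsetSum _ (hSi n)).const_mul _, ?_⟩
    simp only [hS]
    rw [integral_const_mul, integral_finsetSum _ (hSi n)]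
    have h1 : ∑ j ∈ Finset.range m, ∫ ω, D n (j + 1) ω ∂μ ≤ ∑ j ∈ Finset.range m, R :=
      Finset.sum_le_sum fun j hj =>
        (hDm n (j + 1) (by have := Finset.mem_range.1 hj; omega)).2
    rw [Finset.sum_const, Finset.card_range, nsmul_eq_mul] at h1
    calc _ ≤ (m : ℝ)⁻¹ * (m * R) := mul_le_mul_of_nonneg_left h1 (by positivity)
      _ = R := inv_mul_cancel_left₀ hm' R
  refine ⟨fun n ω => 3 ^ (2 * p) * (S n ω + D n m ω + J n ω), fun n => ?_, fun n => ?_,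
    fun n ω => ?_⟩
  · exact (((hSm n).1.add (hDm n m le_rfl).1).add (hJm n).1).const_mul _
  · have i1 : Integrable (fun ω => S n ω + D n m ω) μ := (hSm n).1.add (hDm n m le_rfl).1
    rw [integral_const_mul, integral_add i1 (hJm n).1, integral_add (hSm n).1 (hDm n m le_rfl).1]
    have e1 := (hSm n).2
    have e2 := (hDm n m le_rfl).2
    have e3 := (hJm n).2
    calc _ ≤ (3 : ℝ) ^ (2 * p) * (R + R + R) := by gcongr
      _ = _ := by rw [forcingMoment, hR]; ring
  · refine (add_add_pow_le (norm_nonneg _) (norm_nonneg _) (meanNorm_nonneg hh _) _).trans ?_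
    refine mul_le_mul_of_nonneg_left ?_ (by positivity)
    refine add_le_add_left (add_le_add_left ?_ _) _
    refine le_trans (pow_le_pow_left₀ (norm_nonneg _) ?_ _) (average_pow_le (Finset.range m)
      (Finset.card_range m) hm (f := fun j => ‖gridValue (fun t => B t ω) h n -
        gridValue (fun t => B t ω) h (n - (j + 1))‖) (fun _ _ => norm_nonneg _) (2 * p))
    rw [centeredNoise, norm_smul, norm_inv, Real.norm_natCast]
    exact mul_le_mul_of_nonneg_left (norm_sum_le _ _) (by positivity)

/-! ### The expected interpolation error -/

section
variable {K d M : ℕ} [NeZero K] {γ : ℝ} {U : EuclideanSpace ℝ (Fin d) → ℝ} {c : Fin M → ℝ}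
  {ℓ Lb h : ℝ}

/-- From a bound of the local error in terms of the starting point and the noise to a bound of the
expected interpolation error. The starting point enters through the size `v` of the shifted
iterate. -/
lemma StepAssumptions.lintegral_interpolationError_le (H : StepAssumptions K γ U c ℓ Lb h)
    {Ω : Type*} [MeasurableSpace Ω] {μ : Measure Ω} [IsProbabilityMeasure μ]
    {B : ℝ≥0 → Ω → State K d} (hB : IsBrownianMotion B μ) {p : ℕ} {C : ℝ}
    (hloc : ∀ (w : ℝ → State K d), ContinuousOn w (Icc 0 h) →
      ∀ (y : State K d) (Y : ℝ → State K d), SolvesStep γ U c h w y Y Y → ∀ s ∈ Icc 0 h,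
      ‖gradient U (Y s 0) - interpolant U c h Y s‖ ≤ C * (h * (1 + ‖y‖ + meanNorm h w)) ^ p)
    {m ν n : ℕ} {β T : Ω → ℝ} (hβ : Integrable β μ)
    (hβf : ∀ ω, forcing (fun t => B t ω) h m n ^ (2 * p) ≤ β ω) (hT : Integrable T μ)
    (hTv : ∀ᵐ ω ∂μ, ∃ v : ℝ, 0 ≤ v ∧ v ^ (2 * p) ≤ T ω ∧
      ‖iterate γ U c h ν (fun t => B t ω) n‖ ≤
        v + noiseBound K γ * forcing (fun t => B t ω) h m n) :
    ∫⁻ ω, interpolationError U c h (stepFixedPath γ U c h ν (fun t => B t ω) n) ∂μ ≤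
      ENNReal.ofReal (C ^ 2 * h ^ (2 * p) * (3 ^ (2 * p) *
        (1 + ∫ ω, T ω ∂μ + (noiseBound K γ + 1) ^ (2 * p) * ∫ ω, β ω ∂μ))) := by
  have hh := H.pos
  have hbb := one_le_noiseBound K γ
  set g : Ω → ℝ := fun ω => C ^ 2 * h ^ (2 * p) * (3 ^ (2 * p) *
    (1 + T ω + (noiseBound K γ + 1) ^ (2 * p) * β ω)) with hg
  have i1 : Integrable (fun ω => 1 + T ω) μ := (integrable_const 1).add hT
  have i2 : Integrable (fun ω => (noiseBound K γ + 1) ^ (2 * p) * β ω) μ := hβ.const_mul _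
  have hgi : Integrable g μ := ((i1.add i2).const_mul _).const_mul _
  have hgint : ∫ ω, g ω ∂μ = C ^ 2 * h ^ (2 * p) * (3 ^ (2 * p) *
      (1 + ∫ ω, T ω ∂μ + (noiseBound K γ + 1) ^ (2 * p) * ∫ ω, β ω ∂μ)) := by
    simp only [hg]
    rw [integral_const_mul, integral_const_mul, integral_add i1 i2, integral_add
      (integrable_const 1) hT, integral_const_mul]
    simp
  have hbound : ∀ᵐ ω ∂μ, 0 ≤ g ω ∧
      interpolationError U c h (stepFixedPath γ U c h ν (fun t => B t ω) n) ≤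
        ENNReal.ofReal (g ω) := by
    filter_upwards [hTv, hB.continuous_ae] with ω hω hcont
    obtain ⟨v, hv0, hvT, hy⟩ := hω
    have hw := (continuous_stepNoise (h := h) hcont n).continuousOn (s := Icc 0 h)
    have hf0 := forcing_nonneg (b := fun t => B t ω) hh m n
    have hJ : meanNorm h (stepNoise (fun t => B t ω) h n) ≤ forcing (fun t => B t ω) h m n := by
      rw [forcing]
      exact le_add_of_nonneg_left (by positivity)
    have hJ0 := meanNorm_nonneg hh (stepNoise (fun t => B t ω) h n)
    set y := iterate γ U c h ν (fun t => B t ω) n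
    set f := forcing (fun t => B t ω) h m n
    set J := meanNorm h (stepNoise (fun t => B t ω) h n)
    have hA : (1 + ‖y‖ + J) ^ (2 * p) ≤ 3 ^ (2 * p) *
        (1 + T ω + (noiseBound K γ + 1) ^ (2 * p) * β ω) := by
      have e1 : 1 + ‖y‖ + J ≤ 1 + v + (noiseBound K γ + 1) * f := by linarith
      refine (pow_le_pow_left₀ (by positivity) e1 _).trans
        ((add_add_pow_le zero_le_one hv0 (by positivity) _).trans ?_)
      rw [one_pow, mul_pow]
      gcongr
      exact hβf ω
    have hg0 : 0 ≤ g ω := by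
      have : 0 ≤ (1 + ‖y‖ + J) ^ (2 * p) := by positivity
      exact mul_nonneg (by positivity) (this.trans hA)
    refine ⟨hg0, iSup₂_le fun s hs => ?_⟩
    rw [← ofReal_norm, ← ENNReal.ofReal_pow (norm_nonneg _)]
    refine ENNReal.ofReal_le_ofReal ?_
    have h1 := hloc _ hw y _ (H.fixedPath_spec hw y) s hs
    calc ‖gradient U (stepFixedPath γ U c h ν (fun t => B t ω) n s 0) -
          interpolant U c h (stepFixedPath γ U c h ν (fun t => B t ω) n) s‖ ^ 2
        ≤ (C * (h * (1 + ‖y‖ + J)) ^ p) ^ 2 := pow_le_pow_left₀ (norm_nonneg _) h1 2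
      _ = C ^ 2 * h ^ (2 * p) * (1 + ‖y‖ + J) ^ (2 * p) := by
        rw [mul_pow, ← pow_mul, mul_comm p 2, mul_pow, mul_assoc]
      _ ≤ g ω := mul_le_mul_of_nonneg_left hA (by positivity)
  rw [← hgint, ofReal_integral_eq_lintegral_ofReal hgi (hbound.mono fun _ h => h.1)]
  exact lintegral_mono_ae (hbound.mono fun _ h => h.2)

/-- Either bound of the shifted iterates, over short times or through a Lyapunov function, gives
moments of the iterates that are of the order of the moments of the forcing. The running averages
have integrals bounded by those of the forcing. -/
lemma exists_iterate_majorant {Ω : Type*} [MeasurableSpace Ω] {μ : Measure Ω}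
    {B : ℝ≥0 → Ω → State K d} (hh : 0 < h) {p : ℕ} (hp : p ≠ 0) {m ν n : ℕ} {β : ℕ → Ω → ℝ}
    (hβ : ∀ k, Integrable (β k) μ) {R : ℝ} (hR : 0 ≤ R) (hβR : ∀ k, ∫ ω, β k ω ∂μ ≤ R)
    {a θ : ℝ} (ha : 0 ≤ a) (hθ0 : 0 ≤ θ) (hθ1 : θ ≤ 1)
    (hv : ∀ ν', ν = ν' + 1 → ∀ᵐ ω ∂μ,
      ‖shiftedIterate γ U c h ν (fun t => B t ω) m n‖ ^ (2 * p) ≤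
        a * runningAverage θ (fun k => β k ω) n) :
    ∃ T : Ω → ℝ, Integrable T μ ∧ ∫ ω, T ω ∂μ ≤ a * R ∧
      ∀ᵐ ω ∂μ, ∃ v : ℝ, 0 ≤ v ∧ v ^ (2 * p) ≤ T ω ∧
      ‖iterate γ U c h ν (fun t => B t ω) n‖ ≤
        v + noiseBound K γ * forcing (fun t => B t ω) h m n := by
  have hbb := one_le_noiseBound K γ
  rcases ν with _ | ν
  · -- Without Picard iterations the algorithm never moves.
    refine ⟨fun _ => 0, integrable_zero _ _ _, by simpa using mul_nonneg ha hR,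
      Filter.Eventually.of_forall fun ω => ⟨0, le_rfl, by simp [hp], ?_⟩⟩
    have hf0 := forcing_nonneg (b := fun t => B t ω) hh m n
    rw [iterate_zero_picard, norm_zero]
    positivity
  · obtain ⟨i1, i2⟩ := integrable_runningAverage hθ0 hθ1 hβ hR hβR n
    refine ⟨_, i1.const_mul a, ?_, ?_⟩
    · rw [integral_const_mul]
      exact mul_le_mul_of_nonneg_left i2 ha
    · filter_upwards [hv ν rfl] with ω hω
      refine ⟨_, norm_nonneg _, hω, (norm_iterate_le (ν + 1) m n).trans (add_le_add_right
        (mul_le_mul_of_nonneg_left ?_ (by linarith)) _)⟩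
      have hJ0 := meanNorm_nonneg hh (stepNoise (fun t => B t ω) h n)
      rw [forcing, add_assoc]
      exact le_add_of_nonneg_right (by positivity)

end

end HigherOrderLangevin

end

theorem lemma1
    (K : ℕ) [NeZero K] (hK : 2 ≤ K) (γ : ℝ) (hγ : 0 < γ)
    (c : Fin (K - 1) → ℝ) (hc : ∀ j, c j ∈ Set.Icc (0 : ℝ) 1)
    (hc_unif : ∃ a δ : ℝ, 0 < δ ∧ ∀ j : Fin (K - 1), c j = a + (j : ℕ) * δ)
    (Λ : Fin (K - 1) → ℝ) :
    ∃ C : ℝ, 0 < C ∧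
      ∀ m L : ℝ, 0 < m → m ≤ L →
        ∃ h₀ : ℝ, 0 < h₀ ∧
          ∀ (d : ℕ) (U : EuclideanSpace ℝ (Fin d) → ℝ),
            HigherOrderLangevin.StronglyConvexSmooth U m L →
            HigherOrderLangevin.HigherOrderSmooth K U Λ →
            HigherOrderLangevin.Centered U →
            ∀ (Ω : Type*) [MeasurableSpace Ω] (μ : Measure Ω) [IsProbabilityMeasure μ]
              (B : ℝ≥0 → Ω → HigherOrderLangevin.State K d),
              HigherOrderLangevin.IsBrownianMotion B μ →
              ∀ (ν N : ℕ) (h : ℝ), 0 < h → h ≤ h₀ →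
                ∀ n < N,
                  AEMeasurable (fun ω => HigherOrderLangevin.interpolationError U c h
                    (HigherOrderLangevin.stepFixedPath γ U c h ν (fun t => B t ω) n)) μ ∧
                  ∫⁻ ω, HigherOrderLangevin.interpolationError U c h
                    (HigherOrderLangevin.stepFixedPath γ U c h ν (fun t => B t ω) n) ∂μ
                  ≤ ENNReal.ofReal (C * N * h ^ (2 * K - 2) * (d : ℝ) ^ (K - 1)) := by
  open HigherOrderLangevin in
  obtain ⟨p, hp, hp1⟩ : ∃ p, K - 1 = p ∧ 0 < p := ⟨K - 1, rfl, by omega⟩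
  obtain ⟨Lb, hLb1, hLb⟩ := exists_lebesgue_constant c
  have hinj : Function.Injective c := by
    obtain ⟨a, δ, hδ, hcj⟩ := hc_unif
    intro i j hij
    rw [hcj, hcj, add_right_inj, mul_left_inj' hδ.ne'] at hij
    exact Fin.ext (by exact_mod_cast hij)
  set ℓ := 1 + |Λ ⟨0, by omega⟩|
  have hℓ1 : 1 ≤ ℓ := le_add_of_nonneg_right (abs_nonneg _)
  set Γ := ∑ i, |Λ i|
  have hΓ0 : 0 ≤ Γ := Finset.sum_nonneg fun _ _ => abs_nonneg _
  obtain ⟨C₀, hC₀, hloc⟩ := exists_local_error_bound (K := K) (γ := γ) (c := c) (Γ := Γ) (ℓ := ℓ)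
    (Lb := Lb) (by omega) (by omega) hΓ0 hℓ1 hLb1
  have ha := one_le_driftBound K γ
  have hbb := one_le_noiseBound K γ
  have hS := shiftConstant_nonneg K γ (by linarith : 0 ≤ ℓ) Lb
  have hF := forcingMoment_nonneg K p
  set S := shiftConstant K γ ℓ Lb
  set F := forcingMoment K p
  set A := driftBound K γ * (ℓ + 1) + S
  set E₁ := Real.exp (2 * A * (2 * p : ℕ))
  have hE₁0 : 0 < E₁ := Real.exp_pos _
  set W := 1 + (E₁ + 1) * F + (noiseBound K γ + 1) ^ (2 * p) * F with hWdef
  refine ⟨C₀ ^ 2 * 3 ^ (2 * p) * W + 1, by positivity, fun m L hm hmL => ?_⟩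
  obtain ⟨h₁, cV, lam, Cl, hh₁, hcV, hlam, hlamh, hCl, hlyap⟩ := exists_lyapunov_step (K := K)
    (γ := γ) (m := m) (L := L) (ℓ := ℓ) (C₁ := S) hK hγ hm (hm.le.trans hmL) hℓ1 hS
  set G := (Cl / cV) ^ p
  have hG0 : 0 ≤ G := by positivity
  have hden : 0 < 8 * driftBound K γ * (Lb * ℓ) := by positivity
  -- The condition `h ≤ 1 / (G + 1)` makes `N ≥ G` when `N h > 1`: this is how a constant
  -- that depends on `m` and `L` is absorbed into the factor `N`.
  refine ⟨min (min 1 (1 / (8 * driftBound K γ * (Lb * ℓ)))) (min h₁ (1 / (G + 1))),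
    lt_min (lt_min one_pos (by positivity)) (lt_min hh₁ (by positivity)), ?_⟩
  intro d U hconv hsm hcen Ω _ μ _ B hB ν N h hh hhle n hn
  obtain ⟨⟨hh1, hhs⟩, hhl, hhG⟩ := by simpa only [le_min_iff] using hhle
  rw [le_div_iff₀ hden] at hhs
  rw [le_div_iff₀ (by positivity)] at hhG
  have H : StepAssumptions K γ U c ℓ Lb h :=
    { two_le := hK
      nodes_pos := by omega
      nodes_mem := hc
      nodes_inj := hinj
      lebesgue := hLb
      one_le_lebesgue := hLb1
      one_le_lip := hℓ1
      lip := fun x x' => (hsm.norm_gradient_sub_le hK x x').trans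
        (mul_le_mul_of_nonneg_right ((le_abs_self _).trans (le_add_of_nonneg_left zero_le_one))
          (norm_nonneg _))
      grad_zero := hcen.1
      pos := hh
      le_one := hh1
      small := by linarith }
  refine ⟨H.aemeasurable_interpolationError hB.aemeasurable hB.continuous_ae ν n, ?_⟩
  have hN1 : (1 : ℝ) ≤ N := by exact_mod_cast (by omega : 1 ≤ N)
  have hnN : (n : ℝ) ≤ N := by exact_mod_cast hn.le
  have hpow : (d : ℝ) ^ (K - 1) = (d : ℝ) ^ p := by rw [hp]
  rw [show 2 * K - 2 = 2 * p by omega, hpow]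
  rcases Nat.eq_zero_or_pos d with rfl | hd
  · -- In dimension zero the interpolation error vanishes.
    have h0 : ∀ ω, interpolationError U c h
        (stepFixedPath γ U c h ν (fun t => B t ω) n) = 0 := by
      intro ω
      refine le_antisymm (iSup₂_le fun s _ => ?_) zero_le
      rw [Subsingleton.elim (gradient U (stepFixedPath γ U c h ν (fun t => B t ω) n s 0) -
        interpolant U c h (stepFixedPath γ U c h ν (fun t => B t ω) n) s) 0]
      simp
    simp [h0]
  have hd1 : (1 : ℝ) ≤ (d : ℝ) ^ p := one_le_pow₀ (by exact_mod_cast hd)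
  set k := ⌈h⁻¹⌉₊
  have hk0 : 0 < k := Nat.ceil_pos.2 (by positivity)
  have hkh : (k : ℝ)⁻¹ ≤ h := inv_le_of_inv_le₀ hh (Nat.le_ceil _)
  have hkh2 : k * h ≤ 2 := by
    have h1 := (Nat.ceil_lt_add_one (by positivity : (0 : ℝ) ≤ h⁻¹)).le
    calc k * h ≤ (h⁻¹ + 1) * h := mul_le_mul_of_nonneg_right h1 hh.le
      _ = 1 + h := by rw [add_mul, inv_mul_cancel₀ hh.ne', one_mul]
      _ ≤ 2 := by linarith
  obtain ⟨β, hβi, hβR, hβf⟩ := hB.exists_forcing_majorant (by omega) hd hp1.ne' hh hh1 hk0 hkh2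
  have hR0 : 0 ≤ F * (d : ℝ) ^ p := by positivity
  obtain ⟨T, hTi, hTR, hTv⟩ : ∃ T : Ω → ℝ, Integrable T μ ∧
      ∫ ω, T ω ∂μ ≤ N * ((E₁ + 1) * F * (d : ℝ) ^ p) ∧ ∀ᵐ ω ∂μ, ∃ v : ℝ, 0 ≤ v ∧
      v ^ (2 * p) ≤ T ω ∧ ‖iterate γ U c h ν (fun t => B t ω) n‖ ≤
        v + noiseBound K γ * forcing (fun t => B t ω) h k n := by
    rcases le_or_gt (N * h) 1 with hNh | hNh
    · have hθ0 : 0 ≤ A * h / (1 + 2 * A * h) := by positivity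
      have hθ1 : A * h / (1 + 2 * A * h) ≤ 1 := by
        have : 0 ≤ A * h := by positivity
        rw [div_le_one (by linarith)]
        linarith
      obtain ⟨T, hTi, hTR, hTv⟩ := exists_iterate_majorant (γ := γ) (U := U) (c := c) (m := k)
        (ν := ν) (n := n) hh hp1.ne' hβi hR0 hβR hE₁0.le hθ0 hθ1 fun ν' hν => by
          filter_upwards [hB.continuous_ae] with ω hω
          rw [hν]
          exact H.shifted_pow_le_of_short hω hk0 hkh ν' le_rfl (by omega) (fun k => hβf k ω)
            ((mul_le_mul_of_nonneg_right hnN hh.le).trans hNh)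
      refine ⟨T, hTi, hTR.trans ?_, hTv⟩
      have e1 : E₁ * (F * (d : ℝ) ^ p) ≤ (E₁ + 1) * F * (d : ℝ) ^ p := by linarith
      exact e1.trans (le_mul_of_one_le_left (by positivity) hN1)
    · obtain ⟨V, hV0, hV, hstep⟩ := hlyap d U hconv hcen H.norm_gradient_le
      have hlamh' : lam * h ≤ 1 := (mul_le_mul_of_nonneg_left hhl hlam.le).trans hlamh
      obtain ⟨T, hTi, hTR, hTv⟩ := exists_iterate_majorant (γ := γ) (U := U) (c := c) (m := k)
        (ν := ν) (n := n) hh hp1.ne' hβi hR0 hβR hG0 (by positivity) hlamh' fun ν' hν => by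
          filter_upwards [hB.continuous_ae] with ω hω
          rw [hν]
          exact H.shifted_pow_le_of_lyapunov hω hk0 hkh ν' hcV hlam hlamh' hCl hV0 hV
            (hstep h hh hhl) hp1.ne' (fun k => hβf k ω) n
      refine ⟨T, hTi, hTR.trans ?_, hTv⟩
      have hGN : G ≤ N := by
        have : (G + 1) * h ≤ N * h := by linarith
        linarith [le_of_mul_le_mul_right this hh]
      have e1 : F * (d : ℝ) ^ p ≤ (E₁ + 1) * F * (d : ℝ) ^ p := by
        have : 0 ≤ E₁ * (F * (d : ℝ) ^ p) := by positivity
        linarith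
      exact mul_le_mul hGN e1 hR0 (by linarith)
  have hloc' := hloc d U h H (contDiff_gradient (by
      rw [show K - 1 + 1 = K by omega]; exact hsm.1)) (fun i hi hiM z => by
      obtain ⟨j, rfl⟩ : ∃ j, i = j + 1 := ⟨i - 1, by omega⟩
      exact (hsm.2 ⟨j, by omega⟩ z).trans ((le_abs_self _).trans
        (Finset.single_le_sum (f := fun i => |Λ i|) (fun _ _ => abs_nonneg _)
          (Finset.mem_univ _))))
  refine (H.lintegral_interpolationError_le hB (fun w hw y Y hY s hs =>
      (hloc' w hw y Y hY s hs).trans_eq (by rw [hp])) (hβi n) (hβf n) hTi hTv).trans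
    (ENNReal.ofReal_le_ofReal ?_)
  have hfin : 1 + ∫ ω, T ω ∂μ + (noiseBound K γ + 1) ^ (2 * p) * ∫ ω, β n ω ∂μ ≤
      N * (d : ℝ) ^ p * W := by
    have hNd : 1 ≤ N * (d : ℝ) ^ p := one_le_mul_of_one_le_of_one_le hN1 hd1
    have e1 : (noiseBound K γ + 1) ^ (2 * p) * ∫ ω, β n ω ∂μ ≤
        (noiseBound K γ + 1) ^ (2 * p) * (F * (d : ℝ) ^ p) :=
      mul_le_mul_of_nonneg_left (hβR n) (by positivity)
    have e2 : (noiseBound K γ + 1) ^ (2 * p) * (F * (d : ℝ) ^ p) ≤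
        N * ((noiseBound K γ + 1) ^ (2 * p) * (F * (d : ℝ) ^ p)) :=
      le_mul_of_one_le_left (by positivity) hN1
    calc _ ≤ N * (d : ℝ) ^ p + N * ((E₁ + 1) * F * (d : ℝ) ^ p) +
          N * ((noiseBound K γ + 1) ^ (2 * p) * (F * (d : ℝ) ^ p)) := by linarith
      _ = _ := by rw [hWdef]; ring
  calc C₀ ^ 2 * h ^ (2 * p) * (3 ^ (2 * p) * (1 + ∫ ω, T ω ∂μ +
        (noiseBound K γ + 1) ^ (2 * p) * ∫ ω, β n ω ∂μ))
      ≤ C₀ ^ 2 * h ^ (2 * p) * (3 ^ (2 * p) * (N * (d : ℝ) ^ p * W)) := by gcongr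
    _ = C₀ ^ 2 * 3 ^ (2 * p) * W * (N * h ^ (2 * p) * (d : ℝ) ^ p) := by ring
    _ ≤ (C₀ ^ 2 * 3 ^ (2 * p) * W + 1) * (N * h ^ (2 * p) * (d : ℝ) ^ p) :=
        mul_le_mul_of_nonneg_right (by linarith) (by positivity)
    _ = _ := by ring
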